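/- Let $N\ge 2$ be an integer, $\sigma_1,\sigma_2>-2$, $p>1$, $\varrho>-1$, $u_0\in L^1_{\mathrm{loc}}(\mathbb{R}^N)$ and $w\in L^1(\mathbb{R}^N)$ with $\int_{\mathbb{R}^N}w(x)\,dx>0$. Consider the problem $$|x|^{\sigma_1}u_t=\Delta u+|x|^{\sigma_2}|u|^p+t^{\varrho}w(x)\quad\text{in }(0,\infty)\times\mathbb{R}^N,\qquad u(0,x)=u_0(x).$$ A global weak solution of this problem is a function $u$ such that $u$, $|x|^{\sigma_1}u$ and $|x|^{\sigma_2}|u|^p$ belong to $L^1_{\mathrm{loc}}((0,\infty)\times\mathbb{R}^N)$ and such that, for every $\psi\in C_0^\infty([0,\infty)\times\mathbb{R}^N)$, the following integrals converge absolutely and $$\int_{(0,\infty)\times\mathbb{R}^N}\bigl(-|x|^{\sigma_1}\partial_t\psi-\Delta\psi\bigr)u\,dt\,dx=\int_{\mathbb{R}^N}|x|^{\sigma_1}u_0(x)\psi(0,x)\,dx+\int_{(0,\infty)\times\mathbb{R}^N}\bigl(|x|^{\sigma_2}|u|^p+t^{\varrho}w(x)\bigr)\psi\,dt\,dx.$$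 Then the problem has no global weak solution in each of the following cases: (i) $\varrho>0$ (for every $p>1$); (ii) $-1<\varrho<0$ and $p<p^*:=\dfrac{N+\sigma_2-\varrho(2+\sigma_1)}{N-2-\varrho(2+\sigma_1)}$; (iii) $\varrho=0$ and either $N=2$ (with $p>1$ arbitrary), or $N\ge3$ and $p\le\dfrac{N+\sigma_2}{N-2}$. -/

import Mathlib

open MeasureTheory Set
open scoped ContDiff

noncomputable section

/-- `u` is a global weak solution of
`|x|^σ₁ ∂ₜu = Δu + |x|^σ₂ |u|^p + t^ϱ w(x)` on `(0, ∞) × ℝ^N` with `u(0, ·) = u₀`.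
Only the values of `u` at positive times matter. The test functions `C₀^∞([0, ∞) × ℝ^N)` are the
restrictions to `[0, ∞) × ℝ^N` of smooth compactly supported functions on `ℝ × ℝ^N`. That the
integrals in the weak formulation converge is part of the definition. -/
structure IsGlobalWeakSolution {N : ℕ} (σ₁ σ₂ ϱ p : ℝ)
    (w u₀ : EuclideanSpace ℝ (Fin N) → ℝ) (u : ℝ × EuclideanSpace ℝ (Fin N) → ℝ) : Prop where
  locallyIntegrable_initial : LocallyIntegrable u₀ volume
  locallyIntegrableOn : LocallyIntegrableOn u (Ioi 0 ×ˢ univ) volume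
  locallyIntegrableOn_nonlinearity :
    LocallyIntegrableOn (fun z => ‖z.2‖ ^ σ₂ * |u z| ^ p) (Ioi 0 ×ˢ univ) volume
  locallyIntegrableOn_weighted :
    LocallyIntegrableOn (fun z => ‖z.2‖ ^ σ₁ * u z) (Ioi 0 ×ˢ univ) volume
  weak_formulation : ∀ ψ : ℝ × EuclideanSpace ℝ (Fin N) → ℝ,
    ContDiff ℝ ∞ ψ → HasCompactSupport ψ →
      IntegrableOn (fun z => (-(‖z.2‖ ^ σ₁ * deriv (fun t => ψ (t, z.2)) z.1)
        - Laplacian.laplacian (fun x => ψ (z.1, x)) z.2) * u z) (Ioi 0 ×ˢ univ) volume ∧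
      Integrable (fun x => ‖x‖ ^ σ₁ * u₀ x * ψ (0, x)) volume ∧
      IntegrableOn (fun z => (‖z.2‖ ^ σ₂ * |u z| ^ p + z.1 ^ ϱ * w z.2) * ψ z)
        (Ioi 0 ×ˢ univ) volume ∧
      ∫ z in Ioi 0 ×ˢ univ, (-(‖z.2‖ ^ σ₁ * deriv (fun t => ψ (t, z.2)) z.1)
          - Laplacian.laplacian (fun x => ψ (z.1, x)) z.2) * u z
        = (∫ x, ‖x‖ ^ σ₁ * u₀ x * ψ (0, x))
          + ∫ z in Ioi 0 ×ˢ univ, (‖z.2‖ ^ σ₂ * |u z| ^ p + z.1 ^ ϱ * w z.2) * ψ z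

end

open MeasureTheory Set
open scoped ContDiff

noncomputable section

open Filter Topology


/-! The proof is the test function method. Write p' = p/(p-1), b = -σ₂/(p-1), and Λ = -|x|^σ₁ ∂ₜψ -
Δψ for a test function ψ ≥ 0. If |Λ| ≤ F ψ^(1/p), Young's inequality bounds Λu by |x|^σ₂ |u|^p ψ +
F^p' |x|^b, and the nonlinear integrals cancel in the weak formulation. What remains no longer
contains u: the initial term plus the source term is at most ∫∫ F^p' |x|^b
(`IsTestPair.initial_add_source_le`). A contradiction follows from test functions for which the
source term, of order T^(1+ϱ) ∫ w over a time span T, outgrows the right-hand side.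

Products η(t/T) f(|x|²) with η supported in [1, 4] have no initial term and give
`IsGlobalWeakSolution.exists_product_estimate`. If ϱ > 0, a fixed f supported away from the origin
and T → ∞ suffice (`false_of_pos`). In the subcritical range f cuts off at |x| ~ R and T = R^(2+σ₁),
the scaling that balances the two parts of the operator (`false_of_subcritical`). At the critical
exponent with ϱ = 0 the powers of R balance, and a logarithmic cutoff between |x| = e^(L/2) and e^L
gains a factor L^(1-p') (`false_of_critical`).

The last two arguments need |x|^(σ₁p'+b) to be integrable near the origin. This is automatic at the
critical exponent but can fail below it, the obstacle being the term |x|^σ₁ ∂ₜψ. In that case ψ is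
taken near the origin to be a truncated series solution of the adjoint equation, the sum over k ≤ K
of c_k T^(-k) h_k(t/T) |x|^(k(2+σ₁)) with h_(k+1) = -h_k'. The operator telescopes and leaves only a
term of order |x|^(σ₁+K(2+σ₁)), harmless for large K. Positivity of ψ asks for h_k ≥ 0, so h_0
decreases and cannot vanish at t = 0. The initial datum therefore enters, but only on |x| < 2, where
|x|^σ₁ u₀ is integrable. The powers are not smooth at the origin, so the weak formulation is first
extended by a dominated limit (`isTestPair_rpow`). The resulting contradiction,
`false_of_not_locallyIntegrable`, needs no upper bound on p. -/

/-! ### The Laplacian of radial functions. -/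

theorem laplacian_comp_norm_sq {N : ℕ} {f f₁ : ℝ → ℝ} {f₂ : ℝ} {x : EuclideanSpace ℝ (Fin N)}
    (hf : ∀ᶠ q in 𝓝 (‖x‖ ^ 2), HasDerivAt f (f₁ q) q) (hf₁ : HasDerivAt f₁ f₂ (‖x‖ ^ 2)) :
    Laplacian.laplacian (fun y : EuclideanSpace ℝ (Fin N) => f (‖y‖ ^ 2)) x
      = 4 * ‖x‖ ^ 2 * f₂ + 2 * N * f₁ (‖x‖ ^ 2) := by
  have hq : ∀ y : EuclideanSpace ℝ (Fin N),
      HasFDerivAt (fun y : EuclideanSpace ℝ (Fin N) => ‖y‖ ^ 2) (2 • (innerSL ℝ y)) y :=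
    fun y => (hasStrictFDerivAt_norm_sq y).hasFDerivAt
  -- Only the germ of `f` at `‖x‖ ^ 2` is used, so powers `(q + δ) ^ a` and functions known
  -- explicitly only locally are allowed.
  have hev : ∀ᶠ y in 𝓝 x, HasDerivAt f (f₁ (‖y‖ ^ 2)) (‖y‖ ^ 2) :=
    (by fun_prop : Continuous fun y : EuclideanSpace ℝ (Fin N) => ‖y‖ ^ 2).continuousAt.eventually hf
  have h1 : fderiv ℝ (fun y : EuclideanSpace ℝ (Fin N) => f (‖y‖ ^ 2))
      =ᶠ[𝓝 x] fun y => f₁ (‖y‖ ^ 2) • (2 • (innerSL ℝ y)) := by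
    filter_upwards [hev] with y hy
    exact (hy.comp_hasFDerivAt y (hq y)).fderiv
  have h2 : HasFDerivAt (fun y : EuclideanSpace ℝ (Fin N) => f₁ (‖y‖ ^ 2) • (2 • (innerSL ℝ y)))
      (f₁ (‖x‖ ^ 2) • (2 • (innerSL ℝ : EuclideanSpace ℝ (Fin N) →L[ℝ] _)) +
        (f₂ • (2 • (innerSL ℝ x))).smulRight (2 • (innerSL ℝ x))) x :=
    (hf₁.comp_hasFDerivAt x (hq x)).smul
      ((2 • (innerSL ℝ : EuclideanSpace ℝ (Fin N) →L[ℝ] _)).hasFDerivAt)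
  rw [InnerProductSpace.laplacian_eq_iteratedFDeriv_orthonormalBasis _
    (EuclideanSpace.basisFun (Fin N) ℝ)]
  simp only [iteratedFDeriv_two_apply]
  rw [h1.fderiv_eq, h2.fderiv]
  simp only [EuclideanSpace.basisFun_apply, Matrix.cons_val_zero, Matrix.cons_val_one,
    add_apply, smul_apply, ContinuousLinearMap.smulRight_apply, smul_eq_mul, nsmul_eq_mul]
  have hv : ∀ v w : EuclideanSpace ℝ (Fin N), (innerSL ℝ v) w = inner ℝ v w := fun _ _ => rfl
  simp only [hv, EuclideanSpace.inner_single_right, Finset.sum_add_distrib]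
  have hn := EuclideanSpace.norm_sq_eq x
  simp only [Real.norm_eq_abs, sq_abs] at hn
  rw [add_comm]
  congr 1
  · rw [hn, Finset.mul_sum, Finset.sum_mul]
    exact Finset.sum_congr rfl fun i _ => by simp; ring
  · simp; ring

/-! ### The weak formulation as a linear class of test pairs. -/

/-- The Euclidean space `ℝ^N`. -/
abbrev Space (N : ℕ) := EuclideanSpace ℝ (Fin N)

/-- The weak formulation holds for the test function `ψ`, with `Λ` in the role of
`-|x|^σ₁ ∂ₜψ - Δψ`, and all the integrals converge separately. -/
structure IsTestPair {N : ℕ} (σ₁ σ₂ ϱ p : ℝ) (w u₀ : Space N → ℝ) (u : ℝ × Space N → ℝ)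
    (ψ Λ : ℝ × Space N → ℝ) : Prop where
  integrable_adjoint : IntegrableOn (fun z => Λ z * u z) (Ioi 0 ×ˢ univ) volume
  integrable_initial : Integrable (fun x => ‖x‖ ^ σ₁ * u₀ x * ψ (0, x)) volume
  integrable_nonlinearity :
    IntegrableOn (fun z => ‖z.2‖ ^ σ₂ * |u z| ^ p * ψ z) (Ioi 0 ×ˢ univ) volume
  integrable_source : IntegrableOn (fun z => z.1 ^ ϱ * w z.2 * ψ z) (Ioi 0 ×ˢ univ) volume
  identity : ∫ z in Ioi 0 ×ˢ univ, Λ z * u z = (∫ x, ‖x‖ ^ σ₁ * u₀ x * ψ (0, x))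
    + (∫ z in Ioi 0 ×ˢ univ, ‖z.2‖ ^ σ₂ * |u z| ^ p * ψ z)
    + ∫ z in Ioi 0 ×ˢ univ, z.1 ^ ϱ * w z.2 * ψ z

theorem IsTestPair.add {N : ℕ} {σ₁ σ₂ ϱ p : ℝ} {w u₀ : Space N → ℝ} {u ψ Λ ψ' Λ' : ℝ × Space N → ℝ}
    (h : IsTestPair σ₁ σ₂ ϱ p w u₀ u ψ Λ) (h' : IsTestPair σ₁ σ₂ ϱ p w u₀ u ψ' Λ') :
    IsTestPair σ₁ σ₂ ϱ p w u₀ u (fun z => ψ z + ψ' z) (fun z => Λ z + Λ' z) := by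
  constructor
  · simpa only [add_mul] using! h.integrable_adjoint.add h'.integrable_adjoint
  · simpa only [mul_add] using! h.integrable_initial.add h'.integrable_initial
  · simpa only [mul_add] using! h.integrable_nonlinearity.add h'.integrable_nonlinearity
  · simpa only [mul_add] using! h.integrable_source.add h'.integrable_source
  · simp only [add_mul, mul_add]
    rw [integral_add h.integrable_adjoint h'.integrable_adjoint,
      integral_add h.integrable_initial h'.integrable_initial,
      integral_add h.integrable_nonlinearity h'.integrable_nonlinearity,
      integral_add h.integrable_source h'.integrable_source, h.identity, h'.identity]
    ring

theorem IsTestPair.const_mul {N : ℕ} {σ₁ σ₂ ϱ p : ℝ} {w u₀ : Space N → ℝ}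
    {u ψ Λ : ℝ × Space N → ℝ} (c : ℝ) (h : IsTestPair σ₁ σ₂ ϱ p w u₀ u ψ Λ) :
    IsTestPair σ₁ σ₂ ϱ p w u₀ u (fun z => c * ψ z) (fun z => c * Λ z) := by
  constructor
  · simpa only [mul_assoc] using! h.integrable_adjoint.const_mul c
  · simpa only [mul_left_comm] using! h.integrable_initial.const_mul c
  · simpa only [mul_left_comm] using! h.integrable_nonlinearity.const_mul c
  · simpa only [mul_left_comm] using! h.integrable_source.const_mul c
  · simp only [mul_assoc c, mul_left_comm _ c]
    simp only [integral_const_mul, h.identity]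
    ring

theorem IsTestPair.zero {N : ℕ} {σ₁ σ₂ ϱ p : ℝ} {w u₀ : Space N → ℝ} {u : ℝ × Space N → ℝ} :
    IsTestPair σ₁ σ₂ ϱ p w u₀ u (fun _ => 0) (fun _ => 0) := by
  constructor <;> simp

theorem IsTestPair.sum {N : ℕ} {σ₁ σ₂ ϱ p : ℝ} {w u₀ : Space N → ℝ} {u : ℝ × Space N → ℝ}
    {ι : Type*} {I : Finset ι} {ψ Λ : ι → ℝ × Space N → ℝ}
    (h : ∀ i ∈ I, IsTestPair σ₁ σ₂ ϱ p w u₀ u (ψ i) (Λ i)) :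
    IsTestPair σ₁ σ₂ ϱ p w u₀ u (fun z => ∑ i ∈ I, ψ i z) (fun z => ∑ i ∈ I, Λ i z) := by
  classical
  induction I using Finset.induction_on with
  | empty => simpa using IsTestPair.zero
  | insert a s ha ih =>
    simp only [Finset.sum_insert ha]
    exact (h a (by simp)).add (ih fun i hi => h i (by simp [hi]))

/-- The values of ψ at t = 0 matter because of the initial term, whereas Λ is integrated over t > 0
only. -/
theorem IsTestPair.congr {N : ℕ} {σ₁ σ₂ ϱ p : ℝ} {w u₀ : Space N → ℝ} {u : ℝ × Space N → ℝ}
    {ψ Λ ψ' Λ' : ℝ × Space N → ℝ} (h : IsTestPair σ₁ σ₂ ϱ p w u₀ u ψ Λ)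
    (hψ : ∀ t x, 0 ≤ t → ψ (t, x) = ψ' (t, x)) (hΛ : ∀ t x, 0 < t → Λ (t, x) = Λ' (t, x)) :
    IsTestPair σ₁ σ₂ ϱ p w u₀ u ψ' Λ' := by
  have hm : MeasurableSet (Ioi (0 : ℝ) ×ˢ (univ : Set (Space N))) :=
    measurableSet_Ioi.prod MeasurableSet.univ
  have e1 : EqOn (fun z => Λ z * u z) (fun z => Λ' z * u z) (Ioi 0 ×ˢ univ) := fun z hz => by
    simp only [hΛ z.1 z.2 hz.1]
  have e2 : (fun x => ‖x‖ ^ σ₁ * u₀ x * ψ (0, x)) = fun x => ‖x‖ ^ σ₁ * u₀ x * ψ' (0, x) := by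
    funext x; rw [hψ 0 x le_rfl]
  have e3 : EqOn (fun z => ‖z.2‖ ^ σ₂ * |u z| ^ p * ψ z) (fun z => ‖z.2‖ ^ σ₂ * |u z| ^ p * ψ' z)
      (Ioi 0 ×ˢ univ) := fun z hz => by simp only [hψ z.1 z.2 (le_of_lt hz.1)]
  have e4 : EqOn (fun z => z.1 ^ ϱ * w z.2 * ψ z) (fun z => z.1 ^ ϱ * w z.2 * ψ' z)
      (Ioi 0 ×ˢ univ) := fun z hz => by simp only [hψ z.1 z.2 (le_of_lt hz.1)]
  refine ⟨h.integrable_adjoint.congr_fun e1 hm, e2 ▸ h.integrable_initial,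
    h.integrable_nonlinearity.congr_fun e3 hm, h.integrable_source.congr_fun e4 hm, ?_⟩
  rw [← setIntegral_congr_fun hm e1, ← setIntegral_congr_fun hm e3, ← setIntegral_congr_fun hm e4,
    ← e2, h.identity]

theorem volume_restrict_Ioi_prod_univ (N : ℕ) :
    (volume : Measure (ℝ × Space N)).restrict (Ioi 0 ×ˢ univ)
      = ((volume : Measure ℝ).restrict (Ioi 0)).prod (volume : Measure (Space N)) := by
  rw [Measure.volume_eq_prod, ← Measure.prod_restrict, Measure.restrict_univ]

/-- A function of time which is continuous and vanishes for large times is integrable against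
`t ^ ϱ` for `ϱ > -1`. -/
theorem integrableOn_rpow_mul {ϱ T : ℝ} (hϱ : -1 < ϱ) {η : ℝ → ℝ} (hη : Continuous η)
    (hT : ∀ t, T ≤ t → η t = 0) : IntegrableOn (fun t => t ^ ϱ * η t) (Ioi 0) volume := by
  have h1 : IntegrableOn (fun t : ℝ => t ^ ϱ * η t) (Ioc 0 (max T 0)) volume := by
    have := (intervalIntegral.intervalIntegrable_rpow' hϱ (a := 0) (b := max T 0)).mul_continuousOn
      hη.continuousOn
    exact (intervalIntegrable_iff_integrableOn_Ioc_of_le (le_max_right _ _)).1 this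
  refine h1.of_forall_sdiff_eq_zero measurableSet_Ioi fun t ht => ?_
  have : T ≤ t := by
    by_contra! hlt
    exact ht.2 ⟨ht.1, hlt.le.trans (le_max_left _ _)⟩
  simp [hT t this]

/-- This is what splits the joint right-hand side of the definition into two convergent integrals.
The condition ϱ > -1 enters through the integrability of t^ϱ at 0. -/
theorem integrableOn_source {N : ℕ} {ϱ T : ℝ} (hϱ : -1 < ϱ) {w : Space N → ℝ}
    (hw : Integrable w volume) {η : ℝ → ℝ} (hη : Continuous η) (hT : ∀ t, T ≤ t → η t = 0)
    {ζ : Space N → ℝ} (hζ : AEStronglyMeasurable ζ volume) {M : ℝ} (hM : ∀ x, |ζ x| ≤ M) :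
    IntegrableOn (fun z : ℝ × Space N => z.1 ^ ϱ * w z.2 * (η z.1 * ζ z.2))
      (Ioi 0 ×ˢ univ) volume := by
  rw [IntegrableOn, volume_restrict_Ioi_prod_univ]
  have h := (integrableOn_rpow_mul hϱ hη hT).mul_prod (hw.mul_bdd (c := M) hζ
    (Eventually.of_forall fun x => hM x))
  refine h.congr (Eventually.of_forall fun z => ?_)
  simp only; ring

/-- The time factor only has to vanish for large t: the formulation sees t ≥ 0, so a cutoff at
negative times produces compact support without changing anything. -/
theorem IsGlobalWeakSolution.isTestPair {N : ℕ} {σ₁ σ₂ ϱ p T : ℝ} (hϱ : -1 < ϱ) {w u₀ : Space N → ℝ}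
    {u : ℝ × Space N → ℝ} (hu : IsGlobalWeakSolution σ₁ σ₂ ϱ p w u₀ u) (hw : Integrable w volume)
    {η : ℝ → ℝ} (hη : ContDiff ℝ ∞ η) (hT : ∀ t, T ≤ t → η t = 0)
    {ζ : Space N → ℝ} (hζ : ContDiff ℝ ∞ ζ) (hζc : HasCompactSupport ζ) :
    IsTestPair σ₁ σ₂ ϱ p w u₀ u (fun z => η z.1 * ζ z.2)
      (fun z => -(‖z.2‖ ^ σ₁ * (deriv η z.1 * ζ z.2))
        - η z.1 * Laplacian.laplacian ζ z.2) := by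
  -- θ is 1 on [-1, ∞) and 0 on (-∞, -2]; being constant near [0, ∞), it does not affect time
  -- derivatives there.
  set θ : ℝ → ℝ := fun t => Real.smoothTransition (t + 2)
  have hθ : ContDiff ℝ ∞ θ := Real.smoothTransition.contDiff.comp (contDiff_id.add contDiff_const)
  have hθ1 : ∀ t, -1 ≤ t → θ t = 1 := fun t ht => Real.smoothTransition.one_of_one_le (by linarith)
  have hθη : HasCompactSupport fun t => θ t * η t := by
    refine HasCompactSupport.of_support_subset_isCompact (isCompact_Icc (a := -2) (b := T))
      fun t ht => ?_
    by_contra hn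
    apply ht
    simp only [mem_Icc, not_and_or, not_le] at hn
    rcases hn with hn | hn
    · simp [θ, Real.smoothTransition.zero_of_nonpos (by linarith : t + 2 ≤ 0)]
    · simp [hT t hn.le]
  have hψ : ContDiff ℝ ∞ fun z : ℝ × Space N => θ z.1 * η z.1 * ζ z.2 :=
    ((hθ.comp contDiff_fst).mul (hη.comp contDiff_fst)).mul (hζ.comp contDiff_snd)
  have hψc : HasCompactSupport fun z : ℝ × Space N => θ z.1 * η z.1 * ζ z.2 := by
    refine HasCompactSupport.of_support_subset_isCompact (hθη.isCompact.prod hζc.isCompact)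
      fun z hz => ?_
    have := mul_ne_zero_iff.1 hz
    exact ⟨subset_tsupport _ this.1, subset_tsupport _ this.2⟩
  obtain ⟨i1, i2, i3, i4⟩ := hu.weak_formulation _ hψ hψc
  obtain ⟨M, hM⟩ := hζc.exists_bound_of_continuous hζ.continuous
  have hm : MeasurableSet (Ioi (0 : ℝ) ×ˢ (univ : Set (Space N))) :=
    measurableSet_Ioi.prod MeasurableSet.univ
  have hsrc := integrableOn_source (T := T) (η := fun t => θ t * η t) hϱ hw (hθ.continuous.mul hη.continuous)
    (fun t ht => by simp [hT t ht]) hζ.continuous.aestronglyMeasurable hM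
  have hnl : IntegrableOn (fun z => ‖z.2‖ ^ σ₂ * |u z| ^ p * (θ z.1 * η z.1 * ζ z.2))
      (Ioi 0 ×ˢ univ) volume := by
    refine (i3.sub hsrc).congr (Eventually.of_forall fun z => ?_)
    simp only [Pi.sub_apply, add_mul]; ring
  have base : IsTestPair σ₁ σ₂ ϱ p w u₀ u (fun z => θ z.1 * η z.1 * ζ z.2)
      (fun z => -(‖z.2‖ ^ σ₁ * deriv (fun t => θ t * η t * ζ z.2) z.1)
        - Laplacian.laplacian (fun x => θ z.1 * η z.1 * ζ x) z.2) := by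
    refine ⟨i1, i2, hnl, hsrc, ?_⟩
    rw [i4, add_assoc, ← integral_add hnl hsrc]
    simp only [add_mul]
  refine base.congr (fun t x ht => by simp [hθ1 t (by linarith)]) fun t x ht => ?_
  have hev : (fun s => θ s * η s * ζ x) =ᶠ[𝓝 t] fun s => η s * ζ x := by
    filter_upwards [lt_mem_nhds ht] with s hs
    rw [hθ1 s (by linarith), one_mul]
  have hlap : (Laplacian.laplacian fun x => θ t * η t * ζ x) x
      = η t * Laplacian.laplacian ζ x := by
    have := InnerProductSpace.laplacian_smul (η t) (f := ζ) (x := x)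
      (by exact_mod_cast (contDiff_infty.1 hζ 2).contDiffAt)
    rw [hθ1 t (by linarith), one_mul]
    simpa using! this
  simp only [hev.deriv_eq, hlap]
  rw [deriv_mul_const ((hη.differentiable (by simp)) t)]


/-! ### The test function inequality. -/

theorem ae_pos_and_ne_zero {N : ℕ} (hN : 2 ≤ N) :
    ∀ᵐ z ∂(volume : Measure (ℝ × Space N)).restrict (Ioi 0 ×ˢ univ), 0 < z.1 ∧ z.2 ≠ 0 := by
  have : Nonempty (Fin N) := ⟨⟨0, by omega⟩⟩
  have h1 : ∀ᵐ z ∂(volume : Measure (ℝ × Space N)).restrict (Ioi 0 ×ˢ univ), z ∈ Ioi 0 ×ˢ univ :=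
    ae_restrict_mem (measurableSet_Ioi.prod MeasurableSet.univ)
  have h2 : ∀ᵐ z ∂(volume : Measure (ℝ × Space N)).restrict (Ioi 0 ×ˢ univ), z.2 ≠ 0 := by
    refine ae_restrict_of_ae ?_
    rw [ae_iff]
    have : {z : ℝ × Space N | ¬ z.2 ≠ 0} = univ ×ˢ {0} := by ext z; simp
    rw [this, Measure.volume_eq_prod, Measure.prod_prod]
    simp
  filter_upwards [h1, h2] with z hz hz'
  exact ⟨hz.1, hz'⟩

/-- The test function estimate: if `|Λ| ≤ F ψ^(1/p)`, then the initial and the source term are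
bounded by the integral of `F^(p/(p-1)) |x|^(-σ₂/(p-1))`. -/
theorem IsTestPair.initial_add_source_le {N : ℕ} (hN : 2 ≤ N) {σ₁ σ₂ ϱ p : ℝ} (hp : 1 < p)
    {w u₀ : Space N → ℝ} {u ψ Λ : ℝ × Space N → ℝ} (h : IsTestPair σ₁ σ₂ ϱ p w u₀ u ψ Λ)
    (hψ : ∀ z : ℝ × Space N, 0 < z.1 → 0 ≤ ψ z) {F H : ℝ × Space N → ℝ}
    (hF : ∀ z : ℝ × Space N, 0 < z.1 → z.2 ≠ 0 → 0 ≤ F z ∧ |Λ z| ≤ F z * ψ z ^ (1 / p) ∧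
      F z ^ (p / (p - 1)) * ‖z.2‖ ^ (-σ₂ / (p - 1)) ≤ H z)
    (hH : IntegrableOn H (Ioi 0 ×ˢ univ) volume) :
    (∫ x, ‖x‖ ^ σ₁ * u₀ x * ψ (0, x)) + ∫ z in Ioi 0 ×ˢ univ, z.1 ^ ϱ * w z.2 * ψ z
      ≤ ∫ z in Ioi 0 ×ˢ univ, H z := by
  have key : ∫ z in Ioi 0 ×ˢ univ, Λ z * u z
      ≤ ∫ z in Ioi 0 ×ˢ univ, (‖z.2‖ ^ σ₂ * |u z| ^ p * ψ z + H z) := by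
    refine integral_mono_ae h.integrable_adjoint (h.integrable_nonlinearity.add hH) ?_
    filter_upwards [ae_pos_and_ne_zero hN] with z hz
    obtain ⟨hF0, hΛ, hHz⟩ := hF z hz.1 hz.2
    have hr : 0 < ‖z.2‖ := norm_pos_iff.2 hz.2
    have hψz := hψ z hz.1
    have hp0 : 0 < p := by linarith
    have hp1 : 0 < p - 1 := by linarith
    have hconj : p.HolderConjugate (p / (p - 1)) := Real.HolderConjugate.conjExponent hp
    -- The weights are distributed so that X^p is the nonlinear integrand and Y^p' is the integrand
    -- bounded by `H`.
    set X := ‖z.2‖ ^ (σ₂ / p) * |u z| * ψ z ^ (1 / p) with hX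
    set Y := F z * ‖z.2‖ ^ (-σ₂ / p) with hY
    have hX0 : 0 ≤ X := by positivity
    have hY0 : 0 ≤ Y := by positivity
    have hXp : X ^ p = ‖z.2‖ ^ σ₂ * |u z| ^ p * ψ z := by
      rw [hX, Real.mul_rpow (by positivity) (by positivity), Real.mul_rpow (by positivity)
        (by positivity), ← Real.rpow_mul hr.le, ← Real.rpow_mul hψz]
      rw [div_mul_cancel₀ _ hp0.ne', div_mul_cancel₀ _ hp0.ne', Real.rpow_one]
    have hYp : Y ^ (p / (p - 1)) = F z ^ (p / (p - 1)) * ‖z.2‖ ^ (-σ₂ / (p - 1)) := by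
      rw [hY, Real.mul_rpow hF0 (by positivity), ← Real.rpow_mul hr.le]
      congr 2
      field_simp
    have hyoung := Real.young_inequality_of_nonneg hX0 hY0 hconj
    have hXp0 : 0 ≤ X ^ p := by positivity
    have hYp0 : 0 ≤ Y ^ (p / (p - 1)) := by positivity
    have h1 : X ^ p / p ≤ X ^ p := div_le_self hXp0 hp.le
    have h2 : Y ^ (p / (p - 1)) / (p / (p - 1)) ≤ Y ^ (p / (p - 1)) :=
      div_le_self hYp0 hconj.symm.lt.le
    have hXY : X * Y = F z * ψ z ^ (1 / p) * |u z| := by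
      rw [hX, hY, neg_div, Real.rpow_neg hr.le]
      field_simp
    calc Λ z * u z ≤ |Λ z| * |u z| := by rw [← abs_mul]; exact le_abs_self _
      _ ≤ F z * ψ z ^ (1 / p) * |u z| := by gcongr
      _ = X * Y := hXY.symm
      _ ≤ X ^ p + Y ^ (p / (p - 1)) := by linarith
      _ ≤ _ := by rw [hXp, hYp]; gcongr
  -- The nonlinear integral occurs with coefficient one on both sides and cancels.
  rw [integral_add h.integrable_nonlinearity hH, h.identity] at key
  linarith

/-! ### Cutoffs whose derivatives are controlled by a p-th root. -/

/-- Smooth functions with values in `[0, 1]` whose first two derivatives are controlled by the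
`p`-th root of the function. -/
structure IsCutoff (p : ℝ) (f : ℝ → ℝ) : Prop where
  contDiff : ContDiff ℝ ∞ f
  nonneg : ∀ q, 0 ≤ f q
  le_one : ∀ q, f q ≤ 1
  exists_bound : ∃ C, 0 ≤ C ∧ ∀ q, |deriv f q| ≤ C * f q ^ (1 / p) ∧
    |deriv (deriv f) q| ≤ C * f q ^ (1 / p)

/-- With this, factors that are not differentiated can be charged to the p-th root as well. -/
theorem IsCutoff.le_rpow {p : ℝ} (hp : 1 < p) {f : ℝ → ℝ} (h : IsCutoff p f) (q : ℝ) :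
    f q ≤ f q ^ (1 / p) := by
  rcases (h.nonneg q).eq_or_lt with h0 | h0
  · rw [← h0]; positivity
  · have : (1 : ℝ) / p ≤ 1 := by rw [div_le_one (by linarith)]; exact hp.le
    calc f q = f q ^ (1 : ℝ) := (Real.rpow_one _).symm
      _ ≤ _ := Real.rpow_le_rpow_of_exponent_ge h0 (h.le_one q) this

theorem IsCutoff.hasDerivAt {p : ℝ} {f : ℝ → ℝ} (h : IsCutoff p f) (q : ℝ) :
    HasDerivAt f (deriv f q) q :=
  (h.contDiff.differentiable (by simp) q).hasDerivAt

theorem IsCutoff.hasDerivAt_deriv {p : ℝ} {f : ℝ → ℝ} (h : IsCutoff p f) (q : ℝ) :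
    HasDerivAt (deriv f) (deriv (deriv f) q) q := by
  have : ContDiff ℝ ∞ (deriv f) := (contDiff_infty_iff_deriv.1 h.contDiff).2
  exact (this.differentiable (by simp) q).hasDerivAt

theorem IsCutoff.comp_affine {p : ℝ} {f : ℝ → ℝ} (h : IsCutoff p f) (a c : ℝ) :
    IsCutoff p (fun q => f (a * q + c)) := by
  have hd : deriv (fun q => f (a * q + c)) = fun q => deriv f (a * q + c) * a := by
    funext q
    have h1 : HasDerivAt (fun q : ℝ => a * q + c) a q := by
      simpa using ((hasDerivAt_id q).const_mul a).add_const c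
    exact ((h.hasDerivAt (a * q + c)).comp q h1).deriv
  have hdd : deriv (deriv fun q => f (a * q + c)) = fun q => deriv (deriv f) (a * q + c) * a * a := by
    rw [hd]
    funext q
    have h1 : HasDerivAt (fun q : ℝ => a * q + c) a q := by
      simpa using ((hasDerivAt_id q).const_mul a).add_const c
    exact (((h.hasDerivAt_deriv (a * q + c)).comp q h1).mul_const a).deriv
  obtain ⟨C, hC, hb⟩ := h.exists_bound
  refine ⟨h.contDiff.comp ((contDiff_const.mul contDiff_id).add contDiff_const),
    fun q => h.nonneg _, fun q => h.le_one _, C * |a| + C * |a| * |a|, by positivity, fun q => ?_⟩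
  rw [hdd, hd]
  obtain ⟨b1, b2⟩ := hb (a * q + c)
  have hz : 0 ≤ f (a * q + c) ^ (1 / p) := Real.rpow_nonneg (h.nonneg _) _
  simp only [abs_mul]
  constructor
  · have := mul_le_mul_of_nonneg_right b1 (abs_nonneg a)
    nlinarith [mul_nonneg (mul_nonneg (mul_nonneg hC (abs_nonneg a)) (abs_nonneg a)) hz]
  · have := mul_le_mul_of_nonneg_right (mul_le_mul_of_nonneg_right b2 (abs_nonneg a)) (abs_nonneg a)
    nlinarith [mul_nonneg (mul_nonneg hC (abs_nonneg a)) hz]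

/-- Each factor, differentiated or not, is charged to its own p-th root, and p-th roots are
multiplicative. -/
theorem IsCutoff.mul {p : ℝ} (hp : 1 < p) {f g : ℝ → ℝ} (hf : IsCutoff p f) (hg : IsCutoff p g) :
    IsCutoff p (fun q => f q * g q) := by
  have hd : deriv (fun q => f q * g q) = fun q => deriv f q * g q + f q * deriv g q := by
    funext q
    exact ((hf.hasDerivAt q).mul (hg.hasDerivAt q)).deriv
  have hdd : deriv (deriv fun q => f q * g q) = fun q => (deriv (deriv f) q * g q +
      deriv f q * deriv g q) + (deriv f q * deriv g q + f q * deriv (deriv g) q) := by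
    rw [hd]
    funext q
    exact (((hf.hasDerivAt_deriv q).mul (hg.hasDerivAt q)).add
      ((hf.hasDerivAt q).mul (hg.hasDerivAt_deriv q))).deriv
  obtain ⟨C, hC, hb⟩ := hf.exists_bound
  obtain ⟨D, hD, hb'⟩ := hg.exists_bound
  refine ⟨hf.contDiff.mul hg.contDiff, fun q => mul_nonneg (hf.nonneg q) (hg.nonneg q),
    fun q => mul_le_one₀ (hf.le_one q) (hg.nonneg q) (hg.le_one q),
    C + D + 2 * (C * D), by positivity, fun q => ?_⟩
  rw [hdd, hd, Real.mul_rpow (hf.nonneg q) (hg.nonneg q)]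
  obtain ⟨b1, b2⟩ := hb q
  obtain ⟨b3, b4⟩ := hb' q
  set X := f q ^ (1 / p)
  set Y := g q ^ (1 / p)
  have hX : 0 ≤ X := Real.rpow_nonneg (hf.nonneg _) _
  have hY : 0 ≤ Y := Real.rpow_nonneg (hg.nonneg _) _
  have hfX : |f q| ≤ X := by rw [abs_of_nonneg (hf.nonneg q)]; exact hf.le_rpow hp q
  have hgY : |g q| ≤ Y := by rw [abs_of_nonneg (hg.nonneg q)]; exact hg.le_rpow hp q
  have e1 : |deriv f q * g q| ≤ C * X * Y := by rw [abs_mul]; gcongr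
  have e2 : |f q * deriv g q| ≤ X * (D * Y) := by rw [abs_mul]; gcongr
  have e3 : |deriv (deriv f) q * g q| ≤ C * X * Y := by rw [abs_mul]; gcongr
  have e4 : |f q * deriv (deriv g) q| ≤ X * (D * Y) := by rw [abs_mul]; gcongr
  have e5 : |deriv f q * deriv g q| ≤ C * X * (D * Y) := by rw [abs_mul]; gcongr
  have hXY := mul_nonneg (mul_nonneg hC hD) (mul_nonneg hX hY)
  constructor
  · refine (abs_add_le _ _).trans ?_
    nlinarith
  · refine (abs_add_le _ _).trans ((add_le_add (abs_add_le _ _) (abs_add_le _ _)).trans ?_)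
    nlinarith

/-- There is a cutoff function which is `1` on `(-∞, 1]` and `0` on `[2, ∞)`. -/
theorem exists_isCutoff {p : ℝ} (hp : 1 < p) :
    ∃ ξ : ℝ → ℝ, IsCutoff p ξ ∧ (∀ q ≤ 1, ξ q = 1) ∧ ∀ q, 2 ≤ q → ξ q = 0 := by
  set f : ℝ → ℝ := fun q => Real.smoothTransition (2 - q) with hfdef
  have hf : ContDiff ℝ ∞ f := Real.smoothTransition.contDiff.comp (contDiff_const.sub contDiff_id)
  have hf1 : ∀ q ≤ 1, f q = 1 := fun q hq => Real.smoothTransition.one_of_one_le (by linarith)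
  have hf0 : ∀ q, 2 ≤ q → f q = 0 := fun q hq => Real.smoothTransition.zero_of_nonpos (by linarith)
  have hdf : ContDiff ℝ ∞ (deriv f) := (contDiff_infty_iff_deriv.1 hf).2
  have hddf : ContDiff ℝ ∞ (deriv (deriv f)) := (contDiff_infty_iff_deriv.1 hdf).2
  have hd0 : ∀ q, q ∉ Icc (1 : ℝ) 2 → deriv f =ᶠ[𝓝 q] fun _ => 0 := by
    intro q hq
    simp only [mem_Icc, not_and_or, not_le] at hq
    rcases hq with hq | hq
    · filter_upwards [gt_mem_nhds hq] with y hy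
      have : f =ᶠ[𝓝 y] fun _ => 1 := by
        filter_upwards [gt_mem_nhds hy] with z hz using hf1 z hz.le
      rw [this.deriv_eq]; simp
    · filter_upwards [lt_mem_nhds hq] with y hy
      have : f =ᶠ[𝓝 y] fun _ => 0 := by
        filter_upwards [lt_mem_nhds hy] with z hz using hf0 z hz.le
      rw [this.deriv_eq]; simp
  have hs1 : HasCompactSupport (deriv f) :=
    HasCompactSupport.of_support_subset_isCompact isCompact_Icc fun q hq => by
      by_contra hn
      exact hq (hd0 q hn).eq_of_nhds
  have hs2 : HasCompactSupport (deriv (deriv f)) :=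
    HasCompactSupport.of_support_subset_isCompact isCompact_Icc fun q hq => by
      by_contra hn
      apply hq
      rw [(hd0 q hn).deriv_eq]; simp
  obtain ⟨A, hA⟩ := hs1.exists_bound_of_continuous hdf.continuous
  obtain ⟨B, hB⟩ := hs2.exists_bound_of_continuous hddf.continuous
  have hA0 : 0 ≤ A := (norm_nonneg _).trans (hA 0)
  have hB0 : 0 ≤ B := (norm_nonneg _).trans (hB 0)
  have hp1 : 0 < p - 1 := by linarith
  -- The cutoff is `f ^ (n + 2)`, whose first two derivatives are of order `f ^ n`. The choice of n
  -- gives (n + 2)/p ≤ n, hence a bound by the p-th root.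
  obtain ⟨n, hn⟩ := exists_nat_ge (2 * p / (p - 1))
  have hf_nonneg : ∀ q, 0 ≤ f q := fun q => Real.smoothTransition.nonneg _
  have hf_le : ∀ q, f q ≤ 1 := fun q => Real.smoothTransition.le_one _
  have hnp : ((n + 2 : ℕ) : ℝ) * (1 / p) ≤ n := by
    rw [div_le_iff₀ hp1] at hn
    have hp0 : 0 < p := by linarith
    rw [mul_one_div, div_le_iff₀ hp0]
    push_cast
    nlinarith
  have hpow : ∀ q, f q ^ n ≤ (f q ^ (n + 2)) ^ (1 / p) := by
    intro q
    rcases (hf_nonneg q).eq_or_lt with h0 | h0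
    · have hn0 : n ≠ 0 := by
        rintro rfl
        have : 0 < 2 * p / (p - 1) := by positivity
        simp at hn
        linarith
      rw [← h0, zero_pow hn0]; positivity
    · rw [← Real.rpow_natCast, ← Real.rpow_natCast, ← Real.rpow_mul h0.le]
      exact Real.rpow_le_rpow_of_exponent_ge h0 (hf_le q) hnp
  have hD : ∀ q, HasDerivAt f (deriv f q) q := fun q => (hf.differentiable (by simp) q).hasDerivAt
  have hDD : ∀ q, HasDerivAt (deriv f) (deriv (deriv f) q) q :=
    fun q => (hdf.differentiable (by simp) q).hasDerivAt
  have hd : deriv (fun q => f q ^ (n + 2)) = fun q => (n + 2) * f q ^ (n + 1) * deriv f q := by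
    funext q
    rw [((hD q).fun_pow (n + 2)).deriv]
    push_cast; simp
  have hdd : deriv (deriv fun q => f q ^ (n + 2)) = fun q =>
      (n + 2) * ((n + 1) * f q ^ n * deriv f q) * deriv f q
        + (n + 2) * f q ^ (n + 1) * deriv (deriv f) q := by
    rw [hd]
    funext q
    rw [((((hD q).fun_pow (n + 1)).const_mul ((n : ℝ) + 2)).fun_mul (hDD q)).deriv]
    push_cast; simp
  refine ⟨fun q => f q ^ (n + 2), ⟨hf.pow _, fun q => pow_nonneg (hf_nonneg q) _,
    fun q => pow_le_one₀ (hf_nonneg q) (hf_le q),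
    (n + 2) * A + (n + 2) * (n + 1) * A * A + (n + 2) * B, by positivity, fun q => ?_⟩,
    fun q hq => by simp [hf1 q hq], fun q hq => by simp [hf0 q hq]⟩
  rw [hdd, hd]
  have h0 := hf_nonneg q
  have hle : f q ^ (n + 1) ≤ f q ^ n := pow_le_pow_of_le_one h0 (hf_le q) (by omega)
  have hAq : |deriv f q| ≤ A := hA q
  have hBq : |deriv (deriv f) q| ≤ B := hB q
  have e1 : |(n + 2) * f q ^ (n + 1) * deriv f q| ≤ (n + 2) * A * f q ^ n := by
    rw [abs_mul, abs_of_nonneg (by positivity)]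
    calc _ ≤ (n + 2) * f q ^ n * A := by gcongr
      _ = _ := by ring
  have e2 : |(n + 2) * f q ^ (n + 1) * deriv (deriv f) q| ≤ (n + 2) * B * f q ^ n := by
    rw [abs_mul, abs_of_nonneg (by positivity)]
    calc _ ≤ (n + 2) * f q ^ n * B := by gcongr
      _ = _ := by ring
  have e3 : |(n + 2) * ((n + 1) * f q ^ n * deriv f q) * deriv f q|
      ≤ (n + 2) * (n + 1) * A * A * f q ^ n := by
    rw [show (n + 2) * ((n + 1) * f q ^ n * deriv f q) * deriv f q
      = (n + 2) * ((n + 1) * f q ^ n) * (deriv f q * deriv f q) by ring, abs_mul, abs_mul (deriv f q),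
      abs_of_nonneg (by positivity : 0 ≤ (n + 2 : ℝ) * ((n + 1) * f q ^ n))]
    calc _ ≤ (n + 2 : ℝ) * ((n + 1) * f q ^ n) * (A * A) := by gcongr
      _ = _ := by ring
  have hfn : 0 ≤ f q ^ n := pow_nonneg h0 n
  constructor
  · refine e1.trans ?_
    calc _ ≤ ((n + 2) * A + (n + 2) * (n + 1) * A * A + (n + 2) * B) * f q ^ n := by
          gcongr
          have : 0 ≤ (n + 2 : ℝ) * (n + 1) * A * A := by positivity
          have : 0 ≤ (n + 2 : ℝ) * B := by positivity
          linarith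
      _ ≤ _ := by gcongr; exact hpow q
  · refine (abs_add_le _ _).trans ((add_le_add e3 e2).trans ?_)
    calc _ ≤ ((n + 2) * A + (n + 2) * (n + 1) * A * A + (n + 2) * B) * f q ^ n := by
          have : 0 ≤ (n + 2 : ℝ) * A * f q ^ n := by positivity
          linarith
      _ ≤ _ := by gcongr; exact hpow q

theorem contDiff_comp_norm_sq {N : ℕ} {f : ℝ → ℝ} (hf : ContDiff ℝ ∞ f) :
    ContDiff ℝ ∞ fun x : Space N => f (‖x‖ ^ 2) :=
  hf.comp (contDiff_norm_sq ℝ)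

theorem hasCompactSupport_comp_norm_sq {N : ℕ} {f : ℝ → ℝ} {Q : ℝ} (hf : ∀ q, Q ≤ q → f q = 0) :
    HasCompactSupport fun x : Space N => f (‖x‖ ^ 2) := by
  refine HasCompactSupport.of_support_subset_isCompact
    (isCompact_closedBall (0 : Space N) (Q ^ 2 + 1)) fun x hx => ?_
  by_contra hn
  apply hx
  apply hf
  simp only [Metric.mem_closedBall, dist_zero_right, not_le] at hn
  nlinarith [sq_nonneg Q, sq_nonneg (Q - 1), sq_nonneg (Q + 1)]

theorem IsCutoff.laplacian_eq {N : ℕ} {p : ℝ} {f : ℝ → ℝ} (hf : IsCutoff p f) (x : Space N) :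
    Laplacian.laplacian (fun y : Space N => f (‖y‖ ^ 2)) x
      = 4 * ‖x‖ ^ 2 * deriv (deriv f) (‖x‖ ^ 2) + 2 * N * deriv f (‖x‖ ^ 2) :=
  laplacian_comp_norm_sq (Eventually.of_forall hf.hasDerivAt) (hf.hasDerivAt_deriv _)

theorem deriv_eq_zero_of_eq_one_of_lt {ξ : ℝ → ℝ}
    (h1 : ∀ q ≤ 1, ξ q = 1) {q : ℝ} (hq : q < 1) : deriv ξ q = 0 ∧ deriv (deriv ξ) q = 0 := by
  have hev : ∀ y < 1, deriv ξ y = 0 := fun y hy => by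
    have : ξ =ᶠ[𝓝 y] fun _ => 1 := by
      filter_upwards [gt_mem_nhds hy] with z hz using h1 z hz.le
    rw [this.deriv_eq]; simp
  have hev' : deriv ξ =ᶠ[𝓝 q] fun _ => 0 := by
    filter_upwards [gt_mem_nhds hq] with z hz using hev z hz
  refine ⟨hev q hq, ?_⟩
  rw [hev'.deriv_eq]; simp

/-- The p-th root bound forces this even at boundary points of the support, where the function
vanishes on no neighbourhood. -/
theorem IsCutoff.deriv_eq_zero_of_eq_zero {p : ℝ} (hp : 1 < p) {ξ : ℝ → ℝ} (hξ : IsCutoff p ξ)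
    {q : ℝ} (hq : ξ q = 0) : deriv ξ q = 0 ∧ deriv (deriv ξ) q = 0 := by
  obtain ⟨C, -, hb⟩ := hξ.exists_bound
  obtain ⟨b1, b2⟩ := hb q
  rw [hq, Real.zero_rpow (by positivity), mul_zero] at b1 b2
  exact ⟨abs_nonpos_iff.1 b1, abs_nonpos_iff.1 b2⟩


/-! ### The estimate from product test functions. -/

theorem Real.add_rpow_le_two_rpow_mul {a b s : ℝ} (ha : 0 ≤ a) (hb : 0 ≤ b) (hs : 0 ≤ s) :
    (a + b) ^ s ≤ 2 ^ s * (a ^ s + b ^ s) := by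
  have h1 : a + b ≤ 2 * max a b := by
    rcases le_total a b with h | h <;> simp [h] <;> linarith
  calc (a + b) ^ s ≤ (2 * max a b) ^ s := Real.rpow_le_rpow (by positivity) h1 hs
    _ = 2 ^ s * max a b ^ s := Real.mul_rpow (by positivity) (by positivity)
    _ ≤ _ := by
      gcongr
      have := Real.rpow_nonneg ha s
      have := Real.rpow_nonneg hb s
      rcases le_total a b with h | h <;> simp [h] <;> linarith

/-- A cutoff function supported in `[1, 4]` and equal to `1` on `[2, 3]`. -/
theorem exists_isCutoff_bump {p : ℝ} (hp : 1 < p) :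
    ∃ η : ℝ → ℝ, IsCutoff p η ∧ (∀ t ≤ 1, η t = 0) ∧ (∀ t, 4 ≤ t → η t = 0) ∧
      ∀ t ∈ Icc (2 : ℝ) 3, η t = 1 := by
  obtain ⟨ξ, hξ, h1, h0⟩ := exists_isCutoff hp
  refine ⟨_, (hξ.comp_affine (-1) 3).mul hp (hξ.comp_affine 1 (-2)), fun t ht => ?_, fun t ht => ?_,
    fun t ht => ?_⟩
  · simp only [h0 (-1 * t + 3) (by linarith), zero_mul]
  · simp only [h0 (1 * t + -2) (by linarith), mul_zero]
  · simp only [h1 (-1 * t + 3) (by linarith [ht.1]), h1 (1 * t + -2) (by linarith [ht.2]), mul_one]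

theorem integral_rpow_mul_comp_div {ϱ T : ℝ} (hT : 0 < T) (η : ℝ → ℝ) :
    ∫ t in Ioi (0 : ℝ), t ^ ϱ * η (t / T) = T ^ (1 + ϱ) * ∫ t in Ioi (0 : ℝ), t ^ ϱ * η t := by
  have h := integral_comp_mul_left_Ioi (fun y : ℝ => y ^ ϱ * η y) 0 (inv_pos.2 hT)
  simp only [mul_zero, inv_inv, smul_eq_mul] at h
  rw [Real.rpow_add hT, Real.rpow_one, mul_assoc, mul_left_comm, ← h, ← integral_const_mul]
  refine setIntegral_congr_fun measurableSet_Ioi fun t ht => ?_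
  have ht0 : (0 : ℝ) < t := ht
  rw [Real.mul_rpow (by positivity) ht0.le, Real.inv_rpow hT.le, inv_mul_eq_div T t]
  field_simp

theorem integral_source {N : ℕ} {ϱ : ℝ} (w : Space N → ℝ) (η : ℝ → ℝ) (ζ : Space N → ℝ) :
    ∫ z in Ioi 0 ×ˢ univ, z.1 ^ ϱ * w z.2 * (η z.1 * ζ z.2)
      = (∫ t in Ioi (0 : ℝ), t ^ ϱ * η t) * ∫ x, w x * ζ x := by
  rw [volume_restrict_Ioi_prod_univ, ← integral_prod_mul]
  exact integral_congr_ae (Eventually.of_forall fun z => by simp only; ring)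

theorem integrableOn_indicator_Iio_mul {N : ℕ} {T : ℝ} {k : Space N → ℝ}
    (hk : Integrable k volume) :
    IntegrableOn (fun z : ℝ × Space N => (Iio T).indicator 1 z.1 * k z.2)
      (Ioi 0 ×ˢ univ) volume := by
  rw [IntegrableOn, volume_restrict_Ioi_prod_univ]
  refine Integrable.mul_prod (f := (Iio T).indicator 1) ?_ hk
  rw [integrable_indicator_iff measurableSet_Iio]
  simp only [IntegrableOn, Measure.restrict_restrict measurableSet_Iio]
  rw [Iio_inter_Ioi]
  exact integrable_const (1 : ℝ)

theorem integral_indicator_Iio_mul {N : ℕ} {T : ℝ} (hT : 0 ≤ T) (k : Space N → ℝ) :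
    ∫ z in Ioi 0 ×ˢ univ, (Iio T).indicator 1 z.1 * k z.2 = T * ∫ x, k x := by
  rw [volume_restrict_Ioi_prod_univ, integral_prod_mul (f := (Iio T).indicator 1)]
  congr 1
  rw [integral_indicator measurableSet_Iio, Measure.restrict_restrict measurableSet_Iio,
    Iio_inter_Ioi]
  simp [hT]

/-- The estimate obtained from test functions `η (t / T) f (|x|^2)`. -/
theorem IsGlobalWeakSolution.exists_product_estimate {N : ℕ} (hN : 2 ≤ N) {σ₁ σ₂ ϱ p : ℝ}
    (hp : 1 < p) (hϱ : -1 < ϱ) {w u₀ : Space N → ℝ} (hw : Integrable w volume)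
    {u : ℝ × Space N → ℝ} (hu : IsGlobalWeakSolution σ₁ σ₂ ϱ p w u₀ u) :
    ∃ I C : ℝ, 0 < I ∧ 0 ≤ C ∧ ∀ (f : ℝ → ℝ) (Q : ℝ) (S : Set (Space N)) (G : Space N → ℝ) (T : ℝ),
      IsCutoff p f → (∀ q, Q ≤ q → f q = 0) → MeasurableSet S → (∀ x, x ∉ S → f (‖x‖ ^ 2) = 0) →
      IntegrableOn (fun x => ‖x‖ ^ (σ₁ * (p / (p - 1)) + -σ₂ / (p - 1))) S volume →
      (∀ x, 0 ≤ G x) →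
      (∀ x, x ≠ 0 → |Laplacian.laplacian (fun y : Space N => f (‖y‖ ^ 2)) x|
        ≤ G x * f (‖x‖ ^ 2) ^ (1 / p)) →
      Integrable (fun x => G x ^ (p / (p - 1)) * ‖x‖ ^ (-σ₂ / (p - 1))) volume → 0 < T →
      T ^ (1 + ϱ) * I * (∫ x, w x * f (‖x‖ ^ 2)) ≤
        C * (T ^ (1 - p / (p - 1)) * (∫ x in S, ‖x‖ ^ (σ₁ * (p / (p - 1)) + -σ₂ / (p - 1)))
          + T * ∫ x, G x ^ (p / (p - 1)) * ‖x‖ ^ (-σ₂ / (p - 1))) := by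
  obtain ⟨η, hη, hη1, hη4, hη23⟩ := exists_isCutoff_bump hp
  obtain ⟨C₁, hC₁, hbound⟩ := hη.exists_bound
  have hp1 : 0 < p - 1 := by linarith
  have hp' : 0 ≤ p / (p - 1) := by positivity
  set p' := p / (p - 1) with hp'def
  -- The factor 4 comes from the time interval (0, 4T) and 2^p' from the p'-th power of a sum of two
  -- terms.
  refine ⟨∫ t in Ioi (0 : ℝ), t ^ ϱ * η t, 4 * (2 ^ p' * C₁ ^ p' + 2 ^ p'), ?_, by positivity, ?_⟩
  · rw [setIntegral_pos_iff_support_of_nonneg_ae]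
    · have hsub : Icc (2 : ℝ) 3 ⊆ (Function.support fun t => t ^ ϱ * η t) ∩ Ioi 0 := by
        intro t ht
        have ht0 : 0 < t := by linarith [ht.1]
        refine ⟨?_, ht0⟩
        simp only [Function.mem_support, hη23 t ht, mul_one]
        exact (Real.rpow_pos_of_pos ht0 _).ne'
      refine lt_of_lt_of_le ?_ (measure_mono hsub)
      rw [Real.volume_Icc]
      norm_num
    · filter_upwards [ae_restrict_mem measurableSet_Ioi] with t ht
      exact mul_nonneg (Real.rpow_nonneg (le_of_lt ht) _) (hη.nonneg t)
    · exact integrableOn_rpow_mul hϱ hη.contDiff.continuous hη4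
  intro f Q S G T hf hfQ hS hfS hSint hG hlap hGint hT
  have hηT : IsCutoff p (fun t => η (t / T)) := by
    convert hη.comp_affine T⁻¹ 0 using 2 with t
    rw [add_zero, div_eq_inv_mul]
  have hηT0 : ∀ t, 4 * T ≤ t → η (t / T) = 0 := fun t ht =>
    hη4 _ (by rwa [le_div_iff₀ hT])
  have hηTd : ∀ t, deriv (fun t => η (t / T)) t = deriv η (t / T) * T⁻¹ := by
    intro t
    have h1 : HasDerivAt (fun t : ℝ => t / T) T⁻¹ t := by
      simpa [div_eq_mul_inv] using (hasDerivAt_id t).mul_const T⁻¹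
    exact ((hη.hasDerivAt (t / T)).comp t h1).deriv
  have pair := hu.isTestPair hϱ hw hηT.contDiff hηT0 (contDiff_comp_norm_sq (N := N) hf.contDiff)
    (hasCompactSupport_comp_norm_sq hfQ)
  set k : Space N → ℝ := fun x =>
    2 ^ p' * (C₁ * T⁻¹) ^ p' * S.indicator (fun x => ‖x‖ ^ (σ₁ * p' + -σ₂ / (p - 1))) x
      + 2 ^ p' * (G x ^ p' * ‖x‖ ^ (-σ₂ / (p - 1))) with hk
  have hSint' := hSint.integrable_indicator hS
  have hkint : Integrable k volume := (hSint'.const_mul _).add (hGint.const_mul _)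
  -- One part for the time derivative and one for the Laplacian. The former is needed on `S` only,
  -- since `f (‖x‖ ^ 2)` vanishes elsewhere.
  set F : ℝ × Space N → ℝ := fun z => (Iio (4 * T)).indicator 1 z.1 *
    (C₁ * T⁻¹ * S.indicator (fun x => ‖x‖ ^ σ₁) z.2 + G z.2) with hF
  have hind : ∀ x, 0 ≤ S.indicator (fun x : Space N => ‖x‖ ^ σ₁) x := fun x =>
    indicator_nonneg (fun _ _ => Real.rpow_nonneg (norm_nonneg _) _) x
  have key := pair.initial_add_source_le hN hp
    (fun z _ => mul_nonneg (hηT.nonneg _) (hf.nonneg _))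
    (F := F) (H := fun z => (Iio (4 * T)).indicator 1 z.1 * k z.2) ?_
    (integrableOn_indicator_Iio_mul hkint)
  -- η vanishes on (-∞, 1], so the initial datum drops out.
  · have h0 : ∀ x : Space N, ‖x‖ ^ σ₁ * u₀ x * (η (0 / T) * f (‖x‖ ^ 2)) = 0 := fun x => by
      rw [hη1 (0 / T) (by simp)]; ring
    simp only [h0, integral_zero, zero_add] at key
    rw [integral_source w (fun t => η (t / T)) (fun x => f (‖x‖ ^ 2)),
      integral_rpow_mul_comp_div hT, integral_indicator_Iio_mul (by positivity), hk,
      integral_add (hSint'.const_mul _) (hGint.const_mul _), integral_const_mul,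
      integral_const_mul, integral_indicator hS] at key
    refine key.trans ?_
    set A := ∫ x in S, ‖x‖ ^ (σ₁ * p' + -σ₂ / (p - 1))
    set B := ∫ x, G x ^ p' * ‖x‖ ^ (-σ₂ / (p - 1))
    have hA : 0 ≤ A := integral_nonneg fun x => Real.rpow_nonneg (norm_nonneg _) _
    have hB : 0 ≤ B := integral_nonneg fun x =>
      mul_nonneg (Real.rpow_nonneg (hG x) _) (Real.rpow_nonneg (norm_nonneg _) _)
    have hTp : T * T⁻¹ ^ p' = T ^ (1 - p') := by
      rw [Real.rpow_sub hT, Real.rpow_one, Real.inv_rpow hT.le, div_eq_mul_inv]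
    rw [Real.mul_rpow hC₁ (by positivity)]
    have e1 : 4 * T * (2 ^ p' * (C₁ ^ p' * T⁻¹ ^ p') * A + 2 ^ p' * B)
        = 4 * (2 ^ p' * C₁ ^ p' * (T ^ (1 - p') * A) + 2 ^ p' * (T * B)) := by
      rw [← hTp]; ring
    rw [e1]
    have hx : 0 ≤ T ^ (1 - p') * A := by positivity
    have hy : 0 ≤ T * B := by positivity
    have hc : (0 : ℝ) ≤ 2 ^ p' := by positivity
    have hd : (0 : ℝ) ≤ 2 ^ p' * C₁ ^ p' := by positivity
    nlinarith [mul_nonneg hc hx, mul_nonneg hd hy]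
  · rintro ⟨t, x⟩ ht hx
    simp only at ht hx
    have hF0 : 0 ≤ F (t, x) := by
      simp only [hF]
      refine mul_nonneg (indicator_nonneg (fun _ _ => zero_le_one) _) ?_
      have := hind x; have := hG x; positivity
    refine ⟨hF0, ?_, ?_⟩
    · simp only [hF]
      by_cases htT : t < 4 * T
      · simp only [indicator_of_mem (mem_Iio.2 htT), Pi.one_apply, one_mul]
        rw [Real.mul_rpow (hηT.nonneg _) (hf.nonneg _), hηTd]
        set X := η (t / T) ^ (1 / p)
        set Y := f (‖x‖ ^ 2) ^ (1 / p)
        have hX : 0 ≤ X := Real.rpow_nonneg (hηT.nonneg _) _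
        have hY : 0 ≤ Y := Real.rpow_nonneg (hf.nonneg _) _
        have hηX : η (t / T) ≤ X := hη.le_rpow hp _
        have hfY : f (‖x‖ ^ 2) ≤ Y := hf.le_rpow hp _
        have hr : 0 ≤ ‖x‖ ^ σ₁ := Real.rpow_nonneg (norm_nonneg _) _
        have a1 : |‖x‖ ^ σ₁ * (deriv η (t / T) * T⁻¹ * f (‖x‖ ^ 2))|
            ≤ C₁ * T⁻¹ * S.indicator (fun x => ‖x‖ ^ σ₁) x * (X * Y) := by
          by_cases hxS : x ∈ S
          · rw [indicator_of_mem hxS, abs_mul, abs_mul, abs_mul, abs_of_nonneg hr,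
              abs_of_pos (inv_pos.2 hT), abs_of_nonneg (hf.nonneg _)]
            calc _ ≤ ‖x‖ ^ σ₁ * (C₁ * X * T⁻¹ * Y) := by
                  have := (hbound (t / T)).1
                  have := hf.nonneg (‖x‖ ^ 2)
                  gcongr
              _ = _ := by ring
          · simp [hfS x hxS, hxS]
        have a2 : |η (t / T) * Laplacian.laplacian (fun y : Space N => f (‖y‖ ^ 2)) x|
            ≤ G x * (X * Y) := by
          rw [abs_mul, abs_of_nonneg (hη.nonneg _)]
          calc _ ≤ X * (G x * Y) := by
                gcongr
                exact hlap x hx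
            _ = _ := by ring
        refine (abs_sub _ _).trans ?_
        rw [abs_neg, add_mul]
        exact add_le_add a1 a2
      · have ht4 : 4 * T ≤ t := not_lt.1 htT
        -- The endpoint t = 4T belongs to this case, so the derivative is computed from the right,
        -- where the function is zero.
        have hz : (fun t => η (t / T)) =ᶠ[𝓝[>] t] fun _ => 0 := by
          filter_upwards [self_mem_nhdsWithin] with s hs
          exact hηT0 s (ht4.trans (le_of_lt hs))
        have hd : deriv (fun t => η (t / T)) t = 0 := by
          rw [← (hηT.hasDerivAt t).hasDerivWithinAt.derivWithin (uniqueDiffWithinAt_Ioi t),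
            hz.derivWithin_eq (hηT0 t ht4)]
          simp
        simp [hd, hηT0 t ht4, htT]
    · simp only [hF, hk, ← hp'def]
      by_cases htT : t < 4 * T
      · simp only [indicator_of_mem (mem_Iio.2 htT), Pi.one_apply, one_mul]
        have hr : 0 < ‖x‖ := norm_pos_iff.2 hx
        have h1 := Real.add_rpow_le_two_rpow_mul
          (mul_nonneg (mul_nonneg hC₁ (inv_pos.2 hT).le) (hind x)) (hG x) hp'
        have h2 : (C₁ * T⁻¹ * S.indicator (fun x => ‖x‖ ^ σ₁) x) ^ p' * ‖x‖ ^ (-σ₂ / (p - 1))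
            = (C₁ * T⁻¹) ^ p' * S.indicator (fun x => ‖x‖ ^ (σ₁ * p' + -σ₂ / (p - 1))) x := by
          rw [Real.mul_rpow (by positivity) (hind x)]
          by_cases hxS : x ∈ S
          · simp only [indicator_of_mem hxS]
            rw [Real.rpow_add hr, Real.rpow_mul hr.le, mul_assoc]
          · have : p' ≠ 0 := by positivity
            simp [hxS, Real.zero_rpow this]
        calc _ ≤ _ := mul_le_mul_of_nonneg_right h1 (Real.rpow_nonneg hr.le _)
          _ = _ := by rw [mul_assoc, add_mul, h2]; ring
      · have : p' ≠ 0 := by positivity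
        simp [htT, Real.zero_rpow this]


/-! ### Powers of the norm on shells, and exhausting cutoffs. -/

/-- The set of points whose norm lies in `D`. -/
def shell (N : ℕ) (D : Set ℝ) : Set (Space N) := {x | ‖x‖ ∈ D}

theorem measurableSet_shell {N : ℕ} {D : Set ℝ} (hD : MeasurableSet D) :
    MeasurableSet (shell N D) := measurable_norm hD

theorem pow_mul_indicator_rpow {N : ℕ} (hN : 2 ≤ N) (D : Set ℝ) (a : ℝ) :
    EqOn (fun y : ℝ => y ^ (N - 1) • D.indicator (fun y => y ^ a) y)
      (D.indicator fun y => y ^ (a + N - 1)) (Ioi 0) := by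
  intro y hy
  have hy0 : (0 : ℝ) < y := hy
  by_cases hyD : y ∈ D
  · simp only [indicator_of_mem hyD, smul_eq_mul]
    rw [← Real.rpow_natCast, ← Real.rpow_add hy0, Nat.cast_sub (by omega)]
    congr 1
    push_cast; ring
  · simp [hyD]

theorem indicator_shell {N : ℕ} (D : Set ℝ) (a : ℝ) :
    (shell N D).indicator (fun x => ‖x‖ ^ a) = fun x => D.indicator (fun y => y ^ a) ‖x‖ := by
  funext x
  by_cases hx : ‖x‖ ∈ D
  · rw [indicator_of_mem (show x ∈ shell N D from hx), indicator_of_mem hx]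
  · rw [indicator_of_notMem (show x ∉ shell N D from hx), indicator_of_notMem hx]

theorem integrableOn_shell_iff {N : ℕ} (hN : 2 ≤ N) {D : Set ℝ} (hD : MeasurableSet D) (a : ℝ) :
    IntegrableOn (fun x : Space N => ‖x‖ ^ a) (shell N D) volume
      ↔ IntegrableOn (fun y : ℝ => y ^ (a + N - 1)) (D ∩ Ioi 0) volume := by
  have : Nonempty (Fin N) := ⟨⟨0, by omega⟩⟩
  rw [← integrable_indicator_iff (measurableSet_shell hD), indicator_shell,
    integrable_fun_norm_addHaar, finrank_euclideanSpace_fin,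
    integrableOn_congr_fun (pow_mul_indicator_rpow hN D a) measurableSet_Ioi,
    IntegrableOn, integrable_indicator_iff hD, IntegrableOn, Measure.restrict_restrict hD]
  rfl

theorem integral_shell {N : ℕ} (hN : 2 ≤ N) {D : Set ℝ} (hD : MeasurableSet D) (a : ℝ) :
    ∫ x in shell N D, ‖x‖ ^ a
      = N * volume.real (Metric.ball (0 : Space N) 1) * ∫ y in D ∩ Ioi 0, y ^ (a + N - 1) := by
  have : Nonempty (Fin N) := ⟨⟨0, by omega⟩⟩
  rw [← integral_indicator (measurableSet_shell hD), indicator_shell,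
    integral_fun_norm_addHaar, finrank_euclideanSpace_fin,
    setIntegral_congr_fun measurableSet_Ioi (pow_mul_indicator_rpow hN D a),
    integral_indicator hD, Measure.restrict_restrict hD]
  simp [mul_assoc]

theorem integrableOn_shell_Iio {N : ℕ} (hN : 2 ≤ N) {a R : ℝ} (ha : -N < a) :
    IntegrableOn (fun x : Space N => ‖x‖ ^ a) (shell N (Iio R)) volume := by
  rw [integrableOn_shell_iff hN measurableSet_Iio, Iio_inter_Ioi]
  rcases le_or_gt R 0 with hR | hR
  · simp [hR]
  · rw [intervalIntegral.integrableOn_Ioo_rpow_iff hR]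
    linarith

theorem integrableOn_shell_Icc {N : ℕ} (hN : 2 ≤ N) {c d : ℝ} (hc : 0 < c) (a : ℝ) :
    IntegrableOn (fun x : Space N => ‖x‖ ^ a) (shell N (Icc c d)) volume := by
  rw [integrableOn_shell_iff hN measurableSet_Icc]
  have hsub : Icc c d ⊆ Ioi 0 := fun y hy => hc.trans_le hy.1
  rw [inter_eq_left.2 hsub]
  refine ContinuousOn.integrableOn_Icc fun y hy => ?_
  exact (Real.continuousAt_rpow_const y _ (Or.inl (hsub hy).ne')).continuousWithinAt

theorem integral_shell_scale {N : ℕ} {D D' : Set ℝ} (hD : MeasurableSet D) (hD' : MeasurableSet D')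
    {R : ℝ} (hR : 0 < R) (h : ∀ y, y ∈ D' ↔ R⁻¹ * y ∈ D) (a : ℝ) :
    ∫ x in shell N D', ‖x‖ ^ a = R ^ (a + N) * ∫ x in shell N D, ‖x‖ ^ a := by
  have key := Measure.integral_comp_inv_smul (volume : Measure (Space N))
    ((shell N D).indicator (fun x => ‖x‖ ^ a)) R
  rw [integral_indicator (measurableSet_shell hD), finrank_euclideanSpace_fin,
    abs_of_pos (by positivity), smul_eq_mul] at key
  rw [Real.rpow_add hR, Real.rpow_natCast, mul_assoc, ← key, ← integral_const_mul,
    ← integral_indicator (measurableSet_shell hD')]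
  refine integral_congr_ae (Eventually.of_forall fun x => ?_)
  have hn : ‖R⁻¹ • x‖ = R⁻¹ * ‖x‖ := by rw [norm_smul, Real.norm_of_nonneg (by positivity)]
  by_cases hx : x ∈ shell N D'
  · have hx' : R⁻¹ • x ∈ shell N D := by
      change ‖R⁻¹ • x‖ ∈ D
      rw [hn]; exact (h _).1 hx
    simp only [indicator_of_mem hx, indicator_of_mem hx', hn]
    rw [Real.mul_rpow (by positivity) (norm_nonneg _), Real.inv_rpow hR.le]
    field_simp
  · have hx' : R⁻¹ • x ∉ shell N D := by
      change ‖R⁻¹ • x‖ ∉ D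
      rw [hn]; exact fun hh => hx ((h _).2 hh)
    simp only [indicator_of_notMem hx, indicator_of_notMem hx', mul_zero]

/-- Pointwise convergence is asked off the origin only, so cutoffs vanishing near 0 are admitted. -/
theorem tendsto_integral_mul_of_bounded {N : ℕ} {w : Space N → ℝ} (hw : Integrable w volume)
    {ι : Type*} {l : Filter ι} [l.IsCountablyGenerated] {ζ : ι → Space N → ℝ}
    (hm : ∀ i, Continuous (ζ i)) (hb : ∀ i x, |ζ i x| ≤ 1)
    (h1 : ∀ x, x ≠ 0 → ∀ᶠ i in l, ζ i x = 1) (hN : 2 ≤ N) :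
    Tendsto (fun i => ∫ x, w x * ζ i x) l (𝓝 (∫ x, w x)) := by
  have : Nonempty (Fin N) := ⟨⟨0, by omega⟩⟩
  refine tendsto_integral_filter_of_dominated_convergence (fun x => |w x|) ?_ ?_ hw.abs ?_
  · exact Eventually.of_forall fun i => hw.1.mul (hm i).aestronglyMeasurable
  · refine Eventually.of_forall fun i => Eventually.of_forall fun x => ?_
    rw [Real.norm_eq_abs, abs_mul]
    exact mul_le_of_le_one_right (abs_nonneg _) (hb i x)
  · have h0 : ∀ᵐ x ∂(volume : Measure (Space N)), x ≠ 0 := by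
      rw [ae_iff]; simp
    filter_upwards [h0] with x hx
    refine tendsto_const_nhds.congr' ?_
    filter_upwards [h1 x hx] with i hi
    rw [hi, mul_one]

/-- Laplacian of a radial cutoff at scale `R`. -/
theorem IsCutoff.exists_laplacian_scale_le {N : ℕ} {p : ℝ} (hp : 1 < p) {ξ : ℝ → ℝ}
    (hξ : IsCutoff p ξ) (h1 : ∀ q ≤ 1, ξ q = 1) (h0 : ∀ q, 2 ≤ q → ξ q = 0) :
    ∃ C, 0 ≤ C ∧ ∀ R, 0 < R → ∀ x : Space N,
      |Laplacian.laplacian (fun y : Space N => ξ ((R ^ 2)⁻¹ * ‖y‖ ^ 2 + 0)) x|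
        ≤ (shell N (Icc R (2 * R))).indicator (fun _ => C * (R ^ 2)⁻¹) x
          * ξ ((R ^ 2)⁻¹ * ‖x‖ ^ 2 + 0) ^ (1 / p) := by
  obtain ⟨C, hC, hb⟩ := hξ.exists_bound
  refine ⟨16 * C + 2 * N * C, by positivity, fun R hR x => ?_⟩
  set a := (R ^ 2)⁻¹ with ha
  have ha0 : 0 < a := by positivity
  have hq : ∀ q : ℝ, HasDerivAt (fun q : ℝ => a * q + 0) a q := fun q => by
    simpa using ((hasDerivAt_id q).const_mul a).add_const 0
  have hlap := laplacian_comp_norm_sq (N := N) (x := x) (f := fun q => ξ (a * q + 0))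
    (f₁ := fun q => deriv ξ (a * q + 0) * a) (f₂ := deriv (deriv ξ) (a * ‖x‖ ^ 2 + 0) * a * a)
    (Eventually.of_forall fun q => (hξ.hasDerivAt _).comp q (hq q))
    (((hξ.hasDerivAt_deriv _).comp (‖x‖ ^ 2) (hq _)).mul_const a)
  rw [hlap]
  set q := a * ‖x‖ ^ 2 + 0 with hqdef
  have hqx : ‖x‖ ^ 2 = R ^ 2 * q := by rw [hqdef, ha]; field_simp; ring
  by_cases hx : ‖x‖ ∈ Icc R (2 * R)
  · rw [indicator_of_mem (show x ∈ shell N (Icc R (2 * R)) from hx)]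
    obtain ⟨b1, b2⟩ := hb q
    have hY : 0 ≤ ξ q ^ (1 / p) := Real.rpow_nonneg (hξ.nonneg _) _
    have hx2 : ‖x‖ ^ 2 * a ≤ 4 := by
      have : ‖x‖ ^ 2 ≤ (2 * R) ^ 2 := pow_le_pow_left₀ (norm_nonneg _) hx.2 2
      rw [ha, ← div_eq_mul_inv, div_le_iff₀ (by positivity)]
      linarith
    calc |4 * ‖x‖ ^ 2 * (deriv (deriv ξ) q * a * a) + 2 * N * (deriv ξ q * a)|
        = |4 * (‖x‖ ^ 2 * a) * deriv (deriv ξ) q + 2 * N * deriv ξ q| * a := by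
          rw [← abs_of_pos ha0, ← abs_mul, abs_of_pos ha0]; congr 1; ring
      _ ≤ (4 * (‖x‖ ^ 2 * a) * |deriv (deriv ξ) q| + 2 * N * |deriv ξ q|) * a := by
          gcongr
          refine (abs_add_le _ _).trans (le_of_eq ?_)
          rw [abs_mul, abs_mul (2 * (N : ℝ)), abs_of_nonneg (by positivity : 0 ≤ 4 * (‖x‖ ^ 2 * a)),
            abs_of_nonneg (by positivity : 0 ≤ 2 * (N : ℝ))]
      _ ≤ (4 * 4 * (C * ξ q ^ (1 / p)) + 2 * N * (C * ξ q ^ (1 / p))) * a := by gcongr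
      _ = _ := by ring
  · rw [indicator_of_notMem (show x ∉ shell N (Icc R (2 * R)) from hx), zero_mul]
    suffices deriv ξ q = 0 ∧ deriv (deriv ξ) q = 0 by simp [this.1, this.2]
    have hR2 : 0 < R ^ 2 := by positivity
    simp only [mem_Icc, not_and_or, not_le] at hx
    rcases hx with hx | hx
    · have : ‖x‖ ^ 2 < R ^ 2 := pow_lt_pow_left₀ hx (norm_nonneg _) two_ne_zero
      exact deriv_eq_zero_of_eq_one_of_lt h1 (by nlinarith)
    · have : (2 * R) ^ 2 < ‖x‖ ^ 2 := pow_lt_pow_left₀ hx (by positivity) two_ne_zero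
      exact hξ.deriv_eq_zero_of_eq_zero hp (h0 q (by nlinarith))


/-! ### Positive ϱ, and the subcritical range. -/

/-- With a fixed spatial factor supported away from the origin no condition on the weights arises.
For T ≥ 1 the right-hand side is O(T), against T^(1+ϱ) on the left. -/
theorem IsGlobalWeakSolution.false_of_pos {N : ℕ} (hN : 2 ≤ N) {σ₁ σ₂ ϱ p : ℝ}
    (hp : 1 < p) (hϱ : 0 < ϱ) {w u₀ : Space N → ℝ} (hw : Integrable w volume)
    (hw_pos : 0 < ∫ x, w x) {u : ℝ × Space N → ℝ}
    (hu : IsGlobalWeakSolution σ₁ σ₂ ϱ p w u₀ u) : False := by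
  obtain ⟨I, C, hI, hC, hest⟩ := hu.exists_product_estimate hN hp (by linarith) hw
  obtain ⟨ξ, hξ, h1, h0⟩ := exists_isCutoff hp
  -- For n > 0 the first factor is 1 up to q = n and 0 from q = 2n; the second is 0 up to q = 1/n
  -- and 1 from q = 2/n.
  have hfn : ∀ n : ℝ, IsCutoff p fun q => ξ (n⁻¹ * q + 0) * ξ (-n * q + 3) := fun n =>
    (hξ.comp_affine n⁻¹ 0).mul hp (hξ.comp_affine (-n) 3)
  have hlim : Tendsto (fun n : ℝ => ∫ x, w x * (fun q => ξ (n⁻¹ * q + 0) * ξ (-n * q + 3)) (‖x‖ ^ 2))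
      atTop (𝓝 (∫ x, w x)) := by
    refine tendsto_integral_mul_of_bounded hw
      (fun n => (contDiff_comp_norm_sq (hfn n).contDiff).continuous) (fun n x => ?_) (fun x hx => ?_) hN
    · rw [abs_of_nonneg ((hfn n).nonneg _)]
      exact (hfn n).le_one _
    · have hx0 : 0 < ‖x‖ ^ 2 := by have := norm_pos_iff.2 hx; positivity
      filter_upwards [eventually_ge_atTop (‖x‖ ^ 2), eventually_ge_atTop (2 / ‖x‖ ^ 2),
        eventually_gt_atTop 0] with n hn hn' hn0
      rw [div_le_iff₀ hx0] at hn'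
      have e1 : ξ (n⁻¹ * ‖x‖ ^ 2 + 0) = 1 := h1 _ (by
        rw [add_zero, inv_mul_le_iff₀ hn0]; linarith)
      have e2 : ξ (-n * ‖x‖ ^ 2 + 3) = 1 := h1 _ (by linarith)
      simp only [e1, e2, mul_one]
  -- From here on n is frozen, large enough for the integral of w against the cutoff to be positive.
  obtain ⟨n, hnpos, hn1⟩ :=
    ((hlim.eventually (lt_mem_nhds hw_pos)).and (eventually_ge_atTop 1)).exists
  set f : ℝ → ℝ := fun q => ξ (n⁻¹ * q + 0) * ξ (-n * q + 3) with hf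
  have hn0 : 0 < n := by linarith
  obtain ⟨Cf, hCf, hbf⟩ := (hfn n).exists_bound
  set S : Set (Space N) := shell N (Icc n⁻¹ (2 * n)) with hS
  have hSm : MeasurableSet S := measurableSet_shell measurableSet_Icc
  have hQ : ∀ q, 2 * n ≤ q → f q = 0 := fun q hq => by
    have : ξ (n⁻¹ * q + 0) = 0 := h0 _ (by
      rw [add_zero, ← div_eq_inv_mul, le_div_iff₀ hn0]; exact hq)
    simp only [hf, this, zero_mul]
  have hfS : ∀ x, x ∉ S → f (‖x‖ ^ 2) = 0 := by
    intro x hx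
    have hx' : ¬ (n⁻¹ ≤ ‖x‖ ∧ ‖x‖ ≤ 2 * n) := hx
    rw [not_and_or, not_le, not_le] at hx'
    rcases hx' with hx' | hx'
    · have hle : ‖x‖ ^ 2 ≤ n⁻¹ := by
        have h1' : n⁻¹ ≤ 1 := inv_le_one_of_one_le₀ hn1
        have := norm_nonneg x
        nlinarith
      have : ξ (-n * ‖x‖ ^ 2 + 3) = 0 := h0 _ (by
        have : n * ‖x‖ ^ 2 ≤ n * n⁻¹ := by gcongr
        rw [mul_inv_cancel₀ hn0.ne'] at this
        linarith)
      simp only [hf, this, mul_zero]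
    · exact hQ _ (by nlinarith)
  set G : Space N → ℝ := fun x => S.indicator (fun _ => 4 * (2 * n) ^ 2 * Cf + 2 * N * Cf) x with hG
  have hG0 : ∀ x, 0 ≤ G x := fun x => indicator_nonneg (fun _ _ => by positivity) x
  have hGint : Integrable (fun x => G x ^ (p / (p - 1)) * ‖x‖ ^ (-σ₂ / (p - 1))) volume := by
    have hp1 : 0 < p - 1 := by linarith
    have hp' : p / (p - 1) ≠ 0 := by positivity
    have := ((integrableOn_shell_Icc hN (d := 2 * n) (inv_pos.2 hn0)
      (-σ₂ / (p - 1))).integrable_indicator hSm).const_mul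
        ((4 * (2 * n) ^ 2 * Cf + 2 * N * Cf) ^ (p / (p - 1)))
    refine this.congr (Eventually.of_forall fun x => ?_)
    by_cases hx : x ∈ S <;> simp [hG, hx, Real.zero_rpow hp', ← hS]
  have hlap : ∀ x : Space N, x ≠ 0 → |Laplacian.laplacian (fun y : Space N => f (‖y‖ ^ 2)) x|
      ≤ G x * f (‖x‖ ^ 2) ^ (1 / p) := by
    intro x _
    rw [(hfn n).laplacian_eq]
    obtain ⟨b1, b2⟩ := hbf (‖x‖ ^ 2)
    by_cases hx : x ∈ S
    · simp only [hG, indicator_of_mem hx]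
      have hx2 : ‖x‖ ^ 2 ≤ (2 * n) ^ 2 := pow_le_pow_left₀ (norm_nonneg _) hx.2 2
      have hY : 0 ≤ f (‖x‖ ^ 2) ^ (1 / p) := Real.rpow_nonneg ((hfn n).nonneg _) _
      refine (abs_add_le _ _).trans ?_
      rw [abs_mul, abs_mul (2 * (N : ℝ)), abs_of_nonneg (by positivity : 0 ≤ 4 * ‖x‖ ^ 2),
            abs_of_nonneg (by positivity : 0 ≤ 2 * (N : ℝ))]
      calc _ ≤ 4 * (2 * n) ^ 2 * (Cf * f (‖x‖ ^ 2) ^ (1 / p))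
            + 2 * N * (Cf * f (‖x‖ ^ 2) ^ (1 / p)) := by gcongr
        _ = _ := by ring
    · have e0 := hfS x hx
      simp only [hf] at e0
      rw [e0, Real.zero_rpow (by positivity), mul_zero, abs_nonpos_iff] at b1 b2
      rw [b1, b2]
      simp [hG, hx]
  set A := ∫ x in S, ‖x‖ ^ (σ₁ * (p / (p - 1)) + -σ₂ / (p - 1)) with hA
  set B := ∫ x, G x ^ (p / (p - 1)) * ‖x‖ ^ (-σ₂ / (p - 1)) with hB
  set J := ∫ x, w x * f (‖x‖ ^ 2) with hJ
  have hA0 : 0 ≤ A := integral_nonneg fun x => Real.rpow_nonneg (norm_nonneg _) _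
  have hmain : ∀ T : ℝ, 1 ≤ T → T ^ ϱ ≤ C * (A + B) / (I * J) := by
    intro T hT
    have hT0 : 0 < T := by linarith
    have h := hest f (2 * n) S G T (hfn n) hQ hSm hfS
      (integrableOn_shell_Icc hN (inv_pos.2 hn0) _) hG0 hlap hGint hT0
    rw [← hA, ← hB, ← hJ] at h
    have hTT : T ^ (1 - p / (p - 1)) ≤ T := by
      have hp' : 0 ≤ p / (p - 1) := div_nonneg (by linarith) (by linarith)
      calc T ^ (1 - p / (p - 1)) ≤ T ^ (1 : ℝ) := Real.rpow_le_rpow_of_exponent_le hT (by linarith)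
        _ = T := Real.rpow_one T
    rw [le_div_iff₀ (by positivity)]
    rw [Real.rpow_add hT0, Real.rpow_one] at h
    have h2 : C * (T ^ (1 - p / (p - 1)) * A + T * B) ≤ C * (T * A + T * B) := by gcongr
    have h3 : T * (T ^ ϱ * (I * J)) ≤ T * (C * (A + B)) := by linarith
    exact le_of_mul_le_mul_left h3 hT0
  obtain ⟨T, hT, hT1⟩ := (((tendsto_rpow_atTop hϱ).eventually_gt_atTop
    (C * (A + B) / (I * J))).and (eventually_ge_atTop 1)).exists
  exact absurd (hmain T hT1) (not_le.2 hT)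

/-- Functions `ξ (|x|^2 / R^2)` exhaust an integrable function. -/
theorem tendsto_integral_mul_cutoff {N : ℕ} (hN : 2 ≤ N) {p : ℝ} {w : Space N → ℝ}
    (hw : Integrable w volume) {ξ : ℝ → ℝ} (hξ : IsCutoff p ξ) (h1 : ∀ q ≤ 1, ξ q = 1) :
    Tendsto (fun R : ℝ => ∫ x, w x * ξ ((R ^ 2)⁻¹ * ‖x‖ ^ 2 + 0)) atTop (𝓝 (∫ x, w x)) := by
  refine tendsto_integral_mul_of_bounded hw (fun R =>
    (contDiff_comp_norm_sq (hξ.comp_affine (R ^ 2)⁻¹ 0).contDiff).continuous) (fun R x => ?_)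
    (fun x _ => ?_) hN
  · rw [abs_of_nonneg (hξ.nonneg _)]
    exact hξ.le_one _
  · filter_upwards [eventually_ge_atTop ‖x‖, eventually_gt_atTop 0] with R hR hR0
    refine h1 _ ?_
    rw [add_zero, inv_mul_le_iff₀ (by positivity), mul_one]
    exact pow_le_pow_left₀ (norm_nonneg _) hR 2

/-- The subcritical range in the case where `|x|^(σ₁p' - σ₂/(p-1))` is locally integrable. -/
theorem IsGlobalWeakSolution.false_of_subcritical {N : ℕ} (hN : 2 ≤ N) {σ₁ σ₂ ϱ p : ℝ}
    (hσ₁ : -2 < σ₁) (hp : 1 < p) (hϱ : -1 < ϱ) {w u₀ : Space N → ℝ} (hw : Integrable w volume)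
    (hw_pos : 0 < ∫ x, w x) {u : ℝ × Space N → ℝ}
    (hu : IsGlobalWeakSolution σ₁ σ₂ ϱ p w u₀ u)
    (hloc : -N < σ₁ * (p / (p - 1)) + -σ₂ / (p - 1))
    (hsub : N - 2 * (p / (p - 1)) + -σ₂ / (p - 1) < ϱ * (2 + σ₁)) : False := by
  obtain ⟨I, C, hI, hC, hest⟩ := hu.exists_product_estimate hN hp hϱ hw
  obtain ⟨ξ, hξ, h1, h0⟩ := exists_isCutoff hp
  obtain ⟨D, hD, hlap⟩ := hξ.exists_laplacian_scale_le (N := N) hp h1 h0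
  have hp1 : 0 < p - 1 := by linarith
  have hp'0 : 0 < p / (p - 1) := by positivity
  set p' := p / (p - 1) with hp'
  set b := -σ₂ / (p - 1) with hb
  set s := 2 + σ₁ with hs
  have hs0 : 0 < s := by linarith
  set A := ∫ x in shell N (Iio 2), ‖x‖ ^ (σ₁ * p' + b) with hA
  set B := ∫ x in shell N (Icc 1 2), ‖x‖ ^ b with hB
  have hmain : ∀ R : ℝ, 0 < R →
      R ^ (s * ϱ - (N - 2 * p' + b)) * (I * ∫ x, w x * ξ ((R ^ 2)⁻¹ * ‖x‖ ^ 2 + 0))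
        ≤ C * (A + D ^ p' * B) := by
    intro R hR
    have hQ : ∀ q, 2 * R ^ 2 ≤ q → ξ ((R ^ 2)⁻¹ * q + 0) = 0 := fun q hq => h0 _ (by
      rw [add_zero, ← div_eq_inv_mul, le_div_iff₀ (by positivity)]; exact hq)
    have hfS : ∀ x : Space N, x ∉ shell N (Iio (2 * R)) → ξ ((R ^ 2)⁻¹ * ‖x‖ ^ 2 + 0) = 0 := by
      intro x hx
      have hx' : 2 * R ≤ ‖x‖ := not_lt.1 hx
      refine hQ _ ?_
      nlinarith
    set G : Space N → ℝ := (shell N (Icc R (2 * R))).indicator (fun _ => D * (R ^ 2)⁻¹) with hG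
    have hann : ∀ y, y ∈ Icc R (2 * R) ↔ R⁻¹ * y ∈ Icc (1 : ℝ) 2 := fun y => by
      simp only [mem_Icc]
      rw [← div_eq_inv_mul, le_div_iff₀ hR, div_le_iff₀ hR, one_mul]
    have hball : ∀ y, y ∈ Iio (2 * R) ↔ R⁻¹ * y ∈ Iio (2 : ℝ) := fun y => by
      simp only [mem_Iio]
      rw [← div_eq_inv_mul, div_lt_iff₀ hR]
    have hGeq : (fun x : Space N => G x ^ p' * ‖x‖ ^ b) = fun x =>
        (D * (R ^ 2)⁻¹) ^ p' * (shell N (Icc R (2 * R))).indicator (fun x => ‖x‖ ^ b) x := by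
      funext x
      by_cases hx : x ∈ shell N (Icc R (2 * R)) <;> simp [hG, hx, Real.zero_rpow hp'0.ne']
    have hm := measurableSet_shell (N := N) (measurableSet_Icc (a := R) (b := 2 * R))
    -- T = R^(2+σ₁) is the time scale on which |x|^σ₁ ∂ₜ and Δ balance at |x| ~ R. Both terms on the
    -- right then carry the power R^(s+N-2p'+b).
    have h := hest (fun q => ξ ((R ^ 2)⁻¹ * q + 0)) (2 * R ^ 2) (shell N (Iio (2 * R))) G (R ^ s)
      (hξ.comp_affine _ _) hQ (measurableSet_shell measurableSet_Iio) hfS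
      (integrableOn_shell_Iio hN hloc)
      (fun x => indicator_nonneg (fun _ _ => by positivity) x) (fun x _ => hlap R hR x)
      (by rw [hGeq]; exact ((integrableOn_shell_Icc hN hR b).integrable_indicator hm).const_mul _)
      (by positivity)
    rw [hGeq, integral_const_mul, integral_indicator hm,
      integral_shell_scale measurableSet_Icc measurableSet_Icc hR hann,
      integral_shell_scale measurableSet_Iio measurableSet_Iio hR hball, ← hA, ← hB,
      Real.mul_rpow hD (by positivity)] at h
    have e1 : (R ^ s) ^ (1 - p') * (R ^ (σ₁ * p' + b + N) * A) = R ^ (s + (N - 2 * p' + b)) * A := by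
      rw [← Real.rpow_mul hR.le, ← mul_assoc, ← Real.rpow_add hR]
      congr 2
      rw [hs]; ring
    have e2 : R ^ s * (D ^ p' * ((R ^ 2)⁻¹) ^ p' * (R ^ (b + N) * B))
        = R ^ (s + (N - 2 * p' + b)) * (D ^ p' * B) := by
      have : ((R ^ 2)⁻¹) ^ p' = R ^ (-2 * p') := by
        rw [Real.rpow_mul hR.le, Real.rpow_neg hR.le]; norm_num
      rw [this, show s + (N - 2 * p' + b) = s + ((-2 * p') + (b + N)) by ring, Real.rpow_add hR s,
        Real.rpow_add hR (-2 * p')]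
      ring
    have e3 : (R ^ s) ^ (1 + ϱ) = R ^ (s + (N - 2 * p' + b)) * R ^ (s * ϱ - (N - 2 * p' + b)) := by
      rw [← Real.rpow_mul hR.le, ← Real.rpow_add hR]
      congr 1
      ring
    rw [e1, e2, e3] at h
    have hpos : 0 < R ^ (s + (N - 2 * p' + b)) := by positivity
    refine le_of_mul_le_mul_left ?_ hpos
    calc _ = _ := by ring
      _ ≤ _ := h
      _ = _ := by ring
  -- Subcriticality is exactly the positivity of the exponent left after dividing by the common
  -- power.
  have hlim := (tendsto_rpow_atTop (show 0 < s * ϱ - (N - 2 * p' + b) by linarith)).atTop_mul_pos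
    (mul_pos hI hw_pos) ((tendsto_integral_mul_cutoff hN hw hξ h1).const_mul I)
  obtain ⟨R, hR, hR0⟩ := ((hlim.eventually_gt_atTop (C * (A + D ^ p' * B))).and
    (eventually_gt_atTop 0)).exists
  exact absurd (hmain R hR0) (not_le.2 hR)


/-! ### The critical exponent: logarithmic cutoffs. -/

/-- `Real.log q` is log |q|, with value 0 at q = 0. So the composition is constant 1 near the
origin, and the formulas persist there because the derivatives of ξ vanish. -/
theorem IsCutoff.hasDerivAt_comp_log {p : ℝ} {ξ : ℝ → ℝ} (hξ : IsCutoff p ξ)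
    (h1 : ∀ q ≤ 1, ξ q = 1) {L : ℝ} (hL : 0 < L) (q : ℝ) :
    HasDerivAt (fun q => ξ (L⁻¹ * Real.log q)) (deriv ξ (L⁻¹ * Real.log q) * (L⁻¹ * q⁻¹)) q ∧
    HasDerivAt (fun q => deriv ξ (L⁻¹ * Real.log q) * (L⁻¹ * q⁻¹))
      (deriv (deriv ξ) (L⁻¹ * Real.log q) * (L⁻¹ * q⁻¹) * (L⁻¹ * q⁻¹)
        + deriv ξ (L⁻¹ * Real.log q) * (L⁻¹ * -(q ^ 2)⁻¹)) q := by
  rcases eq_or_ne q 0 with rfl | hq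
  · have hsmall : ∀ᶠ y : ℝ in 𝓝 0, L⁻¹ * Real.log y < 1 := by
      have hball : ∀ᶠ y : ℝ in 𝓝 0, |y| < 1 := by
        have := Metric.ball_mem_nhds (0 : ℝ) one_pos
        filter_upwards [this] with y hy
        simpa using hy
      filter_upwards [hball] with y hy
      have : Real.log y ≤ 0 := by
        rw [← Real.log_abs]
        exact Real.log_nonpos (abs_nonneg _) hy.le
      have : L⁻¹ * Real.log y ≤ 0 := mul_nonpos_of_nonneg_of_nonpos (by positivity) this
      linarith
    constructor
    · have : (fun q => ξ (L⁻¹ * Real.log q)) =ᶠ[𝓝 0] fun _ => 1 := by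
        filter_upwards [hsmall] with y hy using h1 _ hy.le
      simpa using (hasDerivAt_const (0 : ℝ) (1 : ℝ)).congr_of_eventuallyEq this
    · have : (fun q => deriv ξ (L⁻¹ * Real.log q) * (L⁻¹ * q⁻¹)) =ᶠ[𝓝 0] fun _ => 0 := by
        filter_upwards [hsmall] with y hy
        rw [(deriv_eq_zero_of_eq_one_of_lt h1 hy).1, zero_mul]
      simpa using (hasDerivAt_const (0 : ℝ) (0 : ℝ)).congr_of_eventuallyEq this
  · have hl : HasDerivAt (fun q => L⁻¹ * Real.log q) (L⁻¹ * q⁻¹) q :=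
      (Real.hasDerivAt_log hq).const_mul _
    refine ⟨(hξ.hasDerivAt _).comp q hl, ?_⟩
    exact ((hξ.hasDerivAt_deriv _).comp q hl).mul ((hasDerivAt_inv hq).const_mul _)

theorem IsCutoff.contDiff_comp_log {p : ℝ} {ξ : ℝ → ℝ} (hξ : IsCutoff p ξ)
    (h1 : ∀ q ≤ 1, ξ q = 1) {L : ℝ} (hL : 0 < L) :
    ContDiff ℝ ∞ (fun q => ξ (L⁻¹ * Real.log q)) := by
  rw [contDiff_iff_contDiffAt]
  intro q
  rcases eq_or_ne q 0 with rfl | hq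
  · have : (fun q => ξ (L⁻¹ * Real.log q)) =ᶠ[𝓝 0] fun _ => 1 := by
      filter_upwards [Metric.ball_mem_nhds (0 : ℝ) one_pos] with y hy
      have hy' : |y| < 1 := by simpa using hy
      have : Real.log y ≤ 0 := by
        rw [← Real.log_abs]
        exact Real.log_nonpos (abs_nonneg _) hy'.le
      have : L⁻¹ * Real.log y ≤ 0 := mul_nonpos_of_nonneg_of_nonpos (by positivity) this
      exact h1 _ (by linarith)
    exact contDiffAt_const.congr_of_eventuallyEq this
  · exact hξ.contDiff.contDiffAt.comp q (contDiffAt_const.mul (Real.contDiffAt_log.2 hq))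

theorem IsCutoff.comp_log {p : ℝ} {ξ : ℝ → ℝ} (hξ : IsCutoff p ξ)
    (h1 : ∀ q ≤ 1, ξ q = 1) {L : ℝ} (hL : 1 ≤ L) :
    IsCutoff p (fun q => ξ (L⁻¹ * Real.log q)) := by
  have hL0 : 0 < L := by linarith
  obtain ⟨C, hC, hb⟩ := hξ.exists_bound
  have hd : deriv (fun q => ξ (L⁻¹ * Real.log q))
      = fun q => deriv ξ (L⁻¹ * Real.log q) * (L⁻¹ * q⁻¹) :=
    funext fun q => (hξ.hasDerivAt_comp_log h1 hL0 q).1.deriv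
  refine ⟨hξ.contDiff_comp_log h1 hL0, fun q => hξ.nonneg _, fun q => hξ.le_one _, 2 * C,
    by positivity, fun q => ?_⟩
  rw [hd, (hξ.hasDerivAt_comp_log h1 hL0 q).2.deriv]
  beta_reduce
  by_cases hl : L⁻¹ * Real.log q < 1
  · rw [(deriv_eq_zero_of_eq_one_of_lt h1 hl).1, (deriv_eq_zero_of_eq_one_of_lt h1 hl).2]
    have := Real.rpow_nonneg (hξ.nonneg (L⁻¹ * Real.log q)) (1 / p)
    constructor
    · rw [zero_mul, abs_zero]; positivity
    · rw [zero_mul, zero_mul, zero_mul, add_zero, abs_zero]; positivity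
  · rw [not_lt] at hl
    obtain ⟨b1, b2⟩ := hb (L⁻¹ * Real.log q)
    have hq1 : 1 ≤ |q| := by
      by_contra! hlt
      have h0 : Real.log q ≤ 0 := by
        rw [← Real.log_abs]
        exact Real.log_nonpos (abs_nonneg _) hlt.le
      have : L⁻¹ * Real.log q ≤ 0 := mul_nonpos_of_nonneg_of_nonpos (by positivity) h0
      linarith
    have hi : |q⁻¹| ≤ 1 := by rw [abs_inv]; exact inv_le_one_of_one_le₀ hq1
    have hLi : |L⁻¹| ≤ 1 := by rw [abs_inv, abs_of_pos hL0]; exact inv_le_one_of_one_le₀ hL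
    have hLq : |L⁻¹ * q⁻¹| ≤ 1 := by
      rw [abs_mul]; exact mul_le_one₀ hLi (abs_nonneg _) hi
    have hLq2 : |L⁻¹ * -(q ^ 2)⁻¹| ≤ 1 := by
      rw [abs_mul, abs_neg, ← inv_pow, abs_pow]
      exact mul_le_one₀ hLi (by positivity) (pow_le_one₀ (abs_nonneg _) hi)
    have hY := Real.rpow_nonneg (hξ.nonneg (L⁻¹ * Real.log q)) (1 / p)
    set Y := ξ (L⁻¹ * Real.log q) ^ (1 / p)
    have hCY : 0 ≤ C * Y := by positivity
    constructor
    · rw [abs_mul]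
      calc _ ≤ (C * Y) * 1 := by gcongr
        _ ≤ _ := by linarith
    · refine (abs_add_le _ _).trans ?_
      rw [abs_mul, abs_mul, abs_mul (deriv ξ _)]
      calc _ ≤ (C * Y) * 1 * 1 + (C * Y) * 1 := by gcongr
        _ = _ := by ring

/-- A function of L⁻¹ log |x|² has Laplacian of order L⁻¹ |x|⁻²: each derivative of ξ brings a
factor L⁻¹, and the second one brought by the second derivative is bounded by 1. -/
theorem IsCutoff.exists_laplacian_log_le {N : ℕ} {p : ℝ} (hp : 1 < p) {ξ : ℝ → ℝ}
    (hξ : IsCutoff p ξ) (h1 : ∀ q ≤ 1, ξ q = 1) (h0 : ∀ q, 2 ≤ q → ξ q = 0) :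
    ∃ C, 0 ≤ C ∧ ∀ L, 1 ≤ L → ∀ x : Space N, x ≠ 0 →
      |Laplacian.laplacian (fun y : Space N => ξ (L⁻¹ * Real.log (‖y‖ ^ 2))) x|
        ≤ (shell N (Icc (Real.exp (L / 2)) (Real.exp L))).indicator
            (fun x => C * L⁻¹ * ‖x‖ ^ (-2 : ℝ)) x * ξ (L⁻¹ * Real.log (‖x‖ ^ 2)) ^ (1 / p) := by
  obtain ⟨C, hC, hb⟩ := hξ.exists_bound
  refine ⟨8 * C + 2 * N * C, by positivity, fun L hL x hx => ?_⟩
  have hL0 : 0 < L := by linarith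
  have hr : 0 < ‖x‖ := norm_pos_iff.2 hx
  have hlap := laplacian_comp_norm_sq (N := N) (x := x) (f := fun q => ξ (L⁻¹ * Real.log q))
    (Eventually.of_forall fun q => (hξ.hasDerivAt_comp_log h1 hL0 q).1)
    (hξ.hasDerivAt_comp_log h1 hL0 (‖x‖ ^ 2)).2
  rw [hlap]
  -- The shell e^(L/2) ≤ |x| ≤ e^L is the set 1 ≤ l ≤ 2, outside which ξ is locally constant.
  set l := L⁻¹ * Real.log (‖x‖ ^ 2) with hl
  have hlog : Real.log ‖x‖ = L * l / 2 := by
    rw [hl, Real.log_pow]; push_cast; field_simp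
  have hxe : ‖x‖ = Real.exp (L * l / 2) := by rw [← hlog, Real.exp_log hr]
  by_cases hxs : x ∈ shell N (Icc (Real.exp (L / 2)) (Real.exp L))
  · rw [indicator_of_mem hxs]
    obtain ⟨b1, b2⟩ := hb l
    have hY : 0 ≤ ξ l ^ (1 / p) := Real.rpow_nonneg (hξ.nonneg _) _
    set q := ‖x‖ ^ 2 with hq
    have hq0 : 0 < q := by positivity
    have hrp : ‖x‖ ^ (-2 : ℝ) = q⁻¹ := by rw [Real.rpow_neg hr.le, hq]; norm_num
    have hLi : L⁻¹ ≤ 1 := inv_le_one_of_one_le₀ hL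
    rw [hrp]
    have heq : 4 * q * (deriv (deriv ξ) l * (L⁻¹ * q⁻¹) * (L⁻¹ * q⁻¹)
        + deriv ξ l * (L⁻¹ * -(q ^ 2)⁻¹)) + 2 * N * (deriv ξ l * (L⁻¹ * q⁻¹))
        = (4 * (L⁻¹ * deriv (deriv ξ) l - deriv ξ l) + 2 * N * deriv ξ l) * (L⁻¹ * q⁻¹) := by
      field_simp
      ring
    rw [heq, abs_mul, abs_of_pos (by positivity : 0 < L⁻¹ * q⁻¹)]
    have hmain : |4 * (L⁻¹ * deriv (deriv ξ) l - deriv ξ l) + 2 * N * deriv ξ l|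
        ≤ (8 * C + 2 * N * C) * ξ l ^ (1 / p) := by
      have c1 : |L⁻¹ * deriv (deriv ξ) l| ≤ 1 * (C * ξ l ^ (1 / p)) := by
        rw [abs_mul, abs_of_pos (inv_pos.2 hL0)]; gcongr
      have c2 : |L⁻¹ * deriv (deriv ξ) l - deriv ξ l| ≤ 2 * (C * ξ l ^ (1 / p)) :=
        (abs_sub _ _).trans (by linarith)
      calc _ ≤ |4 * (L⁻¹ * deriv (deriv ξ) l - deriv ξ l)| + |2 * N * deriv ξ l| := abs_add_le _ _
        _ = 4 * |L⁻¹ * deriv (deriv ξ) l - deriv ξ l| + 2 * N * |deriv ξ l| := by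
          rw [abs_mul, abs_mul (2 * (N : ℝ)), abs_of_nonneg (by positivity : 0 ≤ 2 * (N : ℝ))]
          norm_num
        _ ≤ 4 * (2 * (C * ξ l ^ (1 / p))) + 2 * N * (C * ξ l ^ (1 / p)) := by gcongr
        _ = _ := by ring
    calc _ ≤ (8 * C + 2 * N * C) * ξ l ^ (1 / p) * (L⁻¹ * q⁻¹) := by gcongr
      _ = _ := by ring
  · rw [indicator_of_notMem hxs, zero_mul]
    suffices deriv ξ l = 0 ∧ deriv (deriv ξ) l = 0 by simp [this.1, this.2]
    have hx' : ¬ (Real.exp (L / 2) ≤ ‖x‖ ∧ ‖x‖ ≤ Real.exp L) := hxs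
    rw [hxe, Real.exp_le_exp, Real.exp_le_exp, not_and_or, not_le, not_le] at hx'
    rcases hx' with hx' | hx'
    · exact deriv_eq_zero_of_eq_one_of_lt h1 (by nlinarith)
    · exact hξ.deriv_eq_zero_of_eq_zero hp (h0 l (by nlinarith))

/-- At the critical exponent the Laplacian term is an integral of |x|^(-N), so only the logarithmic
width of the shell counts. -/
theorem integral_shell_exp {N : ℕ} (hN : 2 ≤ N) {L : ℝ} (hL : 0 < L) :
    ∫ x in shell N (Icc (Real.exp (L / 2)) (Real.exp L)), ‖x‖ ^ (-(N : ℝ))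
      = N * volume.real (Metric.ball (0 : Space N) 1) * (L / 2) := by
  rw [integral_shell hN measurableSet_Icc]
  congr 1
  have hsub : Icc (Real.exp (L / 2)) (Real.exp L) ⊆ Ioi 0 := fun y hy =>
    (Real.exp_pos _).trans_le hy.1
  have hle : Real.exp (L / 2) ≤ Real.exp L := Real.exp_le_exp.2 (by linarith)
  rw [inter_eq_left.2 hsub, integral_Icc_eq_integral_Ioc, ← intervalIntegral.integral_of_le hle]
  have : ∀ y : ℝ, y ^ (-(N : ℝ) + N - 1) = y⁻¹ := fun y => by
    rw [neg_add_cancel, zero_sub, Real.rpow_neg_one]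
  simp only [this]
  rw [integral_inv_of_pos (Real.exp_pos _) (Real.exp_pos _), ← Real.exp_sub, Real.log_exp]
  ring

/-- T → ∞ at fixed L removes the time derivative term, whatever its constant. The Laplacian term is
of order L^(-p') · L, which tends to 0 as L → ∞ because p' > 1. -/
theorem IsGlobalWeakSolution.false_of_critical {N : ℕ} (hN : 2 ≤ N) {σ₁ σ₂ p : ℝ}
    (hσ₁ : -2 < σ₁) (hp : 1 < p) {w u₀ : Space N → ℝ} (hw : Integrable w volume)
    (hw_pos : 0 < ∫ x, w x) {u : ℝ × Space N → ℝ}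
    (hu : IsGlobalWeakSolution σ₁ σ₂ 0 p w u₀ u)
    (hcrit : -2 * (p / (p - 1)) + -σ₂ / (p - 1) = -N) : False := by
  obtain ⟨I, C, hI, hC, hest⟩ := hu.exists_product_estimate hN hp (by norm_num) hw
  obtain ⟨ξ, hξ, h1, h0⟩ := exists_isCutoff hp
  obtain ⟨D, hD, hlap⟩ := hξ.exists_laplacian_log_le (N := N) hp h1 h0
  have hp1 : 0 < p - 1 := by linarith
  have hp'1 : 1 < p / (p - 1) := by rw [lt_div_iff₀ hp1]; linarith
  set p' := p / (p - 1) with hp'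
  have hp'0 : 0 < p' := by linarith
  set b := -σ₂ / (p - 1) with hb
  -- Criticality makes the exponent (2 + σ₁)p' - N, so integrability at the origin is automatic.
  have hloc : -(N : ℝ) < σ₁ * p' + b := by nlinarith
  set V := N * volume.real (Metric.ball (0 : Space N) 1) with hV
  have hmain : ∀ L : ℝ, 1 ≤ L → I * ∫ x, w x * ξ (L⁻¹ * Real.log (‖x‖ ^ 2))
      ≤ C * (D ^ p' * V / 2) * L ^ (-(p' - 1)) := by
    intro L hL
    have hL0 : 0 < L := by linarith
    set E := shell N (Icc (Real.exp (L / 2)) (Real.exp L)) with hE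
    set G : Space N → ℝ := E.indicator (fun x => D * L⁻¹ * ‖x‖ ^ (-2 : ℝ)) with hG
    have hm : MeasurableSet E := measurableSet_shell measurableSet_Icc
    have hGeq : (fun x : Space N => G x ^ p' * ‖x‖ ^ b) = fun x =>
        (D * L⁻¹) ^ p' * E.indicator (fun x => ‖x‖ ^ (-(N : ℝ))) x := by
      funext x
      by_cases hx : x ∈ E
      · have hx0 : 0 < ‖x‖ := (Real.exp_pos _).trans_le hx.1
        simp only [hG, indicator_of_mem hx]
        rw [Real.mul_rpow (by positivity) (by positivity), ← Real.rpow_mul hx0.le, mul_assoc,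
          ← Real.rpow_add hx0, hcrit]
      · simp [hG, hx, Real.zero_rpow hp'0.ne']
    have hQ : ∀ q, Real.exp (2 * L) ≤ q → ξ (L⁻¹ * Real.log q) = 0 := fun q hq => h0 _ (by
      have : 2 * L ≤ Real.log q := by
        rw [Real.le_log_iff_exp_le ((Real.exp_pos _).trans_le hq)]; exact hq
      rw [← div_eq_inv_mul, le_div_iff₀ hL0]; exact this)
    have hfS : ∀ x : Space N, x ∉ shell N (Iio (Real.exp L)) →
        ξ (L⁻¹ * Real.log (‖x‖ ^ 2)) = 0 := by
      intro x hx
      have hx' : Real.exp L ≤ ‖x‖ := not_lt.1 hx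
      refine hQ _ ?_
      rw [two_mul, Real.exp_add, sq]
      gcongr
    have hbound := fun T hT => hest (fun q => ξ (L⁻¹ * Real.log q)) (Real.exp (2 * L))
      (shell N (Iio (Real.exp L))) G T (hξ.comp_log h1 hL) hQ (measurableSet_shell measurableSet_Iio)
      hfS (integrableOn_shell_Iio hN hloc)
      (fun x => indicator_nonneg (fun _ _ => by positivity) x) (hlap L hL)
      (by rw [hGeq]
          exact ((integrableOn_shell_Icc hN (Real.exp_pos _) _).integrable_indicator hm).const_mul _)
      hT
    rw [hGeq, integral_const_mul, integral_indicator hm, hE, integral_shell_exp hN hL0, ← hV,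
      Real.mul_rpow hD (by positivity)] at hbound
    set A := ∫ x in shell N (Iio (Real.exp L)), ‖x‖ ^ (σ₁ * p' + b) with hA
    set J := ∫ x, w x * ξ (L⁻¹ * Real.log (‖x‖ ^ 2)) with hJ
    have hlim : Tendsto (fun T : ℝ => C * (T ^ (-p') * A + D ^ p' * L⁻¹ ^ p' * (V * (L / 2)))) atTop
        (𝓝 (C * (0 * A + D ^ p' * L⁻¹ ^ p' * (V * (L / 2))))) :=
      (((tendsto_rpow_neg_atTop hp'0).mul_const A).add_const _).const_mul C
    have hle : I * J ≤ C * (0 * A + D ^ p' * L⁻¹ ^ p' * (V * (L / 2))) := by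
      refine ge_of_tendsto hlim ?_
      filter_upwards [eventually_gt_atTop 0] with T hT
      have h := hbound T hT
      rw [add_zero, Real.rpow_one, Real.rpow_sub hT, Real.rpow_one] at h
      refine le_of_mul_le_mul_left ?_ hT
      rw [Real.rpow_neg hT.le]
      calc T * (I * J) = T * I * J := by ring
        _ ≤ _ := h
        _ = _ := by ring
    refine hle.trans (le_of_eq ?_)
    rw [neg_sub, Real.rpow_sub hL0, Real.rpow_one, Real.inv_rpow hL0.le]
    ring
  have hlim0 : Tendsto (fun L : ℝ => I * ∫ x, w x * ξ (L⁻¹ * Real.log (‖x‖ ^ 2))) atTop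
      (𝓝 (I * ∫ x, w x)) := by
    refine Tendsto.const_mul I ?_
    -- `max L 1` because the limit lemma asks for continuity at every index, while `comp_log`
    -- supplies it for L ≥ 1.
    have hlim1 : Tendsto (fun L : ℝ => ∫ x, w x * ξ ((max L 1)⁻¹ * Real.log (‖x‖ ^ 2))) atTop
        (𝓝 (∫ x, w x)) := by
      refine tendsto_integral_mul_of_bounded hw (fun L => (contDiff_comp_norm_sq
        (hξ.comp_log h1 (le_max_right L 1)).contDiff).continuous) (fun L x => ?_) (fun x _ => ?_) hN
      · rw [abs_of_nonneg (hξ.nonneg _)]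
        exact hξ.le_one _
      · filter_upwards [eventually_ge_atTop (Real.log (‖x‖ ^ 2))] with L hL
        refine h1 _ ?_
        rw [inv_mul_le_iff₀ (by positivity), mul_one]
        exact hL.trans (le_max_left _ _)
    refine hlim1.congr' ?_
    filter_upwards [eventually_ge_atTop 1] with L hL
    rw [max_eq_left hL]
  have hlim2 : Tendsto (fun L : ℝ => C * (D ^ p' * V / 2) * L ^ (-(p' - 1))) atTop
      (𝓝 (C * (D ^ p' * V / 2) * 0)) :=
    (tendsto_rpow_neg_atTop (by linarith)).const_mul _
  have := le_of_tendsto_of_tendsto hlim0 hlim2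
    (by filter_upwards [eventually_ge_atTop 1] with L hL using hmain L hL)
  have hpos := mul_pos hI hw_pos
  linarith


/-! ### Extending the weak formulation to test functions singular at the origin. -/

theorem laplacian_scale_eq_zero {N : ℕ} {p : ℝ} (hp : 1 < p) {ξ : ℝ → ℝ} (hξ : IsCutoff p ξ)
    (h1 : ∀ q ≤ 1, ξ q = 1) (h0 : ∀ q, 2 ≤ q → ξ q = 0) {R : ℝ} (hR : 0 < R) {x : Space N}
    (hx : ‖x‖ < R) :
    Laplacian.laplacian (fun y : Space N => ξ ((R ^ 2)⁻¹ * ‖y‖ ^ 2 + 0)) x = 0 := by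
  obtain ⟨C, -, hb⟩ := hξ.exists_laplacian_scale_le (N := N) hp h1 h0
  have h := hb R hR x
  have hx' : x ∉ shell N (Icc R (2 * R)) := fun h => not_le.2 hx h.1
  rwa [indicator_of_notMem hx', zero_mul, abs_nonpos_iff] at h

/-- A weak solution is integrable up to the initial time, with and without the weight. -/
theorem IsGlobalWeakSolution.integrableOn_cylinder {N : ℕ} (hN : 2 ≤ N) {σ₁ σ₂ ϱ p : ℝ}
    (hp : 1 < p) (hϱ : -1 < ϱ) {w u₀ : Space N → ℝ} (hw : Integrable w volume)
    {u : ℝ × Space N → ℝ} (hu : IsGlobalWeakSolution σ₁ σ₂ ϱ p w u₀ u) {T R : ℝ} (hT : 0 < T)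
    (hR : 0 < R) :
    IntegrableOn u (Ioo 0 T ×ˢ shell N (Iio R)) volume ∧
    IntegrableOn (fun z => ‖z.2‖ ^ σ₁ * u z) (Ioo 0 T ×ˢ shell N (Iio R)) volume ∧
    IntegrableOn (fun z => ‖z.2‖ ^ σ₂ * |u z| ^ p) (Ioo 0 T ×ˢ shell N (Iio R)) volume ∧
    IntegrableOn (fun x => ‖x‖ ^ σ₁ * u₀ x) (shell N (Iio R)) volume := by
  obtain ⟨ξ, hξ, h1, h0⟩ := exists_isCutoff hp
  have hθ := hξ.comp_affine T⁻¹ 0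
  have hζ := hξ.comp_affine (R ^ 2)⁻¹ 0
  have hθ0 : ∀ t, 2 * T ≤ t → ξ (T⁻¹ * t + 0) = 0 := fun t ht => h0 _ (by
    rw [add_zero, ← div_eq_inv_mul, le_div_iff₀ hT]; exact ht)
  have hζ0 : ∀ q, 2 * R ^ 2 ≤ q → ξ ((R ^ 2)⁻¹ * q + 0) = 0 := fun q hq => h0 _ (by
    rw [add_zero, ← div_eq_inv_mul, le_div_iff₀ (by positivity)]; exact hq)
  have hθ1 : ∀ t, t < T → ξ (T⁻¹ * t + 0) = 1 := fun t ht => h1 _ (by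
    rw [add_zero, ← div_eq_inv_mul, div_le_one₀ hT]; exact ht.le)
  have hζ1 : ∀ q, q < R ^ 2 → ξ ((R ^ 2)⁻¹ * q + 0) = 1 := fun q hq => h1 _ (by
    rw [add_zero, ← div_eq_inv_mul, div_le_one₀ (by positivity)]; exact hq.le)
  have hsq : ∀ x : Space N, x ∈ shell N (Iio R) → ‖x‖ ^ 2 < R ^ 2 := fun x hx =>
    pow_lt_pow_left₀ hx (norm_nonneg _) two_ne_zero
  set K : Set (ℝ × Space N) := Ioo 0 T ×ˢ shell N (Iio R) with hK
  have hKm : MeasurableSet K := measurableSet_Ioo.prod (measurableSet_shell measurableSet_Iio)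
  have hKsub : K ⊆ Ioi 0 ×ˢ univ := fun z hz => ⟨hz.1.1, mem_univ _⟩
  have hθev : ∀ t, t < T → (fun s => ξ (T⁻¹ * s + 0)) =ᶠ[𝓝 t] fun _ => 1 := fun t ht => by
    filter_upwards [gt_mem_nhds ht] with s hs using hθ1 s hs
  -- Local integrability on t > 0 gives nothing up to t = 0; the convergence required by the
  -- definition does. On the cylinder the three test functions are 1, t and |x|². The last two have
  -- adjoints -|x|^σ₁ and -2N, which yield |x|^σ₁ u and u.
  have pair0 := hu.isTestPair hϱ hw hθ.contDiff hθ0 (contDiff_comp_norm_sq (N := N) hζ.contDiff)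
    (hasCompactSupport_comp_norm_sq hζ0)
  have pair1 := hu.isTestPair hϱ hw (η := fun t => t * ξ (T⁻¹ * t + 0)) (T := 2 * T)
    (contDiff_id.mul hθ.contDiff) (fun t ht => by rw [hθ0 t ht, mul_zero])
    (contDiff_comp_norm_sq (N := N) hζ.contDiff) (hasCompactSupport_comp_norm_sq hζ0)
  have pair2 := hu.isTestPair hϱ hw hθ.contDiff hθ0
    (contDiff_comp_norm_sq (N := N) (f := fun q => q * ξ ((R ^ 2)⁻¹ * q + 0))
      (contDiff_id.mul hζ.contDiff))
    (hasCompactSupport_comp_norm_sq (Q := 2 * R ^ 2) (f := fun q => q * ξ ((R ^ 2)⁻¹ * q + 0)) (fun q hq => by rw [hζ0 q hq, mul_zero]))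
  refine ⟨?_, ?_, ?_, ?_⟩
  · have h := (pair2.integrable_adjoint.mono_set hKsub).const_mul (-(2 * (N : ℝ))⁻¹)
    refine IntegrableOn.congr_fun h (fun z hz => ?_) hKm
    have hd : deriv (fun t => ξ (T⁻¹ * t + 0)) z.1 = 0 := by
      rw [(hθev z.1 hz.1.2).deriv_eq]; simp
    have hlap := laplacian_comp_norm_sq (N := N) (x := z.2)
      (f := fun q => q * ξ ((R ^ 2)⁻¹ * q + 0)) (f₁ := fun _ => 1) (f₂ := 0) (by
        filter_upwards [gt_mem_nhds (hsq z.2 hz.2)] with q hq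
        refine (hasDerivAt_id q).congr_of_eventuallyEq ?_
        filter_upwards [gt_mem_nhds hq] with y hy
        rw [hζ1 y hy, mul_one, id]) (hasDerivAt_const _ _)
    have hN0 : (N : ℝ) ≠ 0 := by positivity
    rw [hd, hlap, hθ1 z.1 hz.1.2]
    field_simp
    ring
  · have h := (pair1.integrable_adjoint.mono_set hKsub).const_mul (-1)
    refine IntegrableOn.congr_fun h (fun z hz => ?_) hKm
    have hd : deriv (fun t => t * ξ (T⁻¹ * t + 0)) z.1 = 1 := by
      have : (fun t => t * ξ (T⁻¹ * t + 0)) =ᶠ[𝓝 z.1] fun t => t := by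
        filter_upwards [hθev z.1 hz.1.2] with s hs
        rw [hs, mul_one]
      rw [this.deriv_eq]; simp
    rw [hd, laplacian_scale_eq_zero hp hξ h1 h0 hR hz.2, hζ1 _ (hsq z.2 hz.2)]
    ring
  · have h := pair0.integrable_nonlinearity.mono_set hKsub
    refine IntegrableOn.congr_fun h (fun z hz => ?_) hKm
    rw [hθ1 z.1 hz.1.2, hζ1 _ (hsq z.2 hz.2)]
    ring
  · have h := pair0.integrable_initial.integrableOn (s := shell N (Iio R))
    refine IntegrableOn.congr_fun h (fun x hx => ?_) (measurableSet_shell measurableSet_Iio)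
    rw [hθ1 0 hT, hζ1 _ (hsq x hx)]
    ring

theorem integrable_and_tendsto_of_dominated {α : Type*} [MeasurableSpace α] {μ : Measure α}
    {F : ℕ → α → ℝ} {f bound : α → ℝ} (hF : ∀ n, Integrable (F n) μ) (hb : Integrable bound μ)
    (hle : ∀ n, ∀ᵐ a ∂μ, |F n a| ≤ bound a)
    (hlim : ∀ᵐ a ∂μ, Tendsto (fun n => F n a) atTop (𝓝 (f a))) :
    Integrable f μ ∧ Tendsto (fun n => ∫ a, F n a ∂μ) atTop (𝓝 (∫ a, f a ∂μ)) := by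
  refine ⟨⟨aestronglyMeasurable_of_tendsto_ae _ (fun n => (hF n).1) hlim, ?_⟩,
    tendsto_integral_of_dominated_convergence bound (fun n => (hF n).1) hb hle hlim⟩
  exact hasFiniteIntegral_of_dominated_convergence hb.2 hle hlim

/-- The class of test pairs is closed under dominated pointwise limits. -/
theorem IsTestPair.of_tendsto {N : ℕ} (hN : 2 ≤ N) {σ₁ σ₂ ϱ p : ℝ} {w u₀ : Space N → ℝ}
    {u : ℝ × Space N → ℝ} {ψ Λ : ℕ → ℝ × Space N → ℝ} {ψ' Λ' : ℝ × Space N → ℝ}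
    (h : ∀ n, IsTestPair σ₁ σ₂ ϱ p w u₀ u (ψ n) (Λ n))
    {M T R : ℝ}
    (hψ0 : ∀ n t x, (T ≤ t ∨ R ≤ ‖x‖) → ψ n (t, x) = 0)
    (hΛ0 : ∀ n t x, (T ≤ t ∨ R ≤ ‖x‖) → Λ n (t, x) = 0)
    (hψM : ∀ n t x, 0 ≤ t → |ψ n (t, x)| ≤ M)
    (hΛM : ∀ n t x, 0 < t → x ≠ 0 → |Λ n (t, x)| ≤ M * (1 + ‖x‖ ^ σ₁))
    (hψ : ∀ t x, 0 ≤ t → x ≠ 0 → Tendsto (fun n => ψ n (t, x)) atTop (𝓝 (ψ' (t, x))))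
    (hΛ : ∀ t x, 0 < t → x ≠ 0 → Tendsto (fun n => Λ n (t, x)) atTop (𝓝 (Λ' (t, x))))
    (hu1 : IntegrableOn u (Ioo 0 T ×ˢ shell N (Iio R)) volume)
    (hu2 : IntegrableOn (fun z => ‖z.2‖ ^ σ₁ * u z) (Ioo 0 T ×ˢ shell N (Iio R)) volume)
    (hu3 : IntegrableOn (fun z => ‖z.2‖ ^ σ₂ * |u z| ^ p) (Ioo 0 T ×ˢ shell N (Iio R)) volume)
    (hu4 : IntegrableOn (fun x => ‖x‖ ^ σ₁ * u₀ x) (shell N (Iio R)) volume)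
    (hϱ : -1 < ϱ) (hw : Integrable w volume) :
    IsTestPair σ₁ σ₂ ϱ p w u₀ u ψ' Λ' := by
  have : Nonempty (Fin N) := ⟨⟨0, by omega⟩⟩
  set K : Set (ℝ × Space N) := Ioo 0 T ×ˢ shell N (Iio R) with hK
  have hSm : MeasurableSet (shell N (Iio R)) := measurableSet_shell measurableSet_Iio
  have hKm : MeasurableSet K := measurableSet_Ioo.prod hSm
  have hout : ∀ z : ℝ × Space N, 0 < z.1 → z ∉ K → (T ≤ z.1 ∨ R ≤ ‖z.2‖) := by
    intro z hz hzK
    by_contra! hcon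
    exact hzK ⟨⟨hz, hcon.1⟩, hcon.2⟩
  have hae := ae_pos_and_ne_zero hN
  have hae0 : ∀ᵐ x ∂(volume : Measure (Space N)), x ≠ 0 := by
    rw [ae_iff]; simp
  have hw4 : IntegrableOn (fun z : ℝ × Space N => z.1 ^ ϱ * w z.2) K volume := by
    rw [IntegrableOn, hK, Measure.volume_eq_prod, ← Measure.prod_restrict]
    refine Integrable.mul_prod (f := fun t : ℝ => t ^ ϱ) ?_ hw.restrict
    rcases le_or_gt T 0 with hT | hT
    · simp [hT]
    · exact (intervalIntegral.integrableOn_Ioo_rpow_iff hT).2 hϱ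
  obtain ⟨i1, l1⟩ := integrable_and_tendsto_of_dominated (f := fun z => Λ' z * u z)
    (bound := K.indicator fun z => M * (|u z| + |‖z.2‖ ^ σ₁ * u z|))
    (fun n => (h n).integrable_adjoint)
    (IntegrableOn.integrable_indicator (s := K) ((hu1.abs.add hu2.abs).const_mul M) hKm).integrableOn
    (fun n => by
      filter_upwards [hae] with z hz
      by_cases hzK : z ∈ K
      · rw [indicator_of_mem hzK, abs_mul, abs_mul,
          abs_of_nonneg (Real.rpow_nonneg (norm_nonneg z.2) σ₁)]
        calc _ ≤ M * (1 + ‖z.2‖ ^ σ₁) * |u z| :=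
              mul_le_mul_of_nonneg_right (hΛM n z.1 z.2 hz.1 hz.2) (abs_nonneg _)
          _ = _ := by ring
      · rw [indicator_of_notMem hzK, hΛ0 n z.1 z.2 (hout z hz.1 hzK)]
        simp)
    (by
      filter_upwards [hae] with z hz
      exact (hΛ z.1 z.2 hz.1 hz.2).mul_const _)
  obtain ⟨i2, l2⟩ := integrable_and_tendsto_of_dominated
    (f := fun x => ‖x‖ ^ σ₁ * u₀ x * ψ' (0, x))
    (bound := (shell N (Iio R)).indicator fun x => |‖x‖ ^ σ₁ * u₀ x| * M)
    (fun n => (h n).integrable_initial) 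
    (IntegrableOn.integrable_indicator (s := shell N (Iio R)) (hu4.abs.mul_const M) hSm)
    (fun n => Eventually.of_forall fun x => by
      by_cases hx : x ∈ shell N (Iio R)
      · rw [indicator_of_mem hx, abs_mul]
        exact mul_le_mul_of_nonneg_left (hψM n 0 x le_rfl) (abs_nonneg _)
      · rw [indicator_of_notMem hx, hψ0 n 0 x (Or.inr (not_lt.1 hx))]
        simp)
    (by
      filter_upwards [hae0] with x hx
      exact (hψ 0 x le_rfl hx).const_mul _)
  obtain ⟨i3, l3⟩ := integrable_and_tendsto_of_dominated
    (f := fun z => ‖z.2‖ ^ σ₂ * |u z| ^ p * ψ' z)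
    (bound := K.indicator fun z => |‖z.2‖ ^ σ₂ * |u z| ^ p| * M)
    (fun n => (h n).integrable_nonlinearity)
    (IntegrableOn.integrable_indicator (s := K) (hu3.abs.mul_const M) hKm).integrableOn
    (fun n => by
      filter_upwards [hae] with z hz
      by_cases hzK : z ∈ K
      · rw [indicator_of_mem hzK, abs_mul]
        exact mul_le_mul_of_nonneg_left (hψM n z.1 z.2 hz.1.le) (abs_nonneg _)
      · rw [indicator_of_notMem hzK, hψ0 n z.1 z.2 (hout z hz.1 hzK)]
        simp)
    (by
      filter_upwards [hae] with z hz
      exact (hψ z.1 z.2 hz.1.le hz.2).const_mul _)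
  obtain ⟨i4, l4⟩ := integrable_and_tendsto_of_dominated
    (f := fun z => z.1 ^ ϱ * w z.2 * ψ' z)
    (bound := K.indicator fun z => |z.1 ^ ϱ * w z.2| * M)
    (fun n => (h n).integrable_source)
    (IntegrableOn.integrable_indicator (s := K) (hw4.abs.mul_const M) hKm).integrableOn
    (fun n => by
      filter_upwards [hae] with z hz
      by_cases hzK : z ∈ K
      · rw [indicator_of_mem hzK, abs_mul]
        exact mul_le_mul_of_nonneg_left (hψM n z.1 z.2 hz.1.le) (abs_nonneg _)
      · rw [indicator_of_notMem hzK, hψ0 n z.1 z.2 (hout z hz.1 hzK)]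
        simp)
    (by
      filter_upwards [hae] with z hz
      exact (hψ z.1 z.2 hz.1.le hz.2).const_mul _)
  refine ⟨i1, i2, i3, i4, tendsto_nhds_unique l1 ?_⟩
  refine ((l2.add l3).add l4).congr fun n => ?_
  exact ((h n).identity).symm


/-- The Laplacian of `ξ (|x|^2) (|x|^2 + δ)^a` in terms of `q = |x|^2`. -/
def cutoffPowLaplacian (N : ℕ) (ξ : ℝ → ℝ) (a δ q : ℝ) : ℝ :=
  4 * q * ((deriv (deriv ξ) q * (q + δ) ^ a + deriv ξ q * (a * (q + δ) ^ (a - 1)))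
    + (deriv ξ q * (a * (q + δ) ^ (a - 1)) + ξ q * (a * ((a - 1) * (q + δ) ^ (a - 1 - 1)))))
    + 2 * N * (deriv ξ q * (q + δ) ^ a + ξ q * (a * (q + δ) ^ (a - 1)))

/-- Separates ξ Δ|x|^(2a), which will telescope, from the terms with derivatives of ξ, which are
supported away from the origin for the cutoffs used later. -/
theorem cutoffPowLaplacian_zero_right {N : ℕ} {ξ : ℝ → ℝ} {a q : ℝ} (hq : 0 < q) :
    cutoffPowLaplacian N ξ a 0 q = 2 * a * (2 * a + N - 2) * q ^ (a - 1) * ξ q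
      + (4 * q * q ^ a * deriv (deriv ξ) q + (8 * a + 2 * N) * q ^ a * deriv ξ q) := by
  have h1 : q ^ a = q ^ (a - 1) * q := by rw [Real.rpow_sub hq, Real.rpow_one]; field_simp
  have h2 : q ^ (a - 1) = q ^ (a - 1 - 1) * q := by
    rw [Real.rpow_sub hq (a - 1), Real.rpow_one]; field_simp
  rw [cutoffPowLaplacian, add_zero, h1, h2]
  ring

theorem IsCutoff.hasDerivAt_mul_rpow {p : ℝ} {ξ : ℝ → ℝ} (hξ : IsCutoff p ξ) (a : ℝ) {δ q : ℝ}
    (hq : 0 < q + δ) :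
    HasDerivAt (fun q => ξ q * (q + δ) ^ a)
      (deriv ξ q * (q + δ) ^ a + ξ q * (a * (q + δ) ^ (a - 1))) q ∧
    HasDerivAt (fun q => deriv ξ q * (q + δ) ^ a + ξ q * (a * (q + δ) ^ (a - 1)))
      ((deriv (deriv ξ) q * (q + δ) ^ a + deriv ξ q * (a * (q + δ) ^ (a - 1)))
        + (deriv ξ q * (a * (q + δ) ^ (a - 1))
          + ξ q * (a * ((a - 1) * (q + δ) ^ (a - 1 - 1))))) q := by
  have hpow : ∀ c : ℝ, HasDerivAt (fun q => (q + δ) ^ c) (c * (q + δ) ^ (c - 1)) q := fun c => by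
    have := ((hasDerivAt_id q).add_const δ).rpow_const (p := c) (Or.inl hq.ne')
    simpa using this
  exact ⟨(hξ.hasDerivAt q).mul (hpow a), ((hξ.hasDerivAt_deriv q).mul (hpow a)).add
    ((hξ.hasDerivAt q).mul ((hpow (a - 1)).const_mul a))⟩

theorem IsCutoff.laplacian_mul_rpow {N : ℕ} {p : ℝ} {ξ : ℝ → ℝ} (hξ : IsCutoff p ξ) (a : ℝ) {δ : ℝ}
    (hδ : 0 < δ) (x : Space N) :
    Laplacian.laplacian (fun y : Space N => ξ (‖y‖ ^ 2) * (‖y‖ ^ 2 + δ) ^ a) x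
      = cutoffPowLaplacian N ξ a δ (‖x‖ ^ 2) := by
  have hx : 0 < ‖x‖ ^ 2 + δ := by positivity
  refine laplacian_comp_norm_sq (f := fun q => ξ q * (q + δ) ^ a)
    (f₁ := fun q => deriv ξ q * (q + δ) ^ a + ξ q * (a * (q + δ) ^ (a - 1))) ?_
    (hξ.hasDerivAt_mul_rpow a hx).2
  filter_upwards [lt_mem_nhds (show -δ < ‖x‖ ^ 2 by linarith)] with q hq
  exact (hξ.hasDerivAt_mul_rpow a (by linarith)).1

theorem IsCutoff.exists_abs_deriv_le {p : ℝ} (hp : 1 < p) {ξ : ℝ → ℝ} (hξ : IsCutoff p ξ) :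
    ∃ C, 0 ≤ C ∧ ∀ q, |deriv ξ q| ≤ C ∧ |deriv (deriv ξ) q| ≤ C := by
  obtain ⟨C, hC, hb⟩ := hξ.exists_bound
  have hp0 : 0 ≤ 1 / p := by positivity
  have h1 : ∀ q, C * ξ q ^ (1 / p) ≤ C := fun q =>
    mul_le_of_le_one_right hC (Real.rpow_le_one (hξ.nonneg q) (hξ.le_one q) hp0)
  exact ⟨C, hC, fun q => ⟨(hb q).1.trans (h1 q), (hb q).2.trans (h1 q)⟩⟩

/-- A bound uniform in δ. For a ≥ 1 the power stays bounded; for 0 < a < 1 it is largest at δ = 0,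
where it is r^(2a-2) ≤ 1 + r^σ. -/
theorem mul_add_rpow_sub_one_le {σ a δ r : ℝ} (ha : 0 ≤ a) (haσ : a = 0 ∨ σ ≤ 2 * a - 2)
    (hδ : 0 < δ) (hδ1 : δ ≤ 1) (hr : 0 < r) (hr2 : r ^ 2 ≤ 2) :
    a * (r ^ 2 + δ) ^ (a - 1) ≤ a * 3 ^ a * (1 + r ^ σ) := by
  rcases haσ with rfl | haσ
  · simp
  have hP : 0 < r ^ 2 + δ := by positivity
  have hrσ : 0 ≤ r ^ σ := by positivity
  have h3 : (1 : ℝ) ≤ 3 ^ a := Real.one_le_rpow (by norm_num) ha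
  suffices (r ^ 2 + δ) ^ (a - 1) ≤ 3 ^ a * (1 + r ^ σ) by
    rw [mul_assoc]; gcongr
  rcases le_total 1 a with h1 | h1
  · calc (r ^ 2 + δ) ^ (a - 1) ≤ 3 ^ (a - 1) :=
          Real.rpow_le_rpow hP.le (by linarith) (by linarith)
      _ ≤ 3 ^ a := Real.rpow_le_rpow_of_exponent_le (by norm_num) (by linarith)
      _ ≤ 3 ^ a * (1 + r ^ σ) := le_mul_of_one_le_right (by positivity) (by linarith)
  · have e1 : (r ^ 2 + δ) ^ (a - 1) ≤ r ^ (2 * a - 2) := by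
      calc (r ^ 2 + δ) ^ (a - 1) ≤ (r ^ 2) ^ (a - 1) :=
            Real.rpow_le_rpow_of_nonpos (by positivity) (by linarith) (by linarith)
        _ = r ^ (2 * a - 2) := by
          rw [← Real.rpow_natCast, ← Real.rpow_mul hr.le]
          congr 1; push_cast; ring
    have e2 : r ^ (2 * a - 2) ≤ 1 + r ^ σ := by
      rcases le_total r 1 with hr1 | hr1
      · have := Real.rpow_le_rpow_of_exponent_ge hr hr1 haσ
        linarith
      · have := Real.rpow_le_one_of_one_le_of_nonpos hr1 (by linarith : 2 * a - 2 ≤ 0)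
        linarith
    calc _ ≤ 1 + r ^ σ := e1.trans e2
      _ ≤ _ := le_mul_of_one_le_left (by positivity) h3

theorem IsCutoff.exists_cutoffPowLaplacian_le {N : ℕ} {p : ℝ} (hp : 1 < p) {ξ : ℝ → ℝ}
    (hξ : IsCutoff p ξ) (h0 : ∀ q, 2 ≤ q → ξ q = 0) {σ a : ℝ} (ha : 0 ≤ a)
    (haσ : a = 0 ∨ σ ≤ 2 * a - 2) :
    ∃ M, 0 ≤ M ∧ ∀ δ, 0 < δ → δ ≤ 1 → ∀ r, 0 < r →
      |cutoffPowLaplacian N ξ a δ (r ^ 2)| ≤ M * (1 + r ^ σ) := by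
  obtain ⟨C, hC, hb⟩ := hξ.exists_abs_deriv_le hp
  refine ⟨8 * C * 3 ^ a + 8 * C * a * 3 ^ a + 2 * N * C * 3 ^ a
    + (4 * |a - 1| + 2 * N) * (a * 3 ^ a), by positivity, fun δ hδ hδ1 r hr => ?_⟩
  have hrσ : 0 ≤ r ^ σ := by positivity
  rcases lt_or_ge (r ^ 2) 2 with hr2 | hr2
  · have hbnd := mul_add_rpow_sub_one_le ha haσ hδ hδ1 hr hr2.le
    set q := r ^ 2 with hq
    have hq0 : 0 < q := by positivity
    have hP : 0 < q + δ := by positivity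
    obtain ⟨b1, b2⟩ := hb q
    have b0 : |ξ q| ≤ 1 := by rw [abs_of_nonneg (hξ.nonneg q)]; exact hξ.le_one q
    have hPa : (q + δ) ^ a ≤ 3 ^ a := Real.rpow_le_rpow hP.le (by linarith) ha
    have e1 : (q + δ) ^ a = (q + δ) ^ (a - 1) * (q + δ) := by
      rw [Real.rpow_sub hP, Real.rpow_one]; field_simp
    have e2 : (q + δ) ^ (a - 1) = (q + δ) ^ (a - 1 - 1) * (q + δ) := by
      rw [Real.rpow_sub hP (a - 1), Real.rpow_one]; field_simp
    have hX : 0 ≤ (q + δ) ^ (a - 1) := by positivity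
    have hZ : 0 ≤ (q + δ) ^ (a - 1 - 1) := by positivity
    have hqX : q * (q + δ) ^ (a - 1) ≤ 3 ^ a := by nlinarith
    have hqZ : q * (q + δ) ^ (a - 1 - 1) ≤ (q + δ) ^ (a - 1) := by nlinarith
    set W := (q + δ) ^ a
    set X := (q + δ) ^ (a - 1)
    set Z := (q + δ) ^ (a - 1 - 1)
    have hW : 0 ≤ W := by positivity
    have t1 : |4 * q * (deriv (deriv ξ) q * W)| ≤ 8 * C * 3 ^ a := by
      rw [abs_mul, abs_mul (deriv (deriv ξ) q), abs_of_pos (by positivity : 0 < 4 * q),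
        abs_of_nonneg hW]
      calc _ ≤ 4 * 2 * (C * 3 ^ a) := by gcongr
        _ = _ := by ring
    have t2 : |8 * (deriv ξ q * (a * (q * X)))| ≤ 8 * C * a * 3 ^ a := by
      rw [abs_mul, abs_mul (deriv ξ q), abs_of_nonneg (by positivity : 0 ≤ a * (q * X)),
        abs_of_nonneg (by norm_num : (0 : ℝ) ≤ 8)]
      calc _ ≤ 8 * (C * (a * 3 ^ a)) := by gcongr
        _ = _ := by ring
    have t3 : |4 * (ξ q * ((a - 1) * (a * (q * Z))))| ≤ 4 * |a - 1| * (a * 3 ^ a * (1 + r ^ σ)) := by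
      rw [abs_mul, abs_mul (ξ q), abs_mul (a - 1), abs_of_nonneg (by positivity : 0 ≤ a * (q * Z)),
        abs_of_nonneg (by norm_num : (0 : ℝ) ≤ 4)]
      calc _ ≤ 4 * (1 * (|a - 1| * (a * X))) := by gcongr
        _ ≤ 4 * (1 * (|a - 1| * (a * 3 ^ a * (1 + r ^ σ)))) := by gcongr
        _ = _ := by ring
    have t4 : |2 * N * (deriv ξ q * W)| ≤ 2 * N * C * 3 ^ a := by
      rw [abs_mul, abs_mul (deriv ξ q), abs_of_nonneg (by positivity : 0 ≤ 2 * (N : ℝ)),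
        abs_of_nonneg hW]
      calc _ ≤ 2 * N * (C * 3 ^ a) := by gcongr
        _ = _ := by ring
    have t5 : |2 * N * (ξ q * (a * X))| ≤ 2 * N * (a * 3 ^ a * (1 + r ^ σ)) := by
      rw [abs_mul, abs_mul (ξ q), abs_of_nonneg (by positivity : 0 ≤ 2 * (N : ℝ)),
        abs_of_nonneg (by positivity : 0 ≤ a * X)]
      calc _ ≤ 2 * N * (1 * (a * X)) := by gcongr
        _ = 2 * N * (a * X) := by ring
        _ ≤ _ := by gcongr
    have heq : cutoffPowLaplacian N ξ a δ q = 4 * q * (deriv (deriv ξ) q * W)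
        + 8 * (deriv ξ q * (a * (q * X))) + 4 * (ξ q * ((a - 1) * (a * (q * Z))))
        + 2 * N * (deriv ξ q * W) + 2 * N * (ξ q * (a * X)) := by
      simp only [cutoffPowLaplacian]; ring
    rw [heq]
    have hc : 0 ≤ (8 * C * 3 ^ a + 8 * C * a * 3 ^ a + 2 * N * C * 3 ^ a) * r ^ σ := by positivity
    have := abs_add_le (4 * q * (deriv (deriv ξ) q * W)
        + 8 * (deriv ξ q * (a * (q * X))) + 4 * (ξ q * ((a - 1) * (a * (q * Z))))
        + 2 * N * (deriv ξ q * W)) (2 * N * (ξ q * (a * X)))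
    have := abs_add_le (4 * q * (deriv (deriv ξ) q * W)
        + 8 * (deriv ξ q * (a * (q * X))) + 4 * (ξ q * ((a - 1) * (a * (q * Z)))))
        (2 * N * (deriv ξ q * W))
    have := abs_add_le (4 * q * (deriv (deriv ξ) q * W)
        + 8 * (deriv ξ q * (a * (q * X)))) (4 * (ξ q * ((a - 1) * (a * (q * Z)))))
    have := abs_add_le (4 * q * (deriv (deriv ξ) q * W)) (8 * (deriv ξ q * (a * (q * X))))
    linarith
  · obtain ⟨d1, d2⟩ := hξ.deriv_eq_zero_of_eq_zero hp (h0 _ hr2)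
    rw [cutoffPowLaplacian, d1, d2, h0 _ hr2]
    simp only [zero_mul, add_zero, mul_zero, abs_zero]
    positivity

theorem deriv_eq_zero_of_forall_ge {η : ℝ → ℝ} {T t : ℝ} (hT : ∀ t, T ≤ t → η t = 0) (ht : T < t) :
    deriv η t = 0 := by
  have : η =ᶠ[𝓝 t] fun _ => 0 := by
    filter_upwards [lt_mem_nhds ht] with s hs using hT s hs.le
  rw [this.deriv_eq]; simp

theorem exists_abs_le_of_continuous_of_vanish {η : ℝ → ℝ} (hη : Continuous η) {T : ℝ}
    (hT : ∀ t, T ≤ t → η t = 0) : ∃ M, 0 ≤ M ∧ ∀ t, 0 ≤ t → |η t| ≤ M := by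
  obtain ⟨M, hM⟩ := (isCompact_Icc (a := (0 : ℝ)) (b := T)).exists_bound_of_continuousOn
    hη.continuousOn
  refine ⟨max M 0, le_max_right _ _, fun t ht => ?_⟩
  rcases le_total T t with h | h
  · rw [hT t h, abs_zero]; exact le_max_right _ _
  · exact (hM t ⟨ht, h⟩).trans (le_max_left _ _)

/-- The weak formulation extends to the test functions `η(t) ξ(|x|^2) |x|^(2a)`, which need not be
smooth at the origin. -/
theorem IsGlobalWeakSolution.isTestPair_rpow {N : ℕ} (hN : 2 ≤ N) {σ₁ σ₂ ϱ p T : ℝ} (hp : 1 < p)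
    (hϱ : -1 < ϱ) {w u₀ : Space N → ℝ} {u : ℝ × Space N → ℝ}
    (hu : IsGlobalWeakSolution σ₁ σ₂ ϱ p w u₀ u) (hw : Integrable w volume)
    {η : ℝ → ℝ} (hη : ContDiff ℝ ∞ η) (hT : ∀ t, T ≤ t → η t = 0)
    {ξ : ℝ → ℝ} (hξ : IsCutoff p ξ) (h0 : ∀ q, 2 ≤ q → ξ q = 0) {a : ℝ} (ha : 0 ≤ a)
    (haσ : a = 0 ∨ σ₁ ≤ 2 * a - 2) :
    IsTestPair σ₁ σ₂ ϱ p w u₀ u (fun z => η z.1 * (ξ (‖z.2‖ ^ 2) * (‖z.2‖ ^ 2) ^ a))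
      (fun z => -(‖z.2‖ ^ σ₁ * (deriv η z.1 * (ξ (‖z.2‖ ^ 2) * (‖z.2‖ ^ 2) ^ a)))
        - η z.1 * cutoffPowLaplacian N ξ a 0 (‖z.2‖ ^ 2)) := by
  -- (|x|² + δ)^a is smooth for δ > 0. As δ → 0 the adjoints stay below a multiple of 1 + |x|^σ₁,
  -- which is integrable against u on the cylinder up to t = 0.
  set δ : ℕ → ℝ := fun n => 1 / ((n : ℝ) + 1) with hδ
  have hδ0 : ∀ n, 0 < δ n := fun n => by positivity
  have hδ1 : ∀ n, δ n ≤ 1 := fun n => by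
    rw [hδ]
    exact div_le_one_of_le₀ (by linarith [(Nat.cast_nonneg n : (0 : ℝ) ≤ n)]) (by positivity)
  have hδlim : Tendsto δ atTop (𝓝 0) := tendsto_one_div_add_atTop_nhds_zero_nat
  have hζsmooth : ∀ n, ContDiff ℝ ∞ fun x : Space N => ξ (‖x‖ ^ 2) * (‖x‖ ^ 2 + δ n) ^ a := by
    intro n
    refine (contDiff_comp_norm_sq hξ.contDiff).mul ?_
    rw [contDiff_iff_contDiffAt]
    intro x
    have := hδ0 n
    exact ((contDiff_norm_sq ℝ).add contDiff_const).contDiffAt.rpow_const_of_ne (by positivity)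
  have hζsupp : ∀ n, HasCompactSupport fun x : Space N => ξ (‖x‖ ^ 2) * (‖x‖ ^ 2 + δ n) ^ a :=
    fun n => HasCompactSupport.mul_right (hasCompactSupport_comp_norm_sq h0)
  obtain ⟨M₀, hM₀, hη0⟩ := exists_abs_le_of_continuous_of_vanish hη.continuous hT
  obtain ⟨M₁, hM₁, hη1⟩ := exists_abs_le_of_continuous_of_vanish (T := T + 1)
    ((contDiff_infty_iff_deriv.1 hη).2).continuous
    (fun t ht => deriv_eq_zero_of_forall_ge hT (by linarith))
  obtain ⟨M₂, hM₂, hlapM⟩ := hξ.exists_cutoffPowLaplacian_le (N := N) hp h0 ha haσ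
  have h3 : (0 : ℝ) ≤ 3 ^ a := by positivity
  have hζM : ∀ n (x : Space N), |ξ (‖x‖ ^ 2) * (‖x‖ ^ 2 + δ n) ^ a| ≤ 3 ^ a := by
    intro n x
    have h2 : 0 ≤ (‖x‖ ^ 2 + δ n) ^ a := by have := hδ0 n; positivity
    rcases le_or_gt 2 (‖x‖ ^ 2) with h | h
    · rw [h0 _ h, zero_mul, abs_zero]; exact h3
    · rw [abs_mul, abs_of_nonneg h2, abs_of_nonneg (hξ.nonneg _)]
      calc _ ≤ (1 : ℝ) * (3 : ℝ) ^ a := by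
            gcongr
            · exact hξ.le_one _
            · linarith [hδ1 n]
        _ = _ := one_mul _
  have hfar : ∀ x : Space N, 2 ≤ ‖x‖ → 2 ≤ ‖x‖ ^ 2 := fun x hx => by nlinarith
  -- A positive time strictly beyond T, so that the derivative of η vanishes from there on too.
  have hT0 : 0 < |T| + 1 := by positivity
  have hTle : T < |T| + 1 := by linarith [le_abs_self T]
  obtain ⟨c1, c2, c3, c4⟩ := hu.integrableOn_cylinder hN hp hϱ hw hT0 (two_pos : (0 : ℝ) < 2)
  have hpow : ∀ (x : Space N), x ≠ 0 → ∀ c : ℝ,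
      Tendsto (fun n => (‖x‖ ^ 2 + δ n) ^ c) atTop (𝓝 ((‖x‖ ^ 2 + 0) ^ c)) := by
    intro x hx c
    have hx0 : 0 < ‖x‖ := norm_pos_iff.2 hx
    exact (tendsto_const_nhds.add hδlim).rpow_const (Or.inl (by positivity))
  have hpow' : ∀ (x : Space N), x ≠ 0 →
      Tendsto (fun n => (‖x‖ ^ 2 + δ n) ^ a) atTop (𝓝 ((‖x‖ ^ 2) ^ a)) := fun x hx => by
    simpa using hpow x hx a
  refine IsTestPair.of_tendsto hN
    (ψ := fun n z => η z.1 * (ξ (‖z.2‖ ^ 2) * (‖z.2‖ ^ 2 + δ n) ^ a))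
    (Λ := fun n z => -(‖z.2‖ ^ σ₁ * (deriv η z.1 * (ξ (‖z.2‖ ^ 2) * (‖z.2‖ ^ 2 + δ n) ^ a)))
        - η z.1 * cutoffPowLaplacian N ξ a (δ n) (‖z.2‖ ^ 2))
    (M := M₀ * 3 ^ a + (M₁ * 3 ^ a + M₀ * M₂)) (T := |T| + 1) (R := 2)
    (fun n => ?_) (fun n t x h => ?_) (fun n t x h => ?_) (fun n t x ht => ?_)
    (fun n t x ht hx => ?_) (fun t x ht hx => ?_) (fun t x ht hx => ?_) c1 c2 c3 c4 hϱ hw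
  · have := hu.isTestPair hϱ hw hη hT (hζsmooth n) (hζsupp n)
    simpa only [hξ.laplacian_mul_rpow a (hδ0 n)] using this
  · rcases h with h | h
    · simp [hT t (hTle.le.trans h)]
    · simp [h0 _ (hfar x h)]
  · rcases h with h | h
    · simp [hT t (hTle.le.trans h), deriv_eq_zero_of_forall_ge hT (hTle.trans_le h)]
    · obtain ⟨d1, d2⟩ := hξ.deriv_eq_zero_of_eq_zero hp (h0 _ (hfar x h))
      simp [cutoffPowLaplacian, h0 _ (hfar x h), d1, d2]
  · simp only
    rw [abs_mul]
    have h5 := mul_le_mul (hη0 t ht) (hζM n x) (abs_nonneg _) hM₀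
    have : 0 ≤ M₁ * 3 ^ a + M₀ * M₂ := by positivity
    linarith
  · simp only
    have hrσ : 0 ≤ ‖x‖ ^ σ₁ := Real.rpow_nonneg (norm_nonneg _) _
    have e1 : |‖x‖ ^ σ₁ * (deriv η t * (ξ (‖x‖ ^ 2) * (‖x‖ ^ 2 + δ n) ^ a))|
        ≤ M₁ * 3 ^ a * ‖x‖ ^ σ₁ := by
      rw [abs_mul, abs_mul, abs_of_nonneg hrσ]
      have h5 := mul_le_mul (hη1 t ht.le) (hζM n x) (abs_nonneg _) hM₁
      nlinarith
    have e2 : |η t * cutoffPowLaplacian N ξ a (δ n) (‖x‖ ^ 2)| ≤ M₀ * (M₂ * (1 + ‖x‖ ^ σ₁)) := by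
      rw [abs_mul]
      exact mul_le_mul (hη0 t ht.le) (hlapM (δ n) (hδ0 n) (hδ1 n) ‖x‖ (norm_pos_iff.2 hx))
        (abs_nonneg _) hM₀
    refine (abs_sub _ _).trans ?_
    rw [abs_neg]
    have e3 : 0 ≤ M₀ * 3 ^ a * (1 + ‖x‖ ^ σ₁) := by positivity
    have e4 : 0 ≤ M₁ * 3 ^ a := by positivity
    nlinarith
  · exact ((hpow' x hx).const_mul _).const_mul _
  · refine Tendsto.sub ((((hpow' x hx).const_mul _).const_mul _).const_mul _).neg
      (Tendsto.const_mul _ ?_)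
    have k1 := (hpow x hx a)
    have k2 := (hpow x hx (a - 1)).const_mul a
    have k3 := ((hpow x hx (a - 1 - 1)).const_mul (a - 1)).const_mul a
    exact ((((k1.const_mul _).add (k2.const_mul _)).add ((k2.const_mul _).add
      (k3.const_mul _))).const_mul _).add (((k1.const_mul _).add (k2.const_mul _)).const_mul _)


/-! ### Time profiles and coefficients of the adjoint series. -/

open Polynomial in
/-- The polynomials `P k` for which `P k (1/s) exp (-1/s)` is the `k`-th derivative of
`exp (-1/s)`. -/
def gluePoly : ℕ → ℝ[X]
  | 0 => 1
  | k + 1 => X ^ 2 * (gluePoly k - derivative (R := ℝ) (gluePoly k))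

/-- The `k`-th derivative of `expNegInvGlue`. -/
def glueDeriv (k : ℕ) (s : ℝ) : ℝ := (gluePoly k).eval s⁻¹ * expNegInvGlue s

theorem glueDeriv_zero (s : ℝ) : glueDeriv 0 s = expNegInvGlue s := by
  simp [glueDeriv, gluePoly]

theorem hasDerivAt_glueDeriv (k : ℕ) (s : ℝ) :
    HasDerivAt (glueDeriv k) (glueDeriv (k + 1) s) s :=
  expNegInvGlue.hasDerivAt_polynomial_eval_inv_mul (gluePoly k) s

theorem contDiff_glueDeriv (k : ℕ) : ContDiff ℝ ∞ (glueDeriv k) :=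
  expNegInvGlue.contDiff_polynomial_eval_inv_mul (gluePoly k)

theorem glueDeriv_of_nonpos (k : ℕ) {s : ℝ} (hs : s ≤ 0) : glueDeriv k s = 0 := by
  simp [glueDeriv, expNegInvGlue.zero_of_nonpos hs]

/-- Differentiation lowers the degree, so the recursion keeps the leading coefficient 1. Each
polynomial is then positive at large 1/s, which makes the derivatives of exp(-1/s) nonnegative for
small s. -/
theorem monic_gluePoly (k : ℕ) : (gluePoly k).Monic := by
  induction k with
  | zero => exact Polynomial.monic_one
  | succ k ih =>
    refine (Polynomial.monic_X_pow 2).mul (ih.sub_of_left ?_)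
    exact Polynomial.degree_derivative_lt ih.ne_zero

theorem Polynomial.Monic.eventually_eval_pos {P : Polynomial ℝ} (hP : P.Monic) :
    ∀ᶠ x in atTop, 0 < P.eval x := by
  rcases eq_or_ne P.natDegree 0 with h | h
  · rw [hP.natDegree_eq_zero.1 h]
    simp
  · refine (P.tendsto_atTop_of_leadingCoeff_nonneg ?_ ?_).eventually_gt_atTop 0
    · exact Polynomial.natDegree_pos_iff_degree_pos.1 (Nat.pos_of_ne_zero h)
    · rw [hP.leadingCoeff]; exact zero_le_one

theorem exists_glueDeriv_nonneg (K : ℕ) :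
    ∃ s₀, 0 < s₀ ∧ s₀ ≤ 1 ∧ ∀ k ≤ K, ∀ s ≤ s₀, 0 ≤ glueDeriv k s := by
  have hev : ∀ᶠ x : ℝ in atTop, ∀ k ∈ Finset.range (K + 1), 0 < (gluePoly k).eval x := by
    rw [Filter.eventually_all_finset]
    exact fun k _ => (monic_gluePoly k).eventually_eval_pos
  obtain ⟨X, hX⟩ := eventually_atTop.1 hev
  have hX0 : 0 < max X 1 := by positivity
  refine ⟨(max X 1)⁻¹, inv_pos.2 hX0, inv_le_one_of_one_le₀ (le_max_right _ _), fun k hk s hs => ?_⟩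
  rcases le_or_gt s 0 with h | h
  · rw [glueDeriv_of_nonpos k h]
  · refine mul_nonneg (hX s⁻¹ ?_ k (by simp; omega)).le (expNegInvGlue.nonneg s)
    exact (le_max_left _ _).trans ((le_inv_comm₀ h hX0).1 hs)

/-- Since 1/p + 1/p' = 1, exp(-1/s) splits as exp(-1/(p's)) exp(-1/(ps)). The first factor absorbs
the polynomial in 1/s, the second is the p-th root. -/
theorem exists_glueDeriv_le {p : ℝ} (hp : 1 < p) (k : ℕ) :
    ∃ C, 0 ≤ C ∧ ∀ s ≤ 1, |glueDeriv k s| ≤ C * expNegInvGlue s ^ (1 / p) := by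
  have hp0 : 0 < p := by linarith
  have hp1 : 0 < p - 1 := by linarith
  set p' := p / (p - 1) with hp'
  have hp'0 : 0 < p' := by positivity
  set P := (gluePoly k).comp (Polynomial.C p' * Polynomial.X) with hP
  obtain ⟨M, hM⟩ := (isCompact_Icc (a := (0 : ℝ)) (b := p')).exists_bound_of_continuousOn
    (expNegInvGlue.continuous_polynomial_eval_inv_mul P).continuousOn
  refine ⟨max M 0, le_max_right _ _, fun s hs => ?_⟩
  rcases le_or_gt s 0 with h | h
  · rw [glueDeriv_of_nonpos k h, abs_zero]
    have := Real.rpow_nonneg (expNegInvGlue.nonneg s) (1 / p)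
    positivity
  · have hval : ∀ y : ℝ, 0 < y → expNegInvGlue y = Real.exp (-y⁻¹) := fun y hy => by
      simp [expNegInvGlue, hy.not_ge]
    have h1 := hM (p' * s) ⟨by positivity, by nlinarith⟩
    rw [hP, Polynomial.eval_comp, Polynomial.eval_mul, Polynomial.eval_C, Polynomial.eval_X,
      show p' * (p' * s)⁻¹ = s⁻¹ by field_simp] at h1
    have hsplit : expNegInvGlue s = expNegInvGlue (p' * s) * expNegInvGlue s ^ (1 / p) := by
      rw [hval s h, hval _ (by positivity), ← Real.exp_mul, ← Real.exp_add]
      congr 1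
      rw [hp']
      field_simp
      ring
    have hY := Real.rpow_nonneg (expNegInvGlue.nonneg s) (1 / p)
    have hk : glueDeriv k s = (gluePoly k).eval s⁻¹ * expNegInvGlue (p' * s)
        * expNegInvGlue s ^ (1 / p) := by rw [glueDeriv, mul_assoc, ← hsplit]
    rw [hk, abs_mul, abs_of_nonneg hY]
    rw [Real.norm_eq_abs] at h1
    exact mul_le_mul_of_nonneg_right (h1.trans (le_max_left _ _)) hY

/-- A family of functions on the half line, each the negative derivative of the previous one, which
are nonnegative, vanish for `t ≥ 1` and are controlled by the `p`-th root of the first one. -/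
structure IsDecayFamily (p : ℝ) (K : ℕ) (h : ℕ → ℝ → ℝ) : Prop where
  contDiff : ∀ k, ContDiff ℝ ∞ (h k)
  hasDerivAt : ∀ k t, HasDerivAt (h k) (-(h (k + 1) t)) t
  eq_zero : ∀ k t, 1 ≤ t → h k t = 0
  nonneg : ∀ k ≤ K, ∀ t, 0 ≤ t → 0 ≤ h k t
  le_one : ∀ t, 0 ≤ t → h 0 t ≤ 1
  pos : ∀ t, t < 1 → 0 < h 0 t
  exists_bound : ∃ C, 0 ≤ C ∧ ∀ k ≤ K + 1, ∀ t, 0 ≤ t → |h k t| ≤ C * h 0 t ^ (1 / p)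

theorem exists_isDecayFamily {p : ℝ} (hp : 1 < p) (K : ℕ) : ∃ h, IsDecayFamily p K h := by
  obtain ⟨s₀, hs₀, hs₁, hnn⟩ := exists_glueDeriv_nonneg K
  choose C hC hb using fun k => exists_glueDeriv_le hp k
  have hs : ∀ t : ℝ, 0 ≤ t → s₀ * (1 - t) ≤ s₀ := fun t ht => by nlinarith
  -- The profile is h₀(t) = exp(-1/(s₀(1-t))) for t < 1. For t ≥ 0 the argument stays below s₀,
  -- where the derivatives are nonnegative; each time derivative brings a factor -s₀.
  refine ⟨fun k t => s₀ ^ k * glueDeriv k (s₀ * (1 - t)), ⟨fun k => ?_, fun k t => ?_,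
    fun k t ht => ?_, fun k hk t ht => ?_, fun t ht => ?_, fun t ht => ?_, ?_⟩⟩
  · exact contDiff_const.mul ((contDiff_glueDeriv k).comp
      (contDiff_const.mul (contDiff_const.sub contDiff_id)))
  · have h1 : HasDerivAt (fun t : ℝ => s₀ * (1 - t)) (-s₀) t := by
      simpa using ((hasDerivAt_id t).const_sub 1).const_mul s₀
    refine (((hasDerivAt_glueDeriv k _).comp t h1).const_mul (s₀ ^ k)).congr_deriv ?_
    ring
  · rw [glueDeriv_of_nonpos k (mul_nonpos_of_nonneg_of_nonpos hs₀.le (by linarith)), mul_zero]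
  · exact mul_nonneg (by positivity) (hnn k hk _ (hs t ht))
  · simp only [pow_zero, one_mul, glueDeriv_zero]
    rcases le_or_gt (s₀ * (1 - t)) 0 with h | h
    · rw [expNegInvGlue.zero_of_nonpos h]; exact zero_le_one
    · simp only [expNegInvGlue, not_le.2 h, if_false]
      exact Real.exp_le_one_iff.2 (neg_nonpos.2 (inv_nonneg.2 h.le))
  · simp only [pow_zero, one_mul, glueDeriv_zero]
    exact expNegInvGlue.pos_of_pos (mul_pos hs₀ (by linarith))
  · refine ⟨∑ k ∈ Finset.range (K + 2), C k, Finset.sum_nonneg fun k _ => hC k,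
      fun k hk t ht => ?_⟩
    simp only [pow_zero, one_mul, glueDeriv_zero]
    have hY := Real.rpow_nonneg (expNegInvGlue.nonneg (s₀ * (1 - t))) (1 / p)
    rw [abs_mul, abs_of_nonneg (by positivity : 0 ≤ s₀ ^ k)]
    calc s₀ ^ k * |glueDeriv k (s₀ * (1 - t))| ≤ 1 * |glueDeriv k (s₀ * (1 - t))| := by
          gcongr
          exact pow_le_one₀ hs₀.le hs₁
      _ ≤ C k * expNegInvGlue (s₀ * (1 - t)) ^ (1 / p) := by
          rw [one_mul]
          exact hb k _ ((hs t ht).trans hs₁)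
      _ ≤ _ := by
          gcongr
          exact Finset.single_le_sum (f := C) (fun k _ => hC k) (by simp; omega)

/-- The coefficients `c k` for which `Δ (c (k+1) |x|^((k+1)s)) = |x|^(s-2) c k |x|^(ks)`. -/
def caloricCoeff (N : ℕ) (s : ℝ) : ℕ → ℝ
  | 0 => 1
  | k + 1 => caloricCoeff N s k / ((k + 1) * s * ((k + 1) * s + N - 2))

theorem caloricCoeff_pos {N : ℕ} (hN : 2 ≤ N) {s : ℝ} (hs : 0 < s) (k : ℕ) :
    0 < caloricCoeff N s k := by
  have hN' : (2 : ℝ) ≤ N := by exact_mod_cast hN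
  induction k with
  | zero => exact one_pos
  | succ k ih =>
    have h1 : 0 < ((k : ℝ) + 1) * s := by positivity
    exact div_pos ih (mul_pos h1 (by linarith))

/-- With s = 2 + σ₁, Δ|x|^(ks) = ks(ks+N-2)|x|^(ks-2) and ks - 2 = σ₁ + (k-1)s. So the Laplacian of
term k cancels the time derivative of term k - 1, the term k = 0 has no Laplacian, and the time
derivative of term K survives. -/
theorem sum_caloric_telescope {N : ℕ} (hN : 2 ≤ N) {σ₁ r : ℝ} (hσ₁ : -2 < σ₁) (hr : 0 < r)
    (η : ℕ → ℝ) (y : ℝ) (K : ℕ) :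
    ∑ k ∈ Finset.range (K + 1), caloricCoeff N (2 + σ₁) k *
      (r ^ σ₁ * (η (k + 1) * (y * (r ^ 2) ^ (k * (2 + σ₁) / 2)))
        - η k * (2 * (k * (2 + σ₁) / 2) * (2 * (k * (2 + σ₁) / 2) + N - 2)
          * (r ^ 2) ^ (k * (2 + σ₁) / 2 - 1) * y))
      = caloricCoeff N (2 + σ₁) K * (r ^ σ₁ * (η (K + 1) * (y * (r ^ 2) ^ (K * (2 + σ₁) / 2)))) := by
  have hN' : (2 : ℝ) ≤ N := by exact_mod_cast hN
  have hs : 0 < 2 + σ₁ := by linarith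
  induction K with
  | zero => simp
  | succ K ih =>
    rw [Finset.sum_range_succ, ih]
    have h1 : 0 < ((K : ℝ) + 1) * (2 + σ₁) := by positivity
    have h2 : 0 < ((K : ℝ) + 1) * (2 + σ₁) + N - 2 := by linarith
    have hc : caloricCoeff N (2 + σ₁) (K + 1) * (((K : ℝ) + 1) * (2 + σ₁)
        * (((K : ℝ) + 1) * (2 + σ₁) + N - 2)) = caloricCoeff N (2 + σ₁) K := by
      rw [caloricCoeff, div_mul_cancel₀ _ (by positivity)]
    have hpow : (r ^ 2) ^ (((K : ℝ) + 1) * (2 + σ₁) / 2 - 1)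
        = r ^ σ₁ * (r ^ 2) ^ ((K : ℝ) * (2 + σ₁) / 2) := by
      have : ∀ c : ℝ, (r ^ 2) ^ c = r ^ (2 * c) := fun c => by
        rw [← Real.rpow_natCast, ← Real.rpow_mul hr.le]; norm_num
      rw [this, this, ← Real.rpow_add hr]
      congr 1; ring
    push_cast
    rw [hpow, ← hc]
    ring


/-! ### The caloric test function. -/

theorem IsTestPair.congr_of_ne_zero {N : ℕ} (hN : 2 ≤ N) {σ₁ σ₂ ϱ p : ℝ} {w u₀ : Space N → ℝ}
    {u : ℝ × Space N → ℝ} {ψ Λ ψ' Λ' : ℝ × Space N → ℝ} (h : IsTestPair σ₁ σ₂ ϱ p w u₀ u ψ Λ)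
    (hψ : ∀ t x, 0 ≤ t → ψ (t, x) = ψ' (t, x))
    (hΛ : ∀ t x, 0 < t → x ≠ 0 → Λ (t, x) = Λ' (t, x)) :
    IsTestPair σ₁ σ₂ ϱ p w u₀ u ψ' Λ' := by
  replace h := h.congr (Λ' := Λ) hψ fun _ _ _ => rfl
  have hae : ∀ᵐ z ∂(volume : Measure (ℝ × Space N)).restrict (Ioi 0 ×ˢ univ),
      Λ z * u z = Λ' z * u z := by
    filter_upwards [ae_pos_and_ne_zero hN] with z hz
    rw [hΛ z.1 z.2 hz.1 hz.2]
  refine ⟨h.integrable_adjoint.congr hae, h.integrable_initial, h.integrable_nonlinearity,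
    h.integrable_source, ?_⟩
  rw [← integral_congr_ae hae, h.identity]

/-- The terms of the Laplacian of `ξ(|x|^2) |x|^(2a)` which contain derivatives of `ξ`. -/
def cutoffPowError (N : ℕ) (ξ : ℝ → ℝ) (a q : ℝ) : ℝ :=
  4 * q * q ^ a * deriv (deriv ξ) q + (8 * a + 2 * N) * q ^ a * deriv ξ q

/-- The test function which is an approximate solution of the adjoint equation near the origin. -/
def caloricTest (N : ℕ) (σ₁ : ℝ) (ξ : ℝ → ℝ) (h : ℕ → ℝ → ℝ) (K : ℕ) (T R : ℝ)
    (z : ℝ × Space N) : ℝ :=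
  (∑ k ∈ Finset.range (K + 1), caloricCoeff N (2 + σ₁) k *
    (T⁻¹ ^ k * h k (z.1 / T) * (ξ (‖z.2‖ ^ 2) * (‖z.2‖ ^ 2) ^ (k * (2 + σ₁) / 2))))
  + (ξ (-1 * z.1 + 2) * h 0 (z.1 / T)) * (ξ ((R ^ 2)⁻¹ * ‖z.2‖ ^ 2 + 0) - ξ (‖z.2‖ ^ 2))

/-- The adjoint operator applied to `caloricTest`. -/
def caloricAdjoint (N : ℕ) (σ₁ : ℝ) (ξ : ℝ → ℝ) (h : ℕ → ℝ → ℝ) (K : ℕ) (T R : ℝ)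
    (z : ℝ × Space N) : ℝ :=
  caloricCoeff N (2 + σ₁) K * (‖z.2‖ ^ σ₁ * (T⁻¹ ^ (K + 1) * h (K + 1) (z.1 / T) *
    (ξ (‖z.2‖ ^ 2) * (‖z.2‖ ^ 2) ^ (K * (2 + σ₁) / 2))))
  - (∑ k ∈ Finset.range (K + 1), caloricCoeff N (2 + σ₁) k * (T⁻¹ ^ k * h k (z.1 / T)
      * cutoffPowError N ξ (k * (2 + σ₁) / 2) (‖z.2‖ ^ 2)))
  - ‖z.2‖ ^ σ₁ * (deriv (fun t => ξ (-1 * t + 2) * h 0 (t / T)) z.1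
      * (ξ ((R ^ 2)⁻¹ * ‖z.2‖ ^ 2 + 0) - ξ (‖z.2‖ ^ 2)))
  - (ξ (-1 * z.1 + 2) * h 0 (z.1 / T)) *
      (Laplacian.laplacian (fun y : Space N => ξ ((R ^ 2)⁻¹ * ‖y‖ ^ 2 + 0)) z.2
        - cutoffPowError N ξ 0 (‖z.2‖ ^ 2))

theorem IsDecayFamily.hasDerivAt_scale {p : ℝ} {K : ℕ} {h : ℕ → ℝ → ℝ} (hh : IsDecayFamily p K h)
    (T : ℝ) (k : ℕ) (t : ℝ) :
    HasDerivAt (fun t => T⁻¹ ^ k * h k (t / T)) (-(T⁻¹ ^ (k + 1) * h (k + 1) (t / T))) t := by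
  have h1 : HasDerivAt (fun t : ℝ => t / T) T⁻¹ t := by
    simpa [div_eq_mul_inv] using (hasDerivAt_id t).mul_const T⁻¹
  refine (((hh.hasDerivAt k (t / T)).comp t h1).const_mul (T⁻¹ ^ k)).congr_deriv ?_
  ring

theorem IsDecayFamily.contDiff_scale {p : ℝ} {K : ℕ} {h : ℕ → ℝ → ℝ} (hh : IsDecayFamily p K h)
    (T : ℝ) (k : ℕ) : ContDiff ℝ ∞ (fun t => T⁻¹ ^ k * h k (t / T)) :=
  contDiff_const.mul ((hh.contDiff k).comp (contDiff_id.div_const T))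

/-- The powers near the origin are admissible by `isTestPair_rpow`, the cutoffs at scales R and 1 by
smoothness. Linearity then leaves an algebraic identity off the origin, where the sum telescopes. -/
theorem IsGlobalWeakSolution.isTestPair_caloric {N : ℕ} (hN : 2 ≤ N) {σ₁ σ₂ ϱ p : ℝ} (hσ₁ : -2 < σ₁)
    (hp : 1 < p) (hϱ : -1 < ϱ) {w u₀ : Space N → ℝ} {u : ℝ × Space N → ℝ}
    (hu : IsGlobalWeakSolution σ₁ σ₂ ϱ p w u₀ u) (hw : Integrable w volume)
    {ξ : ℝ → ℝ} (hξ : IsCutoff p ξ) (h0 : ∀ q, 2 ≤ q → ξ q = 0) {K : ℕ} {h : ℕ → ℝ → ℝ}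
    (hh : IsDecayFamily p K h) {T R : ℝ} (hT : 0 < T) (hR : 0 < R) :
    IsTestPair σ₁ σ₂ ϱ p w u₀ u (caloricTest N σ₁ ξ h K T R) (caloricAdjoint N σ₁ ξ h K T R) := by
  have hs : 0 < 2 + σ₁ := by linarith
  have hvan : ∀ k t, T ≤ t → h k (t / T) = 0 := fun k t ht =>
    hh.eq_zero k _ (by rwa [le_div_iff₀ hT, one_mul])
  have pairA := IsTestPair.sum (I := Finset.range (K + 1)) fun k _ =>
    (hu.isTestPair_rpow hN hp hϱ hw (hh.contDiff_scale T k)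
      (fun t ht => by rw [hvan k t ht, mul_zero]) hξ h0
      (a := (k : ℝ) * (2 + σ₁) / 2) (by positivity) (by
        -- The exponent k(2+σ₁) - 2 is at least σ₁ as soon as k ≥ 1, and for k = 0 there is no
        -- singularity.
        rcases Nat.eq_zero_or_pos k with rfl | hk
        · left; simp
        · right
          have : (1 : ℝ) ≤ k := by exact_mod_cast hk
          nlinarith)).const_mul (caloricCoeff N (2 + σ₁) k)
  have hgη : ContDiff ℝ ∞ fun t => ξ (-1 * t + 2) * h 0 (t / T) :=
    (hξ.comp_affine (-1) 2).contDiff.mul ((hh.contDiff 0).comp (contDiff_id.div_const T))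
  have hgη0 : ∀ t, T ≤ t → ξ (-1 * t + 2) * h 0 (t / T) = 0 := fun t ht => by
    rw [hvan 0 t ht, mul_zero]
  have hζ := hξ.comp_affine (R ^ 2)⁻¹ 0
  have hζ0 : ∀ q, 2 * R ^ 2 ≤ q → ξ ((R ^ 2)⁻¹ * q + 0) = 0 := fun q hq => h0 _ (by
    rw [add_zero, ← div_eq_inv_mul, le_div_iff₀ (by positivity)]; exact hq)
  have pairB := hu.isTestPair hϱ hw hgη hgη0 (contDiff_comp_norm_sq (N := N) hζ.contDiff)
    (hasCompactSupport_comp_norm_sq hζ0)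
  have pairC := (hu.isTestPair hϱ hw hgη hgη0 (contDiff_comp_norm_sq (N := N) hξ.contDiff)
    (hasCompactSupport_comp_norm_sq h0)).const_mul (-1)
  refine ((pairA.add pairB).add pairC).congr_of_ne_zero hN (fun t x _ => ?_) fun t x ht hx => ?_
  · simp only [caloricTest]; ring
  · have hr : 0 < ‖x‖ := norm_pos_iff.2 hx
    have hq : 0 < ‖x‖ ^ 2 := by positivity
    simp only [caloricAdjoint, hξ.laplacian_eq, (hh.hasDerivAt_scale T _ _).deriv,
      cutoffPowLaplacian_zero_right hq]
    rw [← sum_caloric_telescope hN hσ₁ hr (fun k => T⁻¹ ^ k * h k (t / T)) (ξ (‖x‖ ^ 2)) K,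
      ← Finset.sum_sub_distrib]
    have hE0 : cutoffPowError N ξ 0 (‖x‖ ^ 2)
        = 4 * ‖x‖ ^ 2 * deriv (deriv ξ) (‖x‖ ^ 2) + 2 * N * deriv ξ (‖x‖ ^ 2) := by
      simp [cutoffPowError]
    rw [hE0]
    have hsum : ∀ (X Y : ℕ → ℝ) (a b c d : ℝ), (∀ k, X k = Y k) → a + b = -c - d →
        ∑ k ∈ Finset.range (K + 1), X k + a + b = ∑ k ∈ Finset.range (K + 1), Y k - c - d := by
      intro X Y a b c d hXY hab
      rw [Finset.sum_congr rfl fun k _ => hXY k]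
      linarith
    refine hsum _ _ _ _ _ _ (fun k => ?_) ?_
    · simp only [cutoffPowError]
      ring
    · ring


/-! ### Bounds for the caloric test function and its adjoint. -/

section
variable {N : ℕ} {σ₁ p : ℝ} {ξ : ℝ → ℝ} {K : ℕ} {h : ℕ → ℝ → ℝ}

theorem cutoff_le_cutoff_scale (hξ : IsCutoff p ξ) (h1 : ∀ q ≤ 1, ξ q = 1)
    (h0 : ∀ q, 2 ≤ q → ξ q = 0) {R : ℝ} (hR : 2 ≤ R) (q : ℝ) :
    ξ q ≤ ξ ((R ^ 2)⁻¹ * q + 0) := by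
  rcases le_total 2 q with h | h
  · rw [h0 q h]; exact hξ.nonneg _
  · rw [h1 ((R ^ 2)⁻¹ * q + 0) (by
      rw [add_zero, inv_mul_le_iff₀ (by positivity)]; nlinarith)]
    exact hξ.le_one q

/-- Isolates k = 0. With χ = ξ(|x|²), φ = ξ(|x|²/R²) and g = ξ(2 - t), the main part is h₀χ + g h₀(φ
- χ). For the standard cutoff, g is 0 for t ≤ 0 and 1 for t ≥ 1, so u₀ is not seen at large |x|. -/
theorem caloricTest_eq (z : ℝ × Space N) (T R : ℝ) :
    caloricTest N σ₁ ξ h K T R z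
      = (∑ k ∈ Finset.range K, caloricCoeff N (2 + σ₁) (k + 1) *
          (T⁻¹ ^ (k + 1) * h (k + 1) (z.1 / T) *
            (ξ (‖z.2‖ ^ 2) * (‖z.2‖ ^ 2) ^ (((k + 1 : ℕ) : ℝ) * (2 + σ₁) / 2))))
        + h 0 (z.1 / T) * ξ (‖z.2‖ ^ 2)
        + (ξ (-1 * z.1 + 2) * h 0 (z.1 / T)) *
          (ξ ((R ^ 2)⁻¹ * ‖z.2‖ ^ 2 + 0) - ξ (‖z.2‖ ^ 2)) := by
  rw [caloricTest, Finset.sum_range_succ']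
  simp [caloricCoeff]

/-- The corrections are nonnegative, which is what the signs of the h_k are for. Both minorants are
products of cutoffs, so their p-th roots factor; the second serves the terms containing g and φ. -/
theorem caloricTest_lower_bounds (hN : 2 ≤ N) (hσ₁ : -2 < σ₁) (hξ : IsCutoff p ξ)
    (h1 : ∀ q ≤ 1, ξ q = 1) (h0 : ∀ q, 2 ≤ q → ξ q = 0) (hh : IsDecayFamily p K h) {T R : ℝ}
    (hT : 0 < T) (hR : 2 ≤ R) {t : ℝ} (ht : 0 ≤ t) (x : Space N) :
    h 0 (t / T) * ξ (‖x‖ ^ 2) ≤ caloricTest N σ₁ ξ h K T R (t, x) ∧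
    ξ (-1 * t + 2) * h 0 (t / T) * ξ ((R ^ 2)⁻¹ * ‖x‖ ^ 2 + 0)
      ≤ caloricTest N σ₁ ξ h K T R (t, x) := by
  have htT : 0 ≤ t / T := by positivity
  have hs : 0 < 2 + σ₁ := by linarith
  have hle := cutoff_le_cutoff_scale hξ h1 h0 hR (‖x‖ ^ 2)
  have hH := hh.nonneg 0 (Nat.zero_le _) (t / T) htT
  have hg0 := hξ.nonneg (-1 * t + 2)
  have hg1 := hξ.le_one (-1 * t + 2)
  have hχ := hξ.nonneg (‖x‖ ^ 2)
  rw [caloricTest_eq]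
  have hsum : 0 ≤ ∑ k ∈ Finset.range K, caloricCoeff N (2 + σ₁) (k + 1) *
          (T⁻¹ ^ (k + 1) * h (k + 1) (t / T) *
            (ξ (‖x‖ ^ 2) * (‖x‖ ^ 2) ^ (((k + 1 : ℕ) : ℝ) * (2 + σ₁) / 2))) := by
    refine Finset.sum_nonneg fun k hk => ?_
    have := caloricCoeff_pos hN hs (k + 1)
    have := hh.nonneg (k + 1) (by simpa [Nat.succ_le_iff] using hk) (t / T) htT
    positivity
  simp only
  have hgH : 0 ≤ ξ (-1 * t + 2) * h 0 (t / T) := mul_nonneg hg0 hH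
  constructor
  · nlinarith [mul_nonneg hgH (sub_nonneg.2 hle)]
  · nlinarith [mul_nonneg (mul_nonneg hH hχ) (sub_nonneg.2 hg1)]

/-- Without k = 0 every term carries at least one factor 1/T. -/
theorem exists_caloric_correction_le (hN : 2 ≤ N) (hσ₁ : -2 < σ₁) (hp : 1 < p) (hξ : IsCutoff p ξ)
    (h0 : ∀ q, 2 ≤ q → ξ q = 0) (hh : IsDecayFamily p K h) :
    ∃ C, 0 ≤ C ∧ ∀ T t, 1 ≤ T → 0 ≤ t → ∀ x : Space N,
      |∑ k ∈ Finset.range K, caloricCoeff N (2 + σ₁) (k + 1) *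
          (T⁻¹ ^ (k + 1) * h (k + 1) (t / T) *
            (ξ (‖x‖ ^ 2) * (‖x‖ ^ 2) ^ (((k + 1 : ℕ) : ℝ) * (2 + σ₁) / 2)))|
        ≤ C * T⁻¹ * (Iio T).indicator 1 t * (shell N (Iio 2)).indicator 1 x := by
  obtain ⟨D, hD, hb⟩ := hh.exists_bound
  have hs : 0 < 2 + σ₁ := by linarith
  refine ⟨∑ k ∈ Finset.range K, caloricCoeff N (2 + σ₁) (k + 1) * (D *
    2 ^ (((k + 1 : ℕ) : ℝ) * (2 + σ₁) / 2)), Finset.sum_nonneg fun k _ => ?_,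
    fun T t hT ht x => ?_⟩
  · have := caloricCoeff_pos hN hs (k + 1); positivity
  have hT0 : 0 < T := by linarith
  refine (Finset.abs_sum_le_sum_abs _ _).trans ?_
  simp only [Finset.sum_mul]
  refine Finset.sum_le_sum fun k hk => ?_
  have hc := caloricCoeff_pos hN hs (k + 1)
  by_cases htT : t < T
  · by_cases hx : x ∈ shell N (Iio 2)
    · rcases le_or_gt 2 (‖x‖ ^ 2) with hq | hq
      · rw [h0 _ hq]
        simp only [indicator_of_mem (mem_Iio.2 htT), indicator_of_mem hx, Pi.one_apply, zero_mul,
          mul_zero, abs_zero]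
        positivity
      · simp only [indicator_of_mem (mem_Iio.2 htT), indicator_of_mem hx, Pi.one_apply, mul_one]
        have htT0 : 0 ≤ t / T := by positivity
        have hX : h 0 (t / T) ^ (1 / p) ≤ 1 := Real.rpow_le_one
          (hh.nonneg 0 (Nat.zero_le _) _ htT0) (hh.le_one _ htT0) (by positivity)
        have hk1 : |h (k + 1) (t / T)| ≤ D := by
          have hk' : k < K := Finset.mem_range.1 hk
          refine (hb (k + 1) (by omega) (t / T) htT0).trans ?_
          exact mul_le_of_le_one_right hD hX
        have hTk : T⁻¹ ^ (k + 1) ≤ T⁻¹ := by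
          refine pow_le_of_le_one (by positivity) (inv_le_one_of_one_le₀ hT) (by omega)
        have hξ0 := hξ.nonneg (‖x‖ ^ 2)
        have hξ1 := hξ.le_one (‖x‖ ^ 2)
        have hpw : (‖x‖ ^ 2) ^ (((k + 1 : ℕ) : ℝ) * (2 + σ₁) / 2)
            ≤ 2 ^ (((k + 1 : ℕ) : ℝ) * (2 + σ₁) / 2) :=
          Real.rpow_le_rpow (by positivity) hq.le (by positivity)
        have hpw0 : 0 ≤ (‖x‖ ^ 2) ^ (((k + 1 : ℕ) : ℝ) * (2 + σ₁) / 2) := by positivity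
        rw [abs_mul, abs_mul, abs_mul, abs_mul, abs_of_pos hc, abs_of_nonneg hξ0,
          abs_of_nonneg hpw0, abs_of_pos (by positivity : 0 < T⁻¹ ^ (k + 1))]
        calc _ ≤ caloricCoeff N (2 + σ₁) (k + 1) * (T⁻¹ * D *
              (1 * 2 ^ (((k + 1 : ℕ) : ℝ) * (2 + σ₁) / 2))) := by gcongr
          _ = _ := by ring
    · have hq : 2 ≤ ‖x‖ ^ 2 := by
        have : 2 ≤ ‖x‖ := not_lt.1 hx
        nlinarith
      simp [h0 _ hq, hx]
  · have : h (k + 1) (t / T) = 0 := hh.eq_zero _ _ (by rw [le_div_iff₀ hT0]; linarith)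
    simp [this, htT]

/-- Derivatives of ξ live on 1 ≤ |x|² ≤ 2, where 4|x|^σ₁ ≥ 1 because σ₁ > -2. Hence the error can be
charged to the weight |x|^σ₁, which the time derivative requires on this shell anyway. -/
theorem exists_cutoffPowError_le (hσ₁ : -2 < σ₁) (hp : 1 < p) (hξ : IsCutoff p ξ)
    (h1 : ∀ q ≤ 1, ξ q = 1) (h0 : ∀ q, 2 ≤ q → ξ q = 0) {a : ℝ} (ha : 0 ≤ a) :
    ∃ C, 0 ≤ C ∧ ∀ R, 2 ≤ R → ∀ x : Space N, |cutoffPowError N ξ a (‖x‖ ^ 2)|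
      ≤ C * (shell N (Icc 1 (2 * R))).indicator (fun x => ‖x‖ ^ σ₁) x * ξ (‖x‖ ^ 2) ^ (1 / p) := by
  obtain ⟨C, hC, hb⟩ := hξ.exists_bound
  refine ⟨4 * ((8 + (8 * a + 2 * N)) * 2 ^ a * C), by positivity, fun R hR x => ?_⟩
  have hind : 0 ≤ (shell N (Icc 1 (2 * R))).indicator (fun x => ‖x‖ ^ σ₁) x :=
    indicator_nonneg (fun _ _ => Real.rpow_nonneg (norm_nonneg _) _) x
  have hY : 0 ≤ ξ (‖x‖ ^ 2) ^ (1 / p) := Real.rpow_nonneg (hξ.nonneg _) _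
  by_cases hq : 1 ≤ ‖x‖ ^ 2 ∧ ‖x‖ ^ 2 < 2
  · have hx1 : 1 ≤ ‖x‖ := by
      by_contra! hlt
      nlinarith [norm_nonneg x]
    have hx2 : ‖x‖ ≤ 2 := by nlinarith
    have hx : x ∈ shell N (Icc 1 (2 * R)) := ⟨hx1, by linarith⟩
    rw [indicator_of_mem hx]
    have hrσ : 1 ≤ 4 * ‖x‖ ^ σ₁ := by
      have e1 : ‖x‖ ^ (-2 : ℝ) ≤ ‖x‖ ^ σ₁ := Real.rpow_le_rpow_of_exponent_le hx1 hσ₁.le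
      have e2 : ‖x‖ ^ (-2 : ℝ) = (‖x‖ ^ 2)⁻¹ := by
        rw [Real.rpow_neg (norm_nonneg _)]; norm_num
      have e3 : (1 : ℝ) / 4 ≤ (‖x‖ ^ 2)⁻¹ := by
        rw [one_div]
        exact inv_anti₀ (by positivity) (by linarith)
      linarith
    obtain ⟨b1, b2⟩ := hb (‖x‖ ^ 2)
    set q := ‖x‖ ^ 2
    have hqa : q ^ a ≤ 2 ^ a := Real.rpow_le_rpow (by positivity) hq.2.le ha
    have hqa0 : 0 ≤ q ^ a := Real.rpow_nonneg (by linarith [hq.1]) _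
    have hq0 : 0 ≤ q := by linarith [hq.1]
    have hE : |cutoffPowError N ξ a q| ≤ (8 + (8 * a + 2 * N)) * 2 ^ a * C * ξ q ^ (1 / p) := by
      rw [cutoffPowError]
      refine (abs_add_le _ _).trans ?_
      rw [abs_mul, abs_mul ((8 * a + 2 * N) * q ^ a),
        abs_of_nonneg (by positivity : 0 ≤ 4 * q * q ^ a),
        abs_of_nonneg (by positivity : 0 ≤ (8 * a + 2 * N) * q ^ a)]
      calc _ ≤ 4 * 2 * 2 ^ a * (C * ξ q ^ (1 / p))
            + (8 * a + 2 * N) * 2 ^ a * (C * ξ q ^ (1 / p)) := by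
            gcongr
            exact hq.2.le
        _ = _ := by ring
    have hnn : 0 ≤ (8 + (8 * a + 2 * N)) * 2 ^ a * C * ξ q ^ (1 / p) := by positivity
    calc _ ≤ _ := hE
      _ ≤ (8 + (8 * a + 2 * N)) * 2 ^ a * C * ξ q ^ (1 / p) * (4 * ‖x‖ ^ σ₁) :=
        le_mul_of_one_le_right hnn hrσ
      _ = _ := by ring
  · have hd : deriv ξ (‖x‖ ^ 2) = 0 ∧ deriv (deriv ξ) (‖x‖ ^ 2) = 0 := by
      rw [not_and_or, not_le, not_lt] at hq
      rcases hq with hq | hq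
      · exact deriv_eq_zero_of_eq_one_of_lt h1 hq
      · exact hξ.deriv_eq_zero_of_eq_zero hp (h0 _ hq)
    rw [cutoffPowError, hd.1, hd.2]
    simp only [mul_zero, add_zero, abs_zero]
    positivity

end


section
variable {N : ℕ} {σ₁ p : ℝ} {ξ : ℝ → ℝ} {K : ℕ} {h : ℕ → ℝ → ℝ}

/-- The error of the term k = 0 and that of the subtracted inner cutoff combine into a factor 1 - g,
zero for t ≥ 1. Otherwise an error without decay would persist over the whole time span T. -/
theorem caloricAdjoint_eq (z : ℝ × Space N) (T R : ℝ) :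
    caloricAdjoint N σ₁ ξ h K T R z
      = caloricCoeff N (2 + σ₁) K * (‖z.2‖ ^ σ₁ * (T⁻¹ ^ (K + 1) * h (K + 1) (z.1 / T) *
          (ξ (‖z.2‖ ^ 2) * (‖z.2‖ ^ 2) ^ (K * (2 + σ₁) / 2))))
        - (∑ k ∈ Finset.range K, caloricCoeff N (2 + σ₁) (k + 1) *
          (T⁻¹ ^ (k + 1) * h (k + 1) (z.1 / T)
            * cutoffPowError N ξ (((k + 1 : ℕ) : ℝ) * (2 + σ₁) / 2) (‖z.2‖ ^ 2)))
        - (1 - ξ (-1 * z.1 + 2)) * h 0 (z.1 / T) * cutoffPowError N ξ 0 (‖z.2‖ ^ 2)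
        - ‖z.2‖ ^ σ₁ * (deriv (fun t => ξ (-1 * t + 2) * h 0 (t / T)) z.1
          * (ξ ((R ^ 2)⁻¹ * ‖z.2‖ ^ 2 + 0) - ξ (‖z.2‖ ^ 2)))
        - (ξ (-1 * z.1 + 2) * h 0 (z.1 / T)) *
          Laplacian.laplacian (fun y : Space N => ξ ((R ^ 2)⁻¹ * ‖y‖ ^ 2 + 0)) z.2 := by
  rw [caloricAdjoint, Finset.sum_range_succ' _ K]
  simp only [caloricCoeff, pow_zero, Nat.cast_zero, zero_mul, zero_div, one_mul]
  ring

theorem IsDecayFamily.deriv_cutoff_mul (hξ : IsCutoff p ξ) (hh : IsDecayFamily p K h) (T t : ℝ) :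
    deriv (fun t => ξ (-1 * t + 2) * h 0 (t / T)) t
      = -deriv ξ (-1 * t + 2) * h 0 (t / T) - ξ (-1 * t + 2) * (T⁻¹ * h 1 (t / T)) := by
  have e1 : HasDerivAt (fun t : ℝ => -1 * t + 2) (-1) t := by
    simpa using ((hasDerivAt_id t).const_mul (-1)).add_const 2
  have e2 := hh.hasDerivAt_scale T 0 t
  simp only [pow_zero, one_mul, zero_add, pow_one] at e2
  have e3 : HasDerivAt (fun t => ξ (-1 * t + 2) * h 0 (t / T)) _ t :=
    ((hξ.hasDerivAt _).comp t e1).mul e2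
  rw [e3.deriv]
  simp only [Function.comp]
  ring

-- Five contributions: the remainder of the telescoping and the cutoff errors with k ≥ 1, both with
-- a factor 1/T; the error with 1 - g, confined to t < 2; the time derivative of g h₀, giving one
-- part confined to t < 2 and one with 1/T; the Laplacian of φ, with 1/R².
set_option maxHeartbeats 1600000 in
theorem exists_caloricAdjoint_le (hN : 2 ≤ N) (hσ₁ : -2 < σ₁) (hp : 1 < p) (hξ : IsCutoff p ξ)
    (h1 : ∀ q ≤ 1, ξ q = 1) (h0 : ∀ q, 2 ≤ q → ξ q = 0) (hh : IsDecayFamily p K h) :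
    ∃ C, 0 ≤ C ∧ ∀ T R t, 1 ≤ T → 2 ≤ R → 0 < t → ∀ x : Space N, x ≠ 0 →
      |caloricAdjoint N σ₁ ξ h K T R (t, x)| ≤
        C * ((Iio 2).indicator 1 t * (shell N (Icc 1 (2 * R))).indicator (fun x => ‖x‖ ^ σ₁) x
          + (Iio T).indicator 1 t * (T⁻¹ *
            ((shell N (Iio 2)).indicator (fun x => ‖x‖ ^ (σ₁ + K * (2 + σ₁))) x
              + (shell N (Icc 1 (2 * R))).indicator (fun x => ‖x‖ ^ σ₁) x)
            + (R ^ 2)⁻¹ * (shell N (Icc R (2 * R))).indicator 1 x))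
          * caloricTest N σ₁ ξ h K T R (t, x) ^ (1 / p) := by
  have hs : 0 < 2 + σ₁ := by linarith
  obtain ⟨D, hD, hb⟩ := hh.exists_bound
  obtain ⟨Cξ, hCξ, hbξ⟩ := hξ.exists_bound
  obtain ⟨CΔ, hCΔ, hΔ⟩ := hξ.exists_laplacian_scale_le (N := N) hp h1 h0
  choose E hE hbE using fun k : ℕ => exists_cutoffPowError_le (N := N) hσ₁ hp hξ h1 h0
    (a := (k : ℝ) * (2 + σ₁) / 2) (by positivity)
  have hc := caloricCoeff_pos hN hs
  set S := ∑ k ∈ Finset.range K, caloricCoeff N (2 + σ₁) (k + 1) * (D * E (k + 1)) with hSdef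
  have hS : 0 ≤ S := Finset.sum_nonneg fun k _ =>
    mul_nonneg (hc _).le (mul_nonneg hD (hE _))
  have hcK := hc K
  refine ⟨caloricCoeff N (2 + σ₁) K * D + S + E 0 + Cξ + D + CΔ, by have := hE 0; positivity,
    fun T R t hT hR ht x hx => ?_⟩
  have hT0 : 0 < T := by linarith
  have hR0 : 0 < R := by linarith
  have hr : 0 < ‖x‖ := norm_pos_iff.2 hx
  set m := (shell N (Icc 1 (2 * R))).indicator (fun x => ‖x‖ ^ σ₁) x with hm
  set m₀ := (shell N (Iio 2)).indicator (fun x => ‖x‖ ^ (σ₁ + K * (2 + σ₁))) x with hm₀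
  set m₁ : ℝ := (shell N (Icc R (2 * R))).indicator 1 x with hm₁
  set i₂ : ℝ := (Iio 2).indicator 1 t with hi₂
  have hm0 : 0 ≤ m := indicator_nonneg (fun _ _ => Real.rpow_nonneg (norm_nonneg _) _) x
  have hm₀0 : 0 ≤ m₀ := indicator_nonneg (fun _ _ => Real.rpow_nonneg (norm_nonneg _) _) x
  have hm₁0 : 0 ≤ m₁ := indicator_nonneg (fun _ _ => zero_le_one) x
  have hi₂0 : 0 ≤ i₂ := indicator_nonneg (fun _ _ => zero_le_one) t
  obtain ⟨hlow1, hlow2⟩ := caloricTest_lower_bounds (σ₁ := σ₁) hN hσ₁ hξ h1 h0 hh hT0 hR ht.le x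
  rw [caloricAdjoint_eq, hh.deriv_cutoff_mul hξ]
  simp only
  set Y := caloricTest N σ₁ ξ h K T R (t, x) ^ (1 / p) with hYdef
  have htT0 : 0 ≤ t / T := by positivity
  set H := h 0 (t / T) with hHdef
  have hH0 : 0 ≤ H := hh.nonneg 0 (Nat.zero_le _) _ htT0
  have hH1 : H ≤ 1 := hh.le_one _ htT0
  set χ := ξ (‖x‖ ^ 2) with hχdef
  set φ := ξ ((R ^ 2)⁻¹ * ‖x‖ ^ 2 + 0) with hφdef
  set g := ξ (-1 * t + 2) with hgdef
  have hχ0 : 0 ≤ χ := hξ.nonneg _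
  have hφ0 : 0 ≤ φ := hξ.nonneg _
  have hg0 : 0 ≤ g := hξ.nonneg _
  have hg1 : g ≤ 1 := hξ.le_one _
  have hχφ : χ ≤ φ := cutoff_le_cutoff_scale hξ h1 h0 hR _
  have hY0 : 0 ≤ Y := Real.rpow_nonneg ((mul_nonneg hH0 hχ0).trans hlow1) _
  have hp0 : 0 < 1 / p := by positivity
  set X := H ^ (1 / p) with hXdef
  have hX0 : 0 ≤ X := Real.rpow_nonneg hH0 _
  have hHX : H ≤ X := by
    rcases hH0.eq_or_lt with e | e
    · rw [← e]; exact hX0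
    · calc H = H ^ (1 : ℝ) := (Real.rpow_one _).symm
        _ ≤ _ := Real.rpow_le_rpow_of_exponent_ge e hH1 (by rw [div_le_one (by linarith)]; exact hp.le)
  have hY1 : X * χ ^ (1 / p) ≤ Y := by
    rw [hXdef, ← Real.mul_rpow hH0 hχ0]
    exact Real.rpow_le_rpow (by positivity) hlow1 hp0.le
  have hY2 : g ^ (1 / p) * X * φ ^ (1 / p) ≤ Y := by
    rw [hXdef, ← Real.mul_rpow hg0 hH0, ← Real.mul_rpow (by positivity) hφ0]
    exact Real.rpow_le_rpow (by positivity) hlow2 hp0.le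
  have hχr : χ ≤ χ ^ (1 / p) := hξ.le_rpow hp _
  have hφr : φ ≤ φ ^ (1 / p) := hξ.le_rpow hp _
  have hgr : g ≤ g ^ (1 / p) := hξ.le_rpow hp _
  rcases le_or_gt T t with htT | htT
  · have hz : ∀ k, h k (t / T) = 0 := fun k =>
      hh.eq_zero k _ (by rwa [le_div_iff₀ hT0, one_mul])
    have hHz : H = 0 := hz 0
    simp only [hz, hHz, mul_zero, zero_mul, Finset.sum_const_zero, sub_zero, abs_zero,
      indicator_of_notMem (show t ∉ Iio T from not_lt.2 htT), add_zero]
    have := hE 0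
    positivity
  simp only [indicator_of_mem (show t ∈ Iio T from htT), Pi.one_apply, one_mul]
  have hTi : T⁻¹ ≤ 1 := inv_le_one_of_one_le₀ hT
  have hTi0 : 0 < T⁻¹ := by positivity
  have hTk : ∀ k : ℕ, T⁻¹ ^ (k + 1) ≤ T⁻¹ := fun k => pow_le_of_le_one hTi0.le hTi (by omega)
  have t1 : |caloricCoeff N (2 + σ₁) K * (‖x‖ ^ σ₁ * (T⁻¹ ^ (K + 1) * h (K + 1) (t / T) *
      (χ * (‖x‖ ^ 2) ^ (K * (2 + σ₁) / 2))))| ≤ caloricCoeff N (2 + σ₁) K * D * (T⁻¹ * m₀) * Y := by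
    by_cases hx2 : x ∈ shell N (Iio 2)
    · rw [hm₀, indicator_of_mem hx2]
      have hpw : (‖x‖ ^ 2) ^ ((K : ℝ) * (2 + σ₁) / 2) = ‖x‖ ^ ((K : ℝ) * (2 + σ₁)) := by
        rw [← Real.rpow_natCast, ← Real.rpow_mul hr.le]
        congr 1; push_cast; ring
      rw [hpw, Real.rpow_add hr, abs_mul, abs_mul, abs_mul, abs_mul, abs_mul, abs_of_pos hcK,
        abs_of_pos (by positivity : 0 < ‖x‖ ^ σ₁), abs_of_pos (by positivity : 0 < T⁻¹ ^ (K + 1)),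
        abs_of_nonneg hχ0, abs_of_pos (by positivity : 0 < ‖x‖ ^ ((K : ℝ) * (2 + σ₁)))]
      calc _ ≤ caloricCoeff N (2 + σ₁) K * (‖x‖ ^ σ₁ * (T⁻¹ * (D * X) *
            (χ ^ (1 / p) * ‖x‖ ^ ((K : ℝ) * (2 + σ₁))))) := by
            gcongr
            · exact hTk K
            · exact hb _ le_rfl _ htT0
        _ = caloricCoeff N (2 + σ₁) K * D * (T⁻¹ * (‖x‖ ^ σ₁ * ‖x‖ ^ ((K : ℝ) * (2 + σ₁))))
            * (X * χ ^ (1 / p)) := by ring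
        _ ≤ _ := by gcongr
    · have hq : 2 ≤ ‖x‖ ^ 2 := by
        have : 2 ≤ ‖x‖ := not_lt.1 hx2
        nlinarith
      have hχz : χ = 0 := h0 _ hq
      rw [hχz]
      simp only [zero_mul, mul_zero, abs_zero]
      positivity
  have t2 : |∑ k ∈ Finset.range K, caloricCoeff N (2 + σ₁) (k + 1) *
      (T⁻¹ ^ (k + 1) * h (k + 1) (t / T)
        * cutoffPowError N ξ (((k + 1 : ℕ) : ℝ) * (2 + σ₁) / 2) (‖x‖ ^ 2))| ≤ S * (T⁻¹ * m) * Y := by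
    refine (Finset.abs_sum_le_sum_abs _ _).trans ?_
    rw [hSdef, Finset.sum_mul, Finset.sum_mul]
    refine Finset.sum_le_sum fun k hk => ?_
    have hk' : k < K := Finset.mem_range.1 hk
    have hck := hc (k + 1)
    have hEk := hE (k + 1)
    rw [abs_mul, abs_mul, abs_mul, abs_of_pos hck, abs_of_pos (by positivity : 0 < T⁻¹ ^ (k + 1))]
    calc _ ≤ caloricCoeff N (2 + σ₁) (k + 1) * (T⁻¹ * (D * X) *
          (E (k + 1) * m * χ ^ (1 / p))) := by
          gcongr
          · exact hTk k
          · exact hb _ (by omega) _ htT0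
          · exact hbE (k + 1) R hR x
      _ = caloricCoeff N (2 + σ₁) (k + 1) * (D * E (k + 1)) * (T⁻¹ * m) * (X * χ ^ (1 / p)) := by
          ring
      _ ≤ _ := by gcongr
  have t3 : |(1 - g) * H * cutoffPowError N ξ 0 (‖x‖ ^ 2)| ≤ E 0 * (i₂ * m) * Y := by
    have hE0 := hE 0
    have hb0 := hbE 0 R hR x
    simp only [Nat.cast_zero, zero_mul, zero_div] at hb0
    rcases lt_or_ge t 2 with ht2 | ht2
    · rw [hi₂, indicator_of_mem (show t ∈ Iio 2 from ht2), Pi.one_apply, one_mul, abs_mul, abs_mul,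
        abs_of_nonneg (sub_nonneg.2 hg1), abs_of_nonneg hH0]
      calc _ ≤ 1 * X * (E 0 * m * χ ^ (1 / p)) := by
            gcongr
            linarith
        _ = E 0 * m * (X * χ ^ (1 / p)) := by ring
        _ ≤ _ := by gcongr
    · have hgone : g = 1 := h1 _ (by linarith)
      rw [hgone]
      simp only [sub_self, zero_mul, abs_zero]
      positivity
  have t4 : |‖x‖ ^ σ₁ * ((-deriv ξ (-1 * t + 2) * H - g * (T⁻¹ * h 1 (t / T))) * (φ - χ))|
      ≤ (Cξ * (i₂ * m) + D * (T⁻¹ * m)) * Y := by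
    have hd : |-deriv ξ (-1 * t + 2) * H - g * (T⁻¹ * h 1 (t / T))|
        ≤ (Cξ * i₂ + D * T⁻¹) * (g ^ (1 / p) * X) := by
      refine (abs_sub _ _).trans ?_
      have d1 : |-deriv ξ (-1 * t + 2) * H| ≤ Cξ * i₂ * (g ^ (1 / p) * X) := by
        rcases lt_or_ge t 2 with ht2 | ht2
        · rw [hi₂, indicator_of_mem (show t ∈ Iio 2 from ht2), Pi.one_apply, mul_one, abs_mul,
            abs_neg, abs_of_nonneg hH0]
          calc _ ≤ Cξ * g ^ (1 / p) * X := by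
                gcongr
                exact (hbξ _).1
            _ = _ := by ring
        · rw [(deriv_eq_zero_of_eq_one_of_lt h1 (by linarith : -1 * t + 2 < 1)).1]
          simp only [neg_zero, zero_mul, abs_zero]
          positivity
      have d2 : |g * (T⁻¹ * h 1 (t / T))| ≤ D * T⁻¹ * (g ^ (1 / p) * X) := by
        rw [abs_mul, abs_mul, abs_of_nonneg hg0, abs_of_pos hTi0]
        calc _ ≤ g ^ (1 / p) * (T⁻¹ * (D * X)) := by
              gcongr
              exact hb 1 (by omega) _ htT0
          _ = _ := by ring
      linarith
    have hφχ : ‖x‖ ^ σ₁ * (φ - χ) ≤ m * φ ^ (1 / p) := by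
      by_cases hxs : x ∈ shell N (Icc 1 (2 * R))
      · rw [hm, indicator_of_mem hxs]
        have : 0 ≤ ‖x‖ ^ σ₁ := by positivity
        gcongr
        linarith
      · have hz : φ - χ = 0 := by
          have hxs' : ¬ (1 ≤ ‖x‖ ∧ ‖x‖ ≤ 2 * R) := hxs
          rw [not_and_or, not_le, not_le] at hxs'
          rcases hxs' with hlt | hlt
          · have hq : ‖x‖ ^ 2 ≤ 1 := by nlinarith
            have e1 : χ = 1 := h1 _ hq
            have e2 : φ = 1 := h1 _ (by
              rw [add_zero, inv_mul_le_iff₀ (by positivity)]; nlinarith)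
            rw [e1, e2, sub_self]
          · have e1 : φ = 0 := h0 _ (by
              rw [add_zero, ← div_eq_inv_mul, le_div_iff₀ (by positivity)]; nlinarith)
            have e2 : χ = 0 := le_antisymm (hχφ.trans e1.le) hχ0
            rw [e1, e2, sub_self]
        rw [hz, mul_zero]
        positivity
    have hrσ : 0 ≤ ‖x‖ ^ σ₁ := by positivity
    rw [abs_mul, abs_mul, abs_of_nonneg hrσ, abs_of_nonneg (sub_nonneg.2 hχφ)]
    calc _ = |-deriv ξ (-1 * t + 2) * H - g * (T⁻¹ * h 1 (t / T))| * (‖x‖ ^ σ₁ * (φ - χ)) := by ring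
      _ ≤ (Cξ * i₂ + D * T⁻¹) * (g ^ (1 / p) * X) * (m * φ ^ (1 / p)) := by
          have : 0 ≤ ‖x‖ ^ σ₁ * (φ - χ) := mul_nonneg hrσ (sub_nonneg.2 hχφ)
          gcongr
      _ = (Cξ * (i₂ * m) + D * (T⁻¹ * m)) * (g ^ (1 / p) * X * φ ^ (1 / p)) := by ring
      _ ≤ _ := by gcongr
  have t5 : |g * H * Laplacian.laplacian (fun y : Space N => ξ ((R ^ 2)⁻¹ * ‖y‖ ^ 2 + 0)) x|
      ≤ CΔ * ((R ^ 2)⁻¹ * m₁) * Y := by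
    have hb5 := hΔ R hR0 x
    have hm₁eq : (shell N (Icc R (2 * R))).indicator (fun _ => CΔ * (R ^ 2)⁻¹) x
        = CΔ * (R ^ 2)⁻¹ * m₁ := by
      by_cases hxs : x ∈ shell N (Icc R (2 * R)) <;> simp [hm₁, hxs]
    rw [hm₁eq] at hb5
    rw [abs_mul, abs_of_nonneg (mul_nonneg hg0 hH0)]
    calc _ ≤ g ^ (1 / p) * X * (CΔ * (R ^ 2)⁻¹ * m₁ * φ ^ (1 / p)) := by gcongr
      _ = CΔ * ((R ^ 2)⁻¹ * m₁) * (g ^ (1 / p) * X * φ ^ (1 / p)) := by ring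
      _ ≤ _ := by gcongr
  have hsum : ∀ a b c d e : ℝ, |a - b - c - d - e| ≤ |a| + |b| + |c| + |d| + |e| := by
    intro a b c d e
    linarith [abs_sub (a - b - c - d) e, abs_sub (a - b - c) d, abs_sub (a - b) c, abs_sub a b]
  refine (hsum _ _ _ _ _).trans ((add_le_add (add_le_add (add_le_add (add_le_add t1 t2) t3) t4)
    t5).trans ?_)
  rw [← add_mul, ← add_mul, ← add_mul, ← add_mul]
  refine mul_le_mul_of_nonneg_right ?_ hY0
  have hE0 := hE 0
  have v1 : 0 ≤ i₂ * m := by positivity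
  have v2 : 0 ≤ T⁻¹ * m := by positivity
  have v3 : 0 ≤ T⁻¹ * m₀ := by positivity
  have v4 : 0 ≤ (R ^ 2)⁻¹ * m₁ := by positivity
  have hcD : 0 ≤ caloricCoeff N (2 + σ₁) K * D := by positivity
  rw [mul_add T⁻¹]
  set c₁ := caloricCoeff N (2 + σ₁) K * D
  set v₁ := i₂ * m
  set v₂ := T⁻¹ * m
  set v₃ := T⁻¹ * m₀
  set v₄ := (R ^ 2)⁻¹ * m₁
  have w1 : 0 ≤ (c₁ + S + D + CΔ) * v₁ := by positivity
  have w2 : 0 ≤ (c₁ + E 0 + Cξ + CΔ) * v₂ := by positivity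
  have w3 : 0 ≤ (S + E 0 + Cξ + D + CΔ) * v₃ := by positivity
  have w4 : 0 ≤ (c₁ + S + E 0 + Cξ + D) * v₄ := by positivity
  linarith
end


/-! ### The contradiction when the weight is not integrable at the origin. -/

/-- The indicators and τ = 1/T are kept to the first power, since y^s ≤ y on [0, 1]: over a time
span T the weight 1/T integrates to a constant, which is enough. Only ρ = 1/R² must keep its power.
-/
theorem rpow_weight_le {s i j τ ρ m m₀ m₁ : ℝ} (hs : 1 ≤ s) (hi : 0 ≤ i) (hi1 : i ≤ 1) (hj : 0 ≤ j)
    (hj1 : j ≤ 1) (hτ : 0 ≤ τ) (hτ1 : τ ≤ 1) (hρ : 0 ≤ ρ) (hm : 0 ≤ m) (hm₀ : 0 ≤ m₀)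
    (hm₁ : 0 ≤ m₁) :
    (i * m + j * (τ * (m₀ + m) + ρ * m₁)) ^ s
      ≤ (2 ^ s) ^ 3 * (i * m ^ s + j * (τ * (m₀ ^ s + m ^ s) + ρ ^ s * m₁ ^ s)) := by
  have hs0 : 0 ≤ s := by linarith
  have hpow : ∀ y : ℝ, 0 ≤ y → y ≤ 1 → y ^ s ≤ y := fun y hy hy1 => by
    rcases hy.eq_or_lt with h | h
    · rw [← h, Real.zero_rpow (by linarith)]
    · calc y ^ s ≤ y ^ (1 : ℝ) := Real.rpow_le_rpow_of_exponent_ge h hy1 hs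
        _ = y := Real.rpow_one y
  have h2 : (1 : ℝ) ≤ 2 ^ s := Real.one_le_rpow (by norm_num) hs0
  have e1 : (τ * (m₀ + m)) ^ s ≤ 2 ^ s * (τ * (m₀ ^ s + m ^ s)) := by
    rw [Real.mul_rpow hτ (by positivity)]
    calc _ ≤ τ * (2 ^ s * (m₀ ^ s + m ^ s)) := by
          gcongr
          · exact hpow τ hτ hτ1
          · exact Real.add_rpow_le_two_rpow_mul hm₀ hm hs0
      _ = _ := by ring
  have e2 : (ρ * m₁) ^ s ≤ 2 ^ s * (ρ ^ s * m₁ ^ s) := by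
    rw [Real.mul_rpow hρ hm₁]
    exact le_mul_of_one_le_left (by positivity) h2
  have e3 : (j * (τ * (m₀ + m) + ρ * m₁)) ^ s
      ≤ (2 ^ s) ^ 2 * (j * (τ * (m₀ ^ s + m ^ s) + ρ ^ s * m₁ ^ s)) := by
    rw [Real.mul_rpow hj (by positivity)]
    calc _ ≤ j * (2 ^ s * (2 ^ s * (τ * (m₀ ^ s + m ^ s)) + 2 ^ s * (ρ ^ s * m₁ ^ s))) := by
          gcongr
          · exact hpow j hj hj1
          · exact (Real.add_rpow_le_two_rpow_mul (by positivity) (by positivity) hs0).trans (by gcongr)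
      _ = _ := by ring
  have e4 : (i * m) ^ s ≤ (2 ^ s) ^ 2 * (i * m ^ s) := by
    rw [Real.mul_rpow hi hm]
    calc _ ≤ 1 * (i * m ^ s) := by
          rw [one_mul]
          gcongr
          exact hpow i hi hi1
      _ ≤ _ := by
          gcongr
          exact one_le_pow₀ h2
  calc _ ≤ 2 ^ s * ((2 ^ s) ^ 2 * (i * m ^ s)
        + (2 ^ s) ^ 2 * (j * (τ * (m₀ ^ s + m ^ s) + ρ ^ s * m₁ ^ s))) :=
        (Real.add_rpow_le_two_rpow_mul (by positivity) (by positivity) hs0).trans (by gcongr)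
    _ = _ := by ring

theorem indicator_rpow_mul_rpow {N : ℕ} (S : Set (Space N)) (a b : ℝ) {s : ℝ} (hs : 0 < s)
    {x : Space N} (hx : x ≠ 0) :
    S.indicator (fun x => ‖x‖ ^ a) x ^ s * ‖x‖ ^ b
      = S.indicator (fun x => ‖x‖ ^ (a * s + b)) x := by
  have hr : 0 < ‖x‖ := norm_pos_iff.2 hx
  by_cases h : x ∈ S
  · simp only [indicator_of_mem h]
    rw [← Real.rpow_mul hr.le, ← Real.rpow_add hr]
  · simp only [indicator_of_notMem h, Real.zero_rpow hs.ne', zero_mul]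

/-- The growth is at most logarithmic, reached at a = -N; any small power of R absorbs it. -/
theorem exists_integral_shell_Icc_le {N : ℕ} (hN : 2 ≤ N) {a δ : ℝ} (ha : a ≤ -N) (hδ : 0 < δ) :
    ∃ V, 0 ≤ V ∧ ∀ R : ℝ, 1 ≤ R → ∫ x in shell N (Icc 1 (2 * R)), ‖x‖ ^ a ≤ V * R ^ δ := by
  set v := N * volume.real (Metric.ball (0 : Space N) 1) with hv
  have hv0 : 0 ≤ v := by positivity
  refine ⟨v * (2 ^ δ / δ), by positivity, fun R hR => ?_⟩
  have hsub : Icc 1 (2 * R) ⊆ Ioi 0 := fun y hy => zero_lt_one.trans_le hy.1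
  rw [integral_shell hN measurableSet_Icc, ← hv, inter_eq_left.2 hsub]
  have hcont : ∀ c : ℝ, IntegrableOn (fun y : ℝ => y ^ c) (Icc 1 (2 * R)) volume := fun c =>
    ContinuousOn.integrableOn_Icc fun y hy =>
      (Real.continuousAt_rpow_const y _ (Or.inl (by linarith [hy.1]))).continuousWithinAt
  have h1 : ∫ y in Icc 1 (2 * R), y ^ (a + N - 1) ≤ ∫ y in Icc 1 (2 * R), y ^ (-1 : ℝ) := by
    refine setIntegral_mono_on (hcont _) (hcont _) measurableSet_Icc fun y hy => ?_
    exact Real.rpow_le_rpow_of_exponent_le hy.1 (by linarith)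
  have h2 : ∫ y in Icc 1 (2 * R), y ^ (-1 : ℝ) = Real.log (2 * R) := by
    rw [integral_Icc_eq_integral_Ioc, ← intervalIntegral.integral_of_le (by linarith)]
    simp only [Real.rpow_neg_one]
    rw [integral_inv_of_pos one_pos (by linarith), div_one]
  have h3 : Real.log (2 * R) ≤ 2 ^ δ / δ * R ^ δ := by
    refine (Real.log_le_rpow_div (by linarith : 0 ≤ 2 * R) hδ).trans_eq ?_
    rw [Real.mul_rpow (by norm_num) (by linarith)]
    ring
  exact (mul_le_mul_of_nonneg_left (h1.trans (h2.le.trans h3)) hv0).trans_eq (mul_assoc _ _ _).symm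

section
variable {N : ℕ} {σ₁ σ₂ ϱ p : ℝ} {ξ : ℝ → ℝ} {K : ℕ} {h : ℕ → ℝ → ℝ} {w u₀ : Space N → ℝ}
  {u : ℝ × Space N → ℝ}

theorem IsGlobalWeakSolution.exists_caloric_estimate (hN : 2 ≤ N) (hσ₁ : -2 < σ₁) (hp : 1 < p)
    (hϱ : -1 < ϱ) (hu : IsGlobalWeakSolution σ₁ σ₂ ϱ p w u₀ u) (hw : Integrable w volume)
    (hξ : IsCutoff p ξ) (h1 : ∀ q ≤ 1, ξ q = 1) (h0 : ∀ q, 2 ≤ q → ξ q = 0)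
    (hh : IsDecayFamily p K h)
    (hK : -N < (σ₁ + K * (2 + σ₁)) * (p / (p - 1)) + -σ₂ / (p - 1)) :
    ∃ C, 0 ≤ C ∧ ∀ T R, 1 ≤ T → 2 ≤ R →
      (∫ x, ‖x‖ ^ σ₁ * u₀ x * caloricTest N σ₁ ξ h K T R (0, x))
        + ∫ z in Ioi 0 ×ˢ univ, z.1 ^ ϱ * w z.2 * caloricTest N σ₁ ξ h K T R z
      ≤ C * (1 + (∫ x in shell N (Icc 1 (2 * R)), ‖x‖ ^ (σ₁ * (p / (p - 1)) + -σ₂ / (p - 1)))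
        + T * R ^ (N - 2 * (p / (p - 1)) + -σ₂ / (p - 1))) := by
  obtain ⟨D, hD, hadj⟩ := exists_caloricAdjoint_le (N := N) (σ₁ := σ₁) hN hσ₁ hp hξ h1 h0 hh
  have hp1 : 0 < p - 1 := by linarith
  have hp'1 : 1 ≤ p / (p - 1) := by rw [le_div_iff₀ hp1]; linarith
  have hp'0 : 0 < p / (p - 1) := by linarith
  set p' := p / (p - 1) with hp'
  set b := -σ₂ / (p - 1) with hb
  set c := D ^ p' * (2 ^ p') ^ 3 with hc
  have hc0 : 0 ≤ c := by positivity
  set A₀ := ∫ x in shell N (Iio 2), ‖x‖ ^ ((σ₁ + K * (2 + σ₁)) * p' + b) with hA₀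
  set B := ∫ x in shell N (Icc 1 2), ‖x‖ ^ b with hB
  have hA₀0 : 0 ≤ A₀ := integral_nonneg fun x => Real.rpow_nonneg (norm_nonneg _) _
  have hB0 : 0 ≤ B := integral_nonneg fun x => Real.rpow_nonneg (norm_nonneg _) _
  refine ⟨c * (A₀ + B + 3), by positivity, fun T R hT hR => ?_⟩
  have hT0 : 0 < T := by linarith
  have hR0 : 0 < R := by linarith
  have hTi0 : 0 < T⁻¹ := by positivity
  have hTi : T⁻¹ ≤ 1 := inv_le_one_of_one_le₀ hT
  have mI := measurableSet_shell (N := N) (measurableSet_Icc (a := 1) (b := 2 * R))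
  have mR := measurableSet_shell (N := N) (measurableSet_Icc (a := R) (b := 2 * R))
  have m2 := measurableSet_shell (N := N) (measurableSet_Iio (a := 2))
  set k : Space N → ℝ := (shell N (Icc 1 (2 * R))).indicator (fun x => ‖x‖ ^ (σ₁ * p' + b)) with hk
  set k₀ : Space N → ℝ := (shell N (Iio 2)).indicator
    (fun x => ‖x‖ ^ ((σ₁ + K * (2 + σ₁)) * p' + b)) with hk₀
  set k₁ : Space N → ℝ := (shell N (Icc R (2 * R))).indicator (fun x => ‖x‖ ^ b) with hk₁
  have ik : Integrable k volume := (integrableOn_shell_Icc hN one_pos _).integrable_indicator mI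
  have ik₀ : Integrable k₀ volume := (integrableOn_shell_Iio hN hK).integrable_indicator m2
  have ik₁ : Integrable k₁ volume := (integrableOn_shell_Icc hN hR0 _).integrable_indicator mR
  have iks : Integrable (fun x => k₀ x + k x) volume := ik₀.add ik
  have ikk : Integrable (fun x => T⁻¹ * (k₀ x + k x) + ((R ^ 2)⁻¹) ^ p' * k₁ x) volume :=
    (iks.const_mul _).add (ik₁.const_mul _)
  have iH1 := integrableOn_indicator_Iio_mul (T := 2) ik
  have iH2 := integrableOn_indicator_Iio_mul (T := T) ikk
  have key := (hu.isTestPair_caloric hN hσ₁ hp hϱ hw hξ h0 hh hT0 hR0).initial_add_source_le hN hp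
    (fun z hz => ?_)
    (F := fun z => D * ((Iio 2).indicator 1 z.1 *
            (shell N (Icc 1 (2 * R))).indicator (fun x => ‖x‖ ^ σ₁) z.2
          + (Iio T).indicator 1 z.1 * (T⁻¹ *
            ((shell N (Iio 2)).indicator (fun x => ‖x‖ ^ (σ₁ + K * (2 + σ₁))) z.2
              + (shell N (Icc 1 (2 * R))).indicator (fun x => ‖x‖ ^ σ₁) z.2)
            + (R ^ 2)⁻¹ * (shell N (Icc R (2 * R))).indicator 1 z.2)))
    (H := fun z => c * ((Iio 2).indicator 1 z.1 * k z.2 + (Iio T).indicator 1 z.1 *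
      (T⁻¹ * (k₀ z.2 + k z.2) + ((R ^ 2)⁻¹) ^ p' * k₁ z.2)))
    (fun z hz hx => ?_) ((iH1.add iH2).const_mul c)
  · refine key.trans ?_
    rw [integral_const_mul, integral_add iH1 iH2, integral_indicator_Iio_mul zero_le_two,
      integral_indicator_Iio_mul hT0.le
        (fun x => T⁻¹ * (k₀ x + k x) + ((R ^ 2)⁻¹) ^ p' * k₁ x), integral_add (iks.const_mul _) (ik₁.const_mul _),
      integral_const_mul, integral_const_mul, integral_add ik₀ ik, hk, hk₀, hk₁,
      integral_indicator mI, integral_indicator m2, integral_indicator mR, ← hA₀,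
      -- The Laplacian term scales as R^(-2p') R^(b+N), and the time integral multiplies it by T.
      integral_shell_scale measurableSet_Icc measurableSet_Icc hR0 (D := Icc 1 2) (D' := Icc R (2 * R)) (fun y => by
        simp only [mem_Icc]
        rw [← div_eq_inv_mul, le_div_iff₀ hR0, div_le_iff₀ hR0, one_mul]), ← hB]
    set M := ∫ x in shell N (Icc 1 (2 * R)), ‖x‖ ^ (σ₁ * p' + b) with hM
    have hM0 : 0 ≤ M := integral_nonneg fun x => Real.rpow_nonneg (norm_nonneg _) _
    have e2 : ((R ^ 2)⁻¹) ^ p' * (R ^ (b + N) * B) = R ^ (N - 2 * p' + b) * B := by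
      have : ((R ^ 2)⁻¹) ^ p' = R ^ (-2 * p') := by
        rw [Real.rpow_mul hR0.le, Real.rpow_neg hR0.le]; norm_num
      rw [this, ← mul_assoc, ← Real.rpow_add hR0]
      congr 2; ring
    rw [e2, mul_assoc c]
    refine mul_le_mul_of_nonneg_left ?_ hc0
    set Z := R ^ (N - 2 * p' + b) with hZ
    have hZ0 : 0 ≤ Z := by positivity
    have e3 : T * (T⁻¹ * (A₀ + M) + Z * B) = A₀ + M + T * Z * B := by
      field_simp
    rw [e3]
    have hTZ : 0 ≤ T * Z := by positivity
    nlinarith [mul_nonneg hA₀0 hM0, mul_nonneg hB0 hM0, mul_nonneg hA₀0 hTZ, mul_nonneg hB0 hTZ]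
  · obtain ⟨hl, -⟩ := caloricTest_lower_bounds (σ₁ := σ₁) hN hσ₁ hξ h1 h0 hh hT0 hR hz.le z.2
    exact (mul_nonneg (hh.nonneg 0 (Nat.zero_le _) _ (by positivity)) (hξ.nonneg _)).trans hl
  · obtain ⟨t, x⟩ := z
    simp only at hz hx ⊢
    have hm0 : 0 ≤ (shell N (Icc 1 (2 * R))).indicator (fun x => ‖x‖ ^ σ₁) x :=
      indicator_nonneg (fun _ _ => Real.rpow_nonneg (norm_nonneg _) _) x
    have hm₀0 : 0 ≤ (shell N (Iio 2)).indicator (fun x => ‖x‖ ^ (σ₁ + K * (2 + σ₁))) x :=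
      indicator_nonneg (fun _ _ => Real.rpow_nonneg (norm_nonneg _) _) x
    have hm₁0 : 0 ≤ (shell N (Icc R (2 * R))).indicator (1 : Space N → ℝ) x :=
      indicator_nonneg (fun _ _ => zero_le_one) x
    have hind : ∀ a : ℝ, 0 ≤ (Iio a).indicator (1 : ℝ → ℝ) t ∧ (Iio a).indicator (1 : ℝ → ℝ) t ≤ 1 :=
      fun a => ⟨indicator_nonneg (fun _ _ => zero_le_one) t,
        indicator_le_self' (fun _ _ => zero_le_one) t⟩
    have hpw := rpow_weight_le hp'1 (hind 2).1 (hind 2).2 (hind T).1 (hind T).2 hTi0.le hTi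
      (by positivity : 0 ≤ (R ^ 2)⁻¹) hm0 hm₀0 hm₁0
    have f1 := indicator_rpow_mul_rpow (shell N (Icc 1 (2 * R))) σ₁ b hp'0 hx
    have f2 := indicator_rpow_mul_rpow (shell N (Iio 2)) (σ₁ + K * (2 + σ₁)) b hp'0 hx
    have f3 : (shell N (Icc R (2 * R))).indicator (1 : Space N → ℝ) x ^ p' * ‖x‖ ^ b = k₁ x := by
      by_cases hxs : x ∈ shell N (Icc R (2 * R)) <;> simp [hk₁, hxs, Real.zero_rpow hp'0.ne']
    rw [← hk] at f1
    rw [← hk₀] at f2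
    have := hadj T R t hT hR hz x hx
    have hi2 := (hind 2).1
    have hiT := (hind T).1
    set m := (shell N (Icc 1 (2 * R))).indicator (fun x => ‖x‖ ^ σ₁) x
    set m₀ := (shell N (Iio 2)).indicator (fun x => ‖x‖ ^ (σ₁ + K * (2 + σ₁))) x
    set m₁ := (shell N (Icc R (2 * R))).indicator (1 : Space N → ℝ) x
    refine ⟨by positivity, this, ?_⟩
    rw [Real.mul_rpow hD (by positivity), ← f1, ← f2, ← f3, hc]
    have hrb : 0 ≤ ‖x‖ ^ b := by positivity
    calc _ ≤ D ^ p' * ((2 ^ p') ^ 3 * ((Iio 2).indicator 1 t * m ^ p' + (Iio T).indicator 1 t *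
          (T⁻¹ * (m₀ ^ p' + m ^ p') + ((R ^ 2)⁻¹) ^ p' * m₁ ^ p'))) * ‖x‖ ^ b := by gcongr
      _ = _ := by ring
end


section
variable {N : ℕ} {σ₁ σ₂ ϱ p : ℝ} {ξ : ℝ → ℝ} {K : ℕ} {h : ℕ → ℝ → ℝ} {w u₀ : Space N → ℝ}
  {u : ℝ × Space N → ℝ}

/-- At t = 0 the factor g vanishes, so the test function lives in |x| < 2 and is bounded there
uniformly in T and R. No growth condition on u₀ is needed. -/
theorem IsGlobalWeakSolution.exists_caloric_initial_ge (hN : 2 ≤ N) (hσ₁ : -2 < σ₁) (hp : 1 < p)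
    (hϱ : -1 < ϱ) (hu : IsGlobalWeakSolution σ₁ σ₂ ϱ p w u₀ u) (hw : Integrable w volume)
    (hξ : IsCutoff p ξ) (h0 : ∀ q, 2 ≤ q → ξ q = 0) (hh : IsDecayFamily p K h) :
    ∃ C, 0 ≤ C ∧ ∀ T R, 1 ≤ T →
      -C ≤ ∫ x, ‖x‖ ^ σ₁ * u₀ x * caloricTest N σ₁ ξ h K T R (0, x) := by
  obtain ⟨D, hD, hcor⟩ := exists_caloric_correction_le (N := N) hN hσ₁ hp hξ h0 hh
  obtain ⟨-, -, -, hu₀⟩ := hu.integrableOn_cylinder hN hp hϱ hw (T := 1) (R := 2) one_pos two_pos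
  have m2 := measurableSet_shell (N := N) (measurableSet_Iio (a := 2))
  have hint := (hu₀.integrable_indicator m2).abs
  refine ⟨(D + 1) * ∫ x, |(shell N (Iio 2)).indicator (fun x => ‖x‖ ^ σ₁ * u₀ x) x|,
    mul_nonneg (by positivity) (integral_nonneg fun _ => abs_nonneg _), fun T R hT => ?_⟩
  have hT0 : 0 < T := by linarith
  refine neg_le_of_abs_le ((abs_integral_le_integral_abs).trans ?_)
  rw [← integral_const_mul]
  refine integral_mono_of_nonneg (Eventually.of_forall fun _ => abs_nonneg _)
    (hint.const_mul _) (Eventually.of_forall fun x => ?_)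
  simp only [caloricTest_eq]
  have hg : ξ (-1 * 0 + 2) = 0 := h0 _ (by norm_num)
  have hc := hcor T 0 hT le_rfl x
  rw [hg, zero_mul, zero_mul, add_zero]
  rw [indicator_of_mem (show (0 : ℝ) ∈ Iio T from hT0), Pi.one_apply, mul_one] at hc
  by_cases hx : x ∈ shell N (Iio 2)
  · rw [indicator_of_mem hx, Pi.one_apply, mul_one] at hc
    rw [indicator_of_mem hx, abs_mul, mul_comm (D + 1)]
    refine mul_le_mul_of_nonneg_left ((abs_add_le _ _).trans (add_le_add (hc.trans ?_) ?_))
      (abs_nonneg _)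
    · exact mul_le_of_le_one_right hD (inv_le_one_of_one_le₀ hT)
    · have hH0 := hh.nonneg 0 (Nat.zero_le _) (0 / T) (by simp)
      have hH1 := hh.le_one (0 / T) (by simp)
      rw [abs_of_nonneg (mul_nonneg hH0 (hξ.nonneg _))]
      exact mul_le_one₀ hH1 (hξ.nonneg _) (hξ.le_one _)
  · have hq : 2 ≤ ‖x‖ ^ 2 := by
      have : 2 ≤ ‖x‖ := not_lt.1 hx
      nlinarith
    simp [h0 _ hq, hx]

/-- Since w may change sign, the deviation of the test function from h₀φ is bounded in absolute
value: a correction of order 1/T for t < T, and (1 - g) h₀(φ - χ), present for small t only. Against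
t^ϱ |w| they cost multiples of T^ϱ and 1, below the main term T^(1+ϱ). -/
theorem exists_caloric_source_ge (hN : 2 ≤ N) (hσ₁ : -2 < σ₁) (hp : 1 < p)
    (hϱ : -1 < ϱ) (hw : Integrable w volume)
    (hξ : IsCutoff p ξ) (h1 : ∀ q ≤ 1, ξ q = 1) (h0 : ∀ q, 2 ≤ q → ξ q = 0)
    (hh : IsDecayFamily p K h) :
    ∃ C, 0 ≤ C ∧ ∀ T R, 1 ≤ T → 2 ≤ R →
      IntegrableOn (fun z => z.1 ^ ϱ * w z.2 * caloricTest N σ₁ ξ h K T R z)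
        (Ioi 0 ×ˢ univ) volume →
      T ^ (1 + ϱ) * ((∫ t in Ioi (0 : ℝ), t ^ ϱ * h 0 t) * ∫ x, w x * ξ ((R ^ 2)⁻¹ * ‖x‖ ^ 2 + 0))
        ≤ C * (1 + T ^ ϱ)
          + ∫ z in Ioi 0 ×ˢ univ, z.1 ^ ϱ * w z.2 * caloricTest N σ₁ ξ h K T R z := by
  obtain ⟨D, hD, hcor⟩ := exists_caloric_correction_le (N := N) hN hσ₁ hp hξ h0 hh
  set J := ∫ t in Ioi (0 : ℝ), t ^ ϱ * ξ t with hJ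
  have hJ0 : 0 ≤ J := setIntegral_nonneg measurableSet_Ioi fun t ht =>
    mul_nonneg (Real.rpow_nonneg (le_of_lt ht) _) (hξ.nonneg _)
  set W := ∫ x, |w x| with hW
  have hW0 : 0 ≤ W := integral_nonneg fun _ => abs_nonneg _
  have h20 : (0 : ℝ) < 2 ^ (1 + ϱ) := by positivity
  refine ⟨(D + 2 ^ (1 + ϱ)) * J * W, by positivity, fun T R hT hR hψ => ?_⟩
  have hT0 : 0 < T := by linarith
  have hξc := hξ.contDiff.continuous
  have cont : ∀ c : ℝ, Continuous fun t : ℝ => ξ (t / c) := fun c =>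
    hξc.comp (continuous_id.div_const c)
  have vanish : ∀ c : ℝ, 0 < c → ∀ t, 2 * c ≤ t → ξ (t / c) = 0 := fun c hc t ht =>
    h0 _ (by rwa [le_div_iff₀ hc])
  have i1 : IntegrableOn (fun z : ℝ × Space N => z.1 ^ ϱ * w z.2 *
      (h 0 (z.1 / T) * ξ ((R ^ 2)⁻¹ * ‖z.2‖ ^ 2 + 0))) (Ioi 0 ×ˢ univ) volume := by
    refine integrableOn_source (T := T) (η := fun t => h 0 (t / T))
      (ζ := fun x => ξ ((R ^ 2)⁻¹ * ‖x‖ ^ 2 + 0)) (M := 1) hϱ hw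
      ((hh.contDiff 0).continuous.comp (continuous_id.div_const T))
      (fun t ht => hh.eq_zero 0 _ (by rwa [le_div_iff₀ hT0, one_mul]))
      (Continuous.aestronglyMeasurable (by fun_prop)) fun x => ?_
    rw [abs_of_nonneg (hξ.nonneg _)]
    exact hξ.le_one _
  -- ξ(t/c) is a continuous majorant of the indicator of t < c, to which the scaling of
  -- `integral_rpow_mul_comp_div` applies.
  have i2 : ∀ c : ℝ, 0 < c → IntegrableOn (fun z : ℝ × Space N => z.1 ^ ϱ * |w z.2| *
      (ξ (z.1 / c) * (fun _ => 1) z.2)) (Ioi 0 ×ˢ univ) volume := fun c hc =>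
    integrableOn_source (w := fun x => |w x|) (η := fun t => ξ (t / c)) (M := 1) hϱ hw.abs (cont c)
      (vanish c hc) aestronglyMeasurable_const fun x => by simp
  have v2 : ∀ c : ℝ, 0 < c → ∫ z in Ioi 0 ×ˢ univ, z.1 ^ ϱ * |w z.2| *
      (ξ (z.1 / c) * (fun _ : Space N => (1 : ℝ)) z.2) = c ^ (1 + ϱ) * J * W := fun c hc => by
    rw [integral_source (fun x => |w x|) (fun t => ξ (t / c)) (fun _ => 1), integral_rpow_mul_comp_div hc, ← hJ]
    simp [hW]
  have i3 : IntegrableOn (fun z : ℝ × Space N => D * T⁻¹ * (z.1 ^ ϱ * |w z.2| *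
      (ξ (z.1 / T) * (fun _ => 1) z.2)) + z.1 ^ ϱ * |w z.2| * (ξ (z.1 / 2) * (fun _ => 1) z.2))
      (Ioi 0 ×ˢ univ) volume := ((i2 T hT0).const_mul _).add (i2 2 two_pos)
  have hle : ∫ z in Ioi 0 ×ˢ univ, z.1 ^ ϱ * w z.2 *
        (h 0 (z.1 / T) * ξ ((R ^ 2)⁻¹ * ‖z.2‖ ^ 2 + 0))
      ≤ ∫ z in Ioi 0 ×ˢ univ, ((D * T⁻¹ * (z.1 ^ ϱ * |w z.2| *
            (ξ (z.1 / T) * (fun _ : Space N => (1 : ℝ)) z.2))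
          + z.1 ^ ϱ * |w z.2| * (ξ (z.1 / 2) * (fun _ : Space N => (1 : ℝ)) z.2))
        + z.1 ^ ϱ * w z.2 * caloricTest N σ₁ ξ h K T R z) := by
    refine setIntegral_mono_on i1 (i3.add hψ)
      (measurableSet_Ioi.prod MeasurableSet.univ) fun z hz => ?_
    obtain ⟨t, x⟩ := z
    have ht : 0 < t := hz.1
    have htT0 : 0 ≤ t / T := by positivity
    simp only [mul_one, caloricTest_eq]
    have hc := hcor T t hT ht.le x
    set S := ∑ k ∈ Finset.range K, caloricCoeff N (2 + σ₁) (k + 1) *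
          (T⁻¹ ^ (k + 1) * h (k + 1) (t / T) *
            (ξ (‖x‖ ^ 2) * (‖x‖ ^ 2) ^ (((k + 1 : ℕ) : ℝ) * (2 + σ₁) / 2)))
    set H := h 0 (t / T)
    have hH0 : 0 ≤ H := hh.nonneg 0 (Nat.zero_le _) _ htT0
    have hH1 : H ≤ 1 := hh.le_one _ htT0
    set χ := ξ (‖x‖ ^ 2)
    set φ := ξ ((R ^ 2)⁻¹ * ‖x‖ ^ 2 + 0)
    set g := ξ (-1 * t + 2) with hg
    have hg0 : 0 ≤ g := hξ.nonneg _
    have hg1 : g ≤ 1 := hξ.le_one _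
    have hχ0 : 0 ≤ χ := hξ.nonneg _
    have hφ1 : φ ≤ 1 := hξ.le_one _
    have hχφ : χ ≤ φ := cutoff_le_cutoff_scale hξ h1 h0 hR _
    have b1 : |S| ≤ D * T⁻¹ * ξ (t / T) := by
      refine hc.trans ?_
      have hs1 : (shell N (Iio 2)).indicator (1 : Space N → ℝ) x ≤ 1 :=
        indicator_le_self' (fun _ _ => zero_le_one) x
      have ht1 : (Iio T).indicator (1 : ℝ → ℝ) t ≤ ξ (t / T) := by
        by_cases htT : t < T
        · rw [h1 (t / T) (by rw [div_le_one hT0]; exact htT.le)]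
          exact indicator_le_self' (fun _ _ => zero_le_one) t
        · rw [indicator_of_notMem (show t ∉ Iio T from htT)]
          exact hξ.nonneg _
      have hs0 : 0 ≤ (Iio T).indicator (1 : ℝ → ℝ) t := indicator_nonneg (fun _ _ => zero_le_one) t
      calc _ ≤ D * T⁻¹ * (Iio T).indicator (1 : ℝ → ℝ) t * 1 := by gcongr
        _ ≤ _ := by rw [mul_one]; gcongr
    have b2 : (1 - g) * (H * (φ - χ)) ≤ ξ (t / 2) := by
      rcases lt_or_ge t 2 with ht2 | ht2
      · rw [h1 (t / 2) (by linarith)]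
        exact mul_le_one₀ (by linarith) (mul_nonneg hH0 (by linarith))
          (mul_le_one₀ hH1 (by linarith) (by linarith))
      · have hgone : g = 1 := h1 _ (by linarith)
        rw [hgone, sub_self, zero_mul]
        exact hξ.nonneg _
    have b3 : 0 ≤ (1 - g) * (H * (φ - χ)) :=
      mul_nonneg (by linarith) (mul_nonneg hH0 (by linarith))
    have htr : 0 ≤ t ^ ϱ := by positivity
    have hdiff : |H * φ - (S + H * χ + g * H * (φ - χ))| ≤ D * T⁻¹ * ξ (t / T) + ξ (t / 2) := by
      have : H * φ - (S + H * χ + g * H * (φ - χ)) = (1 - g) * (H * (φ - χ)) - S := by ring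
      rw [this]
      refine (abs_sub _ _).trans ?_
      rw [abs_of_nonneg b3]
      linarith
    have hmul : w x * (H * φ - (S + H * χ + g * H * (φ - χ)))
        ≤ |w x| * (D * T⁻¹ * ξ (t / T) + ξ (t / 2)) := by
      refine (le_abs_self _).trans ?_
      rw [abs_mul]
      gcongr
    have := mul_le_mul_of_nonneg_left hmul htr
    linarith
  rw [integral_source w (fun t => h 0 (t / T)) (fun x => ξ ((R ^ 2)⁻¹ * ‖x‖ ^ 2 + 0)),
    integral_rpow_mul_comp_div hT0, integral_add i3 hψ,
    integral_add ((i2 T hT0).const_mul _) (i2 2 two_pos), integral_const_mul, v2 T hT0,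
    v2 2 two_pos] at hle
  rw [← mul_assoc]
  refine hle.trans (add_le_add ?_ le_rfl)
  have e : D * T⁻¹ * (T ^ (1 + ϱ) * J * W) = D * J * W * T ^ ϱ := by
    rw [Real.rpow_add hT0, Real.rpow_one]
    field_simp
  rw [e]
  have hTϱ : 0 ≤ T ^ ϱ := by positivity
  have q1 : 0 ≤ D * J * W := by positivity
  have q2 : 0 ≤ 2 ^ (1 + ϱ) * J * W * T ^ ϱ := by positivity
  linarith

/-- The case where `|x|^(σ₁p' - σ₂/(p-1))` is not integrable near the origin. -/
theorem IsGlobalWeakSolution.false_of_not_locallyIntegrable (hN : 2 ≤ N) (hσ₁ : -2 < σ₁)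
    (hp : 1 < p) (hϱ : -1 < ϱ) (hw : Integrable w volume) (hw_pos : 0 < ∫ x, w x)
    (hu : IsGlobalWeakSolution σ₁ σ₂ ϱ p w u₀ u)
    (hloc : σ₁ * (p / (p - 1)) + -σ₂ / (p - 1) ≤ -N) : False := by
  have hs : 0 < 2 + σ₁ := by linarith
  have hp1 : 0 < p - 1 := by linarith
  have hp'0 : 0 < p / (p - 1) := by positivity
  -- Each further term of the series raises the exponent by (2+σ₁)p' > 0.
  obtain ⟨K, hK⟩ : ∃ K : ℕ, -(N : ℝ) < (σ₁ + K * (2 + σ₁)) * (p / (p - 1)) + -σ₂ / (p - 1) := by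
    have hpos : 0 < (2 + σ₁) * (p / (p - 1)) := by positivity
    obtain ⟨K, hK⟩ := exists_nat_gt
      ((-(N : ℝ) - (σ₁ * (p / (p - 1)) + -σ₂ / (p - 1))) / ((2 + σ₁) * (p / (p - 1))))
    refine ⟨K, ?_⟩
    rw [div_lt_iff₀ hpos] at hK
    linarith
  obtain ⟨ξ, hξ, h1, h0⟩ := exists_isCutoff hp
  obtain ⟨h, hh⟩ := exists_isDecayFamily hp K
  obtain ⟨C₁, hC₁, hest⟩ := hu.exists_caloric_estimate hN hσ₁ hp hϱ hw hξ h1 h0 hh hK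
  obtain ⟨C₂, hC₂, hini⟩ := hu.exists_caloric_initial_ge hN hσ₁ hp hϱ hw hξ h0 hh
  obtain ⟨C₃, hC₃, hsrc⟩ := exists_caloric_source_ge (N := N) (σ₁ := σ₁) hN hσ₁ hp hϱ hw hξ h1 h0 hh
  -- T = R^ν makes the Laplacian term T R^(N-2p'+b) equal to 1. Positivity of ν follows from N + b ≤
  -- -σ₁p' < 2p'.
  set ν := -(N - 2 * (p / (p - 1)) + -σ₂ / (p - 1)) with hν
  have hν0 : 0 < ν := by nlinarith
  set κ := ν * (1 + ϱ) with hκ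
  have hκ0 : 0 < κ := mul_pos hν0 (by linarith)
  -- The loss R^(κ/2) stays below the growth R^κ = T^(1+ϱ) of the source term.
  obtain ⟨V, hV, hVle⟩ := exists_integral_shell_Icc_le hN hloc (half_pos hκ0)
  set I := ∫ t in Ioi (0 : ℝ), t ^ ϱ * h 0 t with hI
  have hI0 : 0 < I := by
    have hint := integrableOn_rpow_mul hϱ (hh.contDiff 0).continuous (T := 1) (hh.eq_zero 0)
    have hnn : ∀ t ∈ Ioi (0 : ℝ), 0 ≤ t ^ ϱ * h 0 t := fun t ht =>
      mul_nonneg (Real.rpow_nonneg (le_of_lt ht) _) (hh.nonneg 0 (Nat.zero_le _) t (le_of_lt ht))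
    rw [hI, setIntegral_pos_iff_support_of_nonneg_ae
      ((ae_restrict_iff' measurableSet_Ioi).2 (Eventually.of_forall hnn)) hint]
    have hsub : Ioo (0 : ℝ) 1 ⊆ Function.support (fun t => t ^ ϱ * h 0 t) ∩ Ioi 0 := fun t ht =>
      ⟨(mul_pos (Real.rpow_pos_of_pos ht.1 _) (hh.pos t ht.2)).ne', ht.1⟩
    refine lt_of_lt_of_le ?_ (measure_mono hsub)
    simp
  have hmain : ∀ R : ℝ, 2 ≤ R →
      I * ∫ x, w x * ξ ((R ^ 2)⁻¹ * ‖x‖ ^ 2 + 0)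
        ≤ (2 * C₁ + C₂ + C₃) * R ^ (-κ) + C₁ * V * R ^ (-(κ / 2)) + C₃ * R ^ (-ν) := by
    intro R hR
    have hR0 : 0 < R := by linarith
    have hT : 1 ≤ R ^ ν := Real.one_le_rpow (by linarith) hν0.le
    have e1 := hest (R ^ ν) R hT hR
    have e2 := hini (R ^ ν) R hT
    have e3 := hsrc (R ^ ν) R hT hR
      (hu.isTestPair_caloric hN hσ₁ hp hϱ hw hξ h0 hh (by linarith) hR0).integrable_source
    have e4 := hVle R (by linarith)
    have f1 : R ^ ν * R ^ (N - 2 * (p / (p - 1)) + -σ₂ / (p - 1)) = 1 := by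
      rw [← Real.rpow_add hR0, hν, neg_add_cancel, Real.rpow_zero]
    rw [f1] at e1
    rw [← Real.rpow_mul hR0.le, ← Real.rpow_mul hR0.le, ← hκ] at e3
    have e5 := mul_le_mul_of_nonneg_left e4 hC₁
    have e6 : R ^ κ * (I * ∫ x, w x * ξ ((R ^ 2)⁻¹ * ‖x‖ ^ 2 + 0))
        ≤ 2 * C₁ + C₂ + C₃ + C₁ * V * R ^ (κ / 2) + C₃ * R ^ (ν * ϱ) := by linarith
    have hRκ : 0 < R ^ (-κ) := by positivity
    have e7 := mul_le_mul_of_nonneg_left e6 hRκ.le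
    have g1 : R ^ (-κ) * R ^ κ = 1 := by rw [← Real.rpow_add hR0, neg_add_cancel, Real.rpow_zero]
    have g2 : R ^ (-κ) * R ^ (κ / 2) = R ^ (-(κ / 2)) := by
      rw [← Real.rpow_add hR0, show -κ + κ / 2 = -(κ / 2) by ring]
    have g3 : R ^ (-κ) * R ^ (ν * ϱ) = R ^ (-ν) := by
      rw [← Real.rpow_add hR0, show -κ + ν * ϱ = -ν by rw [hκ]; ring]
    calc _ = R ^ (-κ) * R ^ κ * (I * ∫ x, w x * ξ ((R ^ 2)⁻¹ * ‖x‖ ^ 2 + 0)) := by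
          rw [g1, one_mul]
      _ ≤ R ^ (-κ) * (2 * C₁ + C₂ + C₃ + C₁ * V * R ^ (κ / 2) + C₃ * R ^ (ν * ϱ)) := by
          rw [mul_assoc]; exact e7
      _ = (2 * C₁ + C₂ + C₃) * R ^ (-κ) + C₁ * V * (R ^ (-κ) * R ^ (κ / 2))
          + C₃ * (R ^ (-κ) * R ^ (ν * ϱ)) := by ring
      _ = _ := by rw [g2, g3]
  have hlim : Tendsto (fun R : ℝ =>
      (2 * C₁ + C₂ + C₃) * R ^ (-κ) + C₁ * V * R ^ (-(κ / 2)) + C₃ * R ^ (-ν)) atTop (𝓝 0) := by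
    simpa using (((tendsto_rpow_neg_atTop hκ0).const_mul (2 * C₁ + C₂ + C₃)).add
      ((tendsto_rpow_neg_atTop (half_pos hκ0)).const_mul (C₁ * V))).add
      ((tendsto_rpow_neg_atTop hν0).const_mul C₃)
  have := le_of_tendsto_of_tendsto ((tendsto_integral_mul_cutoff hN hw hξ h1).const_mul I) hlim
    ((eventually_ge_atTop 2).mono hmain)
  exact absurd this (not_le.2 (mul_pos hI0 hw_pos))
end

end

/-! ### The three cases. -/

theorem theorem1p1 (N : ℕ) (hN : 2 ≤ N) (σ₁ σ₂ ϱ p : ℝ) (hσ₁ : -2 < σ₁) (hσ₂ : -2 < σ₂)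
    (hp : 1 < p) (u₀ w : EuclideanSpace ℝ (Fin N) → ℝ)
    (hu₀ : LocallyIntegrable u₀ volume) (hw : Integrable w volume) (hw_pos : 0 < ∫ x, w x) :
    (0 < ϱ → ¬ ∃ u, IsGlobalWeakSolution σ₁ σ₂ ϱ p w u₀ u) ∧
    (-1 < ϱ → ϱ < 0 →
      p < ((N : ℝ) + σ₂ - ϱ * (2 + σ₁)) / ((N : ℝ) - 2 - ϱ * (2 + σ₁)) →
        ¬ ∃ u, IsGlobalWeakSolution σ₁ σ₂ ϱ p w u₀ u) ∧
    (ϱ = 0 → (N = 2 ∨ p ≤ ((N : ℝ) + σ₂) / ((N : ℝ) - 2)) →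
        ¬ ∃ u, IsGlobalWeakSolution σ₁ σ₂ ϱ p w u₀ u) := by
  have hp1 : 0 < p - 1 := by linarith
  have hN' : (2 : ℝ) ≤ N := by exact_mod_cast hN
  -- Translates the thresholds for p into conditions on N - 2p' + b.
  have hexp : ∀ c : ℝ, c - 2 * (p / (p - 1)) + -σ₂ / (p - 1)
      = (c * (p - 1) - 2 * p - σ₂) / (p - 1) := fun c => by field_simp; ring
  refine ⟨fun hϱ => ?_, fun hϱ hϱ0 hlt => ?_, fun hϱ hcase => ?_⟩
  · rintro ⟨u, hu⟩
    exact hu.false_of_pos hN hp hϱ hw hw_pos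
  · rintro ⟨u, hu⟩
    have hneg : ϱ * (2 + σ₁) < 0 := mul_neg_of_neg_of_pos hϱ0 (by linarith)
    rw [lt_div_iff₀ (by linarith)] at hlt
    have hsub : (N : ℝ) - 2 * (p / (p - 1)) + -σ₂ / (p - 1) < ϱ * (2 + σ₁) := by
      rw [hexp, div_lt_iff₀ hp1]
      linarith
    -- Subcriticality is used only if the weight is integrable at the origin; the other alternative
    -- is contradictory for every p > 1.
    rcases lt_or_ge (-(N : ℝ)) (σ₁ * (p / (p - 1)) + -σ₂ / (p - 1)) with hloc | hloc
    · exact hu.false_of_subcritical hN hσ₁ hp hϱ hw hw_pos hloc hsub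
    · exact hu.false_of_not_locallyIntegrable hN hσ₁ hp hϱ hw hw_pos hloc
  · subst hϱ
    rintro ⟨u, hu⟩
    -- Cleared of its denominator the condition also makes sense for N = 2, where it is 0 ≤ 2 + σ₂
    -- and strict because σ₂ > -2.
    have hle : p * ((N : ℝ) - 2) ≤ N + σ₂ := by
      rcases hcase with h2 | h2
      · rw [h2]
        push_cast
        linarith
      · rcases hN'.eq_or_lt with h | h
        · rw [← h]
          linarith
        · rwa [le_div_iff₀ (by linarith)] at h2
    rcases hle.eq_or_lt with h | h
    · refine hu.false_of_critical hN hσ₁ hp hw hw_pos ?_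
      have := hexp 0
      rw [zero_sub, ← neg_mul, zero_mul, zero_sub] at this
      rw [this, div_eq_iff hp1.ne']
      linarith
    · have hsub : (N : ℝ) - 2 * (p / (p - 1)) + -σ₂ / (p - 1) < 0 * (2 + σ₁) := by
        rw [hexp, div_lt_iff₀ hp1]
        linarith
      rcases lt_or_ge (-(N : ℝ)) (σ₁ * (p / (p - 1)) + -σ₂ / (p - 1)) with hloc | hloc
      · exact hu.false_of_subcritical hN hσ₁ hp (by norm_num) hw hw_pos hloc hsub
      · exact hu.false_of_not_locallyIntegrable hN hσ₁ hp (by norm_num) hw hw_pos hloc
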